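/- Let $q=2^n$ with $n\ge 2$, $G=\mathrm{SL}_2(q)$, $\zeta_r=e^{2\pi i/r}$ and $\vartheta_r^{(s)}=\zeta_r^s+\zeta_r^{-s}$. Let $\nu$ be a generator of $\mathbb F_q^\times$, $c=\begin{pmatrix}1&0\\1&1\end{pmatrix}$, $a=\begin{pmatrix}\nu&0\\0&\nu^{-1}\end{pmatrix}$, and let $b\in G$ be an element of order $q+1$. By the classical character table of $G$, the non-trivial irreducible complex characters of $G$ are the irreducible characters with the following values ($1\le\ell\le\frac{q-2}{2}$, $1\le m\le \frac q2$): $$\begin{array}{c|cccc} & 1 & c & a^\ell & b^m\\ \hline \psi & q&0&1&-1\\ \chi_i\ (1\le i\le \frac{q-2}{2}) & q+1&1&\vartheta_{q-1}^{(i\ell)}&0\\ \theta_j\ (1\le j\le \frac q2)& q-1&-1&0&-\vartheta_{q+1}^{(jm)}\end{array}$$ For an irreducible character $\chi$ afforded by the $\mathbb CG$-module $V$, let $K=\mathbb Q(\chi)^+$ be the maximal real subfield of the character field $\mathbb{Q}(\chi)$, let $W$ be an irreducible $KG$-module such that $V$ is a constituent of $\mathbb C\otimes_K W$, and let $F$ be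 a non-zero $G$-invariant symmetric bilinear form on $W$. Put $N=\dim_K W$. The discriminant of $(W,F)$ is $d_\pm(W,F)=(-1)^{N(N-1)/2}\det(W,F)$ modulo $(K^\times)^2$. The algebra $c(W,F)$ is the Clifford algebra of $(W,\,v\mapsto\frac12F(v,v))$ if $N$ is even and its even subalgebra if $N$ is odd; its class in $\mathrm{Br}(K)$ is the Clifford invariant of $(W,F)$. If $N$ is even, $d_\pm(\chi)$ is the discriminant of $(W,F)$. If $N$ is odd, or if $N$ is even, $d_\pm(\chi)=1$ and all $G$-invariant symmetric bilinear forms on $W$ are $K$-multiples of $F$, then $\mathfrak c(\chi)$ is the Clifford invariant of $(W,F)$. The following claims include that such $(W,F)$ exist, that the invariants concerned are defined, and that they do not depend on the choice of $(W,F)$. Theorem. 1. $\mathbb Q(\psi)=\mathbb Q$ and $d_\pm(\psi)=q+1$ modulo $(\mathbb{Q}^\times)^2$. 2. Let $1\le i\le\frac{q-2}{2}$. Then $K=\mathbb Q(\chi_i)^+=\mathbb Q(\chi_i)=\mathbb Q(\vartheta_{q-1}^{(i)})$, and $\mathfrak c(\chi_i)\in \mathrm{Br}(K)$ is defined. If $n$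 is odd, then $\mathfrak c(\chi_i)=1$. For arbitrary $n$, if $\wp$ is a maximal ideal of the ring of integers $\mathbb{Z}_K$ with $\wp\cap\mathbb Z=p\mathbb Z$ for an odd prime $p$, then the class of $c(W,F)\otimes_K K_\wp$ in $\mathrm{Br}(K_\wp)$ is non-trivial if and only if $p\equiv\pm3\pmod 8$ and $(q-1)/\gcd(q-1,i)$ is a power of $p$. 3. Let $1\le j\le\frac q2$. Then $\mathbb Q(\theta_j)^+=\mathbb Q(\theta_j)$. If $q=4$, then $\mathbb Q(\theta_j)=\mathbb Q(\sqrt5)$ and $\mathfrak c(\theta_j)=(-1,-1)\in\mathrm{Br}(\mathbb Q(\sqrt5))$, the class of the quaternion algebra $\left(\frac{-1,-1}{\mathbb{Q}(\sqrt5)}\right)$. If $q\ge8$, then $\mathfrak c(\theta_j)=1\in\mathrm{Br}(\mathbb Q(\theta_j))$. -/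

import Mathlib

open scoped TensorProduct NumberField

noncomputable section

namespace OrthChar

/-! ### Brauer classes -/

/-- `A` and `B` are (isomorphic to) finite-dimensional central simple `K`-algebras which have the
same class in the Brauer group of `K`. -/
def SameBrauerClass.{u, v} (K : Type u) [Field K] (A B : Type v) [Ring A] [Algebra K A]
    [Ring B] [Algebra K B] : Prop :=
  ∃ A' B' : CSA.{u, v} K, Nonempty (A' ≃ₐ[K] A) ∧ Nonempty (B' ≃ₐ[K] B) ∧ IsBrauerEquivalent A' B'

/-! ### Invariants of quadratic spaces -/

section Quadratic

variable {K W : Type*} [Field K] [AddCommGroup W] [Module K W]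

/-- The signed discriminant `(-1)^(n(n-1)/2) det(W, F)`, `n = dim W`, is the class of `d` modulo
nonzero squares (with respect to any basis of `W`). -/
def HasSignedDisc (F : LinearMap.BilinForm K W) (d : K) : Prop :=
  ∀ β : Module.Basis (Fin (Module.finrank K W)) K W, ∃ u : Kˣ,
    (-1) ^ (Module.finrank K W * (Module.finrank K W - 1) / 2) *
      (LinearMap.BilinForm.toMatrix β F).det = (u : K) ^ 2 * d

/-- The quadratic form `v ↦ F(v, v) / 2`. -/
def halfQuadraticForm (F : LinearMap.BilinForm K W) : QuadraticForm K W :=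
  (2⁻¹ : K) • F.toQuadraticMap

open Classical in
/-- The algebra `c(W, F)`: the Clifford algebra (in which `v * v = F(v, v) / 2`) if `dim W` is
even, and its even subalgebra if `dim W` is odd. -/
def cliffordPart (F : LinearMap.BilinForm K W) :
    Subalgebra K (CliffordAlgebra (halfQuadraticForm F)) :=
  if Even (Module.finrank K W) then ⊤ else CliffordAlgebra.even (halfQuadraticForm F)

end Quadratic

/-! ### Character fields -/

section CharField

variable {G V : Type*} [Group G] [AddCommGroup V] [Module ℂ V]

/-- The character field `ℚ(χ)`. -/
def charField (ρ : Representation ℂ G V) : IntermediateField ℚ ℂ :=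
  IntermediateField.adjoin ℚ (Set.range ρ.character)

/-- The maximal real subfield `ℚ(χ)⁺ = ℚ(χ) ∩ ℝ` of the character field. -/
def realCharField (ρ : Representation ℂ G V) : IntermediateField ℚ ℂ :=
  charField ρ ⊓ (⊥ : IntermediateField ℝ ℂ).restrictScalars ℚ

theorem isIntegral_character [Finite G] [FiniteDimensional ℂ V] (ρ : Representation ℂ G V)
    (g : G) : IsIntegral ℚ (ρ.character g) := by
  have hsum : ρ.character g = (ρ g).charpoly.roots.sum :=
    Module.End.trace_eq_sum_roots_charpoly_of_splits (IsAlgClosed.splits _)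
  rw [hsum]
  refine IsIntegral.multiset_sum fun μ hμ => ?_
  have hev : Module.End.HasEigenvalue (ρ g) μ :=
    (Module.End.hasEigenvalue_iff_isRoot_charpoly _ _).mpr (Polynomial.isRoot_of_mem_roots hμ)
  obtain ⟨v, hv⟩ := hev.exists_hasEigenvector
  have hpow : μ ^ Nat.card G = 1 := by
    have h1 : ((ρ g) ^ Nat.card G) v = μ ^ Nat.card G • v := hv.pow_apply _
    rw [← map_pow, pow_card_eq_one', map_one] at h1
    have h2 : (1 - μ ^ Nat.card G) • v = 0 := by
      rw [sub_smul, one_smul, ← h1]; simp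
    rcases smul_eq_zero.mp h2 with h | h
    · exact (sub_eq_zero.mp h).symm
    · exact absurd h hv.2
  exact IsIntegral.of_pow Nat.card_pos (by rw [hpow]; exact isIntegral_one)

instance numberField_realCharField [Finite G] [FiniteDimensional ℂ V]
    (ρ : Representation ℂ G V) : NumberField (realCharField ρ) := by
  have h1 : FiniteDimensional ℚ (charField ρ) := by
    refine IntermediateField.finiteDimensional_adjoin ?_
    rintro _ ⟨g, rfl⟩
    exact isIntegral_character ρ g
  have h2 : FiniteDimensional ℚ (realCharField ρ) :=
    have hle : realCharField ρ ≤ charField ρ := inf_le_left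
    FiniteDimensional.of_injective (IntermediateField.inclusion hle).toLinearMap
      (IntermediateField.inclusion_injective hle)
  exact { to_charZero := inferInstance, to_finiteDimensional := h2 }

end CharField

/-! ### Orthogonal invariants of a character -/

section OrthInvariants

variable {G V : Type*} [Group G] [AddCommGroup V] [Module ℂ V]

/-- `F` is a symmetric bilinear form that is invariant under the representation `σ`. -/
def IsInvariantForm {K W : Type*} [Field K] [AddCommGroup W] [Module K W]
    (σ : Representation K G W) (F : LinearMap.BilinForm K W) : Prop :=
  (∀ v w, F v w = F w v) ∧ ∀ g v w, F (σ g v) (σ g w) = F v w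

/-- A pair `(W, F)` where, with `K = ℚ(χ)⁺`, `W` is an irreducible `KG`-module such that `V` is a
constituent of `ℂ ⊗ W` and `F` is a nonzero `G`-invariant symmetric bilinear form on `W`. Here `V`
is the (irreducible) `ℂG`-module affording `χ`. -/
structure OrthModel (ρ : Representation ℂ G V) where
  W : Type
  [addCommGroup : AddCommGroup W]
  [module : Module (realCharField ρ) W]
  [finiteDimensional : FiniteDimensional (realCharField ρ) W]
  σ : Representation (realCharField ρ) G W
  irreducible : σ.IsIrreducible
  constituent : ∃ f : V →ₗ[ℂ] (ℂ ⊗[realCharField ρ] W), Function.Injective f ∧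
    ∀ g v, f (ρ g v) = (σ g).baseChange ℂ (f v)
  F : LinearMap.BilinForm (realCharField ρ) W
  invariant : IsInvariantForm σ F
  ne_zero : F ≠ 0

attribute [instance] OrthModel.addCommGroup OrthModel.module OrthModel.finiteDimensional

variable {ρ : Representation ℂ G V}

/-- The dimension of `W` over `K`. -/
def OrthModel.dim (M : OrthModel ρ) : ℕ := Module.finrank (realCharField ρ) M.W

/-- `W` is uniform: the space of invariant symmetric bilinear forms is one-dimensional. -/
def OrthModel.Uniform (M : OrthModel ρ) : Prop :=
  ∀ F' : LinearMap.BilinForm (realCharField ρ) M.W, IsInvariantForm M.σ F' →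
    ∃ a : realCharField ρ, F' = a • M.F

/-- The condition under which the Clifford invariant of the character is defined. -/
def OrthModel.CliffordDefined (M : OrthModel ρ) : Prop :=
  Odd M.dim ∨ (Even M.dim ∧ M.Uniform ∧ HasSignedDisc M.F 1)

/-- The algebra `c(W, F)`. -/
abbrev OrthModel.c (M : OrthModel ρ) :
    Subalgebra (realCharField ρ) (CliffordAlgebra (halfQuadraticForm M.F)) :=
  cliffordPart M.F

variable (ρ)

/-- `d±(χ)` is defined and equal to the square class of `d`. -/
def DiscEq (d : realCharField ρ) : Prop :=
  Nonempty (OrthModel ρ) ∧ ∀ M : OrthModel ρ, Even M.dim ∧ HasSignedDisc M.F d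

/-- The Clifford invariant of `χ` is defined and equal to the class of `B` in `Br(K)`,
`K = ℚ(χ)⁺`. -/
def CliffordEq (B : Type) [Ring B] [Algebra (realCharField ρ) B] : Prop :=
  Nonempty (OrthModel ρ) ∧ ∀ M : OrthModel ρ,
    M.CliffordDefined ∧ SameBrauerClass (realCharField ρ) M.c B

/-- `[c(W, F) ⊗ K_℘]` is trivial in the Brauer group of the completion `K_℘`. -/
def OrthModel.LocallyTrivial [Finite G] [FiniteDimensional ℂ V] (M : OrthModel ρ)
    (v : IsDedekindDomain.HeightOneSpectrum (𝓞 (realCharField ρ))) : Prop :=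
  SameBrauerClass (v.adicCompletion (realCharField ρ))
    (v.adicCompletion (realCharField ρ) ⊗[realCharField ρ] M.c)
    (v.adicCompletion (realCharField ρ))

end OrthInvariants

/-! ### The character table of `SL₂(q)`, `q` even -/

/-- `ζ_r = exp(2πi/r)`. -/
def zeta (r : ℕ) : ℂ := Complex.exp (2 * Real.pi * Complex.I / r)

/-- `ϑ_r^(s) = ζ_r^s + ζ_r^(-s)`. -/
def vartheta (r s : ℕ) : ℂ := zeta r ^ s + (zeta r ^ s)⁻¹

section Table

variable {F : Type*} [Field F]

/-- The matrix `(1 0; 1 1)`. -/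
def matC : Matrix.SpecialLinearGroup (Fin 2) F := ⟨!![1, 0; 1, 1], by simp⟩

/-- The matrix `(ν 0; 0 ν⁻¹)`. -/
def matA (ν : Fˣ) : Matrix.SpecialLinearGroup (Fin 2) F :=
  ⟨!![(ν : F), 0; 0, (ν⁻¹ : Fˣ)], by simp⟩

/-- The row of the Steinberg character `ψ` in the character table. -/
def IsPsi (q : ℕ) (ν : Fˣ) (b : Matrix.SpecialLinearGroup (Fin 2) F)
    (χ : Matrix.SpecialLinearGroup (Fin 2) F → ℂ) : Prop :=
  χ 1 = q ∧ χ matC = 0 ∧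
  (∀ l ∈ Finset.Icc 1 ((q - 2) / 2), χ (matA ν ^ l) = 1) ∧
  ∀ m ∈ Finset.Icc 1 (q / 2), χ (b ^ m) = -1

/-- The row of the character `χ_i` in the character table. -/
def IsChi (q : ℕ) (ν : Fˣ) (b : Matrix.SpecialLinearGroup (Fin 2) F) (i : ℕ)
    (χ : Matrix.SpecialLinearGroup (Fin 2) F → ℂ) : Prop :=
  χ 1 = q + 1 ∧ χ matC = 1 ∧
  (∀ l ∈ Finset.Icc 1 ((q - 2) / 2), χ (matA ν ^ l) = vartheta (q - 1) (i * l)) ∧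
  ∀ m ∈ Finset.Icc 1 (q / 2), χ (b ^ m) = 0

/-- The row of the character `θ_j` in the character table. -/
def IsTheta (q : ℕ) (ν : Fˣ) (b : Matrix.SpecialLinearGroup (Fin 2) F) (j : ℕ)
    (χ : Matrix.SpecialLinearGroup (Fin 2) F → ℂ) : Prop :=
  χ 1 = q - 1 ∧ χ matC = -1 ∧
  (∀ l ∈ Finset.Icc 1 ((q - 2) / 2), χ (matA ν ^ l) = 0) ∧
  ∀ m ∈ Finset.Icc 1 (q / 2), χ (b ^ m) = -vartheta (q + 1) (j * m)

end Table

end OrthChar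

end

noncomputable section
namespace OrthChar

section MatrixOver

/-- `A` is isomorphic to a full matrix algebra over `B`. -/
def IsMatrixOver (K A B : Type*) [Field K] [Ring A] [Algebra K A] [Ring B] [Algebra K B] : Prop :=
  ∃ N : ℕ, N ≠ 0 ∧ Nonempty (A ≃ₐ[K] Matrix (Fin N) (Fin N) B)

variable {K A B C : Type*} [Field K] [Ring A] [Algebra K A] [Ring B] [Algebra K B]
  [Ring C] [Algebra K C]

theorem IsMatrixOver.of_matrix {n : Type*} [Fintype n] [DecidableEq n] [Nonempty n]
    (e : A ≃ₐ[K] Matrix n n B) : IsMatrixOver K A B :=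
  ⟨Fintype.card n, Fintype.card_ne_zero,
    ⟨e.trans (Matrix.reindexAlgEquiv K B (Fintype.equivFin n))⟩⟩

theorem IsMatrixOver.of_equiv (e : A ≃ₐ[K] B) : IsMatrixOver K A B :=
  .of_matrix (n := Unit) (e.trans (Matrix.uniqueAlgEquiv (m := Unit) (R := K) (A := B)).symm)

theorem IsMatrixOver.trans (h : IsMatrixOver K A B) (h' : IsMatrixOver K B C) :
    IsMatrixOver K A C := by
  obtain ⟨N, hN, ⟨e⟩⟩ := h
  obtain ⟨M, hM, ⟨e'⟩⟩ := h'
  have : Nonempty (Fin N × Fin M) := ⟨(⟨0, by omega⟩, ⟨0, by omega⟩)⟩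
  exact .of_matrix (n := Fin N × Fin M)
    ((e.trans e'.mapMatrix).trans (Matrix.compAlgEquiv (Fin N) (Fin M) C K))

end MatrixOver

section DiagClifford

variable {K : Type*} [Field K] {ι κ : Type*} [Fintype ι] [DecidableEq ι] [Fintype κ] [DecidableEq κ]
  {A B : Type*} [Ring A] [Algebra K A] [Ring B] [Algebra K B]

/-- The Clifford algebra of the diagonal form with coefficients `w`. -/
abbrev DiagClifford (w : ι → K) : Type _ := CliffordAlgebra (QuadraticMap.weightedSumSquares K w)

namespace DiagClifford

/-- The generator attached to the `i`-th basis vector. -/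
def gen (w : ι → K) (i : ι) : DiagClifford w := CliffordAlgebra.ι _ (Pi.single i 1)

theorem gen_mul_self (w : ι → K) (i : ι) : gen w i * gen w i = algebraMap K _ (w i) := by
  rw [gen, CliffordAlgebra.ι_sq_scalar]
  congr 1
  rw [QuadraticMap.weightedSumSquares_apply, Finset.sum_eq_single i]
  · simp
  · intro j _ hj; simp [Pi.single_eq_of_ne hj]
  · simp

theorem gen_anticomm (w : ι → K) {i j : ι} (h : i ≠ j) :
    gen w i * gen w j = -(gen w j * gen w i) := by
  rw [gen, gen]
  apply CliffordAlgebra.ι_mul_ι_comm_of_isOrtho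
  rw [QuadraticMap.isOrtho_def]
  simp only [QuadraticMap.weightedSumSquares_apply, ← Finset.sum_add_distrib]
  refine Finset.sum_congr rfl fun k _ => ?_
  by_cases hi : k = i
  · subst hi; simp [Pi.single_eq_of_ne h]
  · simp [Pi.single_eq_of_ne hi]

theorem adjoin_range_gen (w : ι → K) : Algebra.adjoin K (Set.range (gen w)) = ⊤ := by
  rw [eq_top_iff, ← CliffordAlgebra.adjoin_range_ι, Algebra.adjoin_le_iff]
  rintro _ ⟨v, rfl⟩
  have hv : v = ∑ i, v i • (Pi.single i 1 : ι → K) := by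
    ext j; simp [Finset.sum_apply, Pi.single_apply]
  rw [hv, map_sum]
  refine Subalgebra.sum_mem _ fun i _ => ?_
  rw [map_smul]
  exact Subalgebra.smul_mem _ (Algebra.subset_adjoin (Set.mem_range_self i)) _

theorem algHom_ext {w : ι → K} {f g : DiagClifford w →ₐ[K] A}
    (h : ∀ i, f (gen w i) = g (gen w i)) : f = g := by
  refine AlgHom.ext_of_adjoin_eq_top (adjoin_range_gen w) ?_
  rintro _ ⟨i, rfl⟩
  exact h i

omit [DecidableEq ι] in
theorem sum_smul_mul_self [NeZero (2 : K)] (w : ι → K) (x : ι → A)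
    (hsq : ∀ i, x i * x i = algebraMap K A (w i))
    (hanti : ∀ i j, i ≠ j → x i * x j = -(x j * x i)) (v : ι → K) :
    (∑ i, v i • x i) * (∑ i, v i • x i) =
      algebraMap K A (QuadraticMap.weightedSumSquares K w v) := by
  have h2 : (2 : K) ≠ 0 := NeZero.ne 2
  set S := (∑ i, v i • x i) * (∑ i, v i • x i) with hS
  have h1 : S = ∑ i, ∑ j, (v i * v j) • (x i * x j) := by
    rw [hS, Finset.sum_mul_sum]
    refine Finset.sum_congr rfl fun i _ => Finset.sum_congr rfl fun j _ => ?_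
    rw [smul_mul_smul_comm]
  have h3 : S = ∑ i, ∑ j, (v i * v j) • (x j * x i) := by
    rw [h1, Finset.sum_comm]
    refine Finset.sum_congr rfl fun i _ => Finset.sum_congr rfl fun j _ => ?_
    rw [mul_comm]
  have h4 : (2 : K) • S = (2 : K) • algebraMap K A (QuadraticMap.weightedSumSquares K w v) := by
    rw [two_smul]
    nth_rewrite 1 [h1]
    rw [h3, ← Finset.sum_add_distrib, QuadraticMap.weightedSumSquares_apply, map_sum,
      Finset.smul_sum]
    refine Finset.sum_congr rfl fun i _ => ?_
    rw [← Finset.sum_add_distrib, Finset.sum_eq_single i]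
    · rw [← two_smul K, hsq, Algebra.algebraMap_eq_smul_one, Algebra.algebraMap_eq_smul_one]
      simp only [smul_smul, smul_eq_mul]
      congr 1; ring
    · intro j _ hj
      rw [← smul_add, hanti i j hj.symm]; simp
    · simp
  exact smul_right_injective A h2 h4

/-- The universal property of `DiagClifford`. -/
def lift [NeZero (2 : K)] (w : ι → K) (x : ι → A)
    (hsq : ∀ i, x i * x i = algebraMap K A (w i))
    (hanti : ∀ i j, i ≠ j → x i * x j = -(x j * x i)) : DiagClifford w →ₐ[K] A :=
  CliffordAlgebra.lift _ ⟨Fintype.linearCombination K x, fun v => by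
    simpa [Fintype.linearCombination_apply] using sum_smul_mul_self w x hsq hanti v⟩

theorem lift_gen [NeZero (2 : K)] (w : ι → K) (x : ι → A)
    (hsq : ∀ i, x i * x i = algebraMap K A (w i))
    (hanti : ∀ i j, i ≠ j → x i * x j = -(x j * x i)) (i : ι) :
    lift w x hsq hanti (gen w i) = x i := by
  rw [lift, gen, CliffordAlgebra.lift_ι_apply]
  simp

/-- Rescaling and permuting the basis vectors. -/
def congr [NeZero (2 : K)] {w : ι → K} {w' : κ → K} (e : ι ≃ κ) (s : ι → K) (hs : ∀ i, s i ≠ 0)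
    (h : ∀ i, w i = s i ^ 2 * w' (e i)) : DiagClifford w ≃ₐ[K] DiagClifford w' :=
  AlgEquiv.ofAlgHom
    (lift w (fun i => s i • gen w' (e i))
      (fun i => by
        rw [smul_mul_smul_comm, gen_mul_self, h, map_mul, Algebra.smul_def, ← pow_two])
      (fun i j hij => by
        rw [smul_mul_smul_comm, smul_mul_smul_comm, gen_anticomm w' (e.injective.ne hij),
          mul_comm (s i), smul_neg]))
    (lift w' (fun k => (s (e.symm k))⁻¹ • gen w (e.symm k))
      (fun k => by
        rw [smul_mul_smul_comm, gen_mul_self, h, e.apply_symm_apply, Algebra.smul_def, ← map_mul]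
        congr 1
        have := hs (e.symm k)
        field_simp)
      (fun i j hij => by
        rw [smul_mul_smul_comm, smul_mul_smul_comm, gen_anticomm w (e.symm.injective.ne hij),
          mul_comm (s (e.symm i))⁻¹, smul_neg]))
    (algHom_ext fun k => by simp [lift_gen, smul_smul, hs])
    (algHom_ext fun i => by simp [lift_gen, smul_smul, hs])

/-- Permuting the basis vectors. -/
def reindex [NeZero (2 : K)] {w : ι → K} {w' : κ → K} (e : ι ≃ κ) (h : ∀ i, w i = w' (e i)) :
    DiagClifford w ≃ₐ[K] DiagClifford w' :=
  congr e (fun _ => 1) (fun _ => one_ne_zero) (fun i => by simp [h])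

end DiagClifford

theorem bijective_matrix_two [NeZero (2 : K)] (f : A →ₐ[K] Matrix (Fin 2) (Fin 2) B)
    (φ : B →ₐ[K] A) (X Y : A) (c : K) (hc : c ≠ 0) (hX : X * X = 1) (hY : Y * Y = algebraMap K A c)
    (hXY : X * Y = -(Y * X)) (hφX : ∀ b, φ b * X = X * φ b) (hφY : ∀ b, φ b * Y = Y * φ b)
    (hfX : f X = !![1, 0; 0, -1]) (hfY : f Y = !![0, algebraMap K B c; 1, 0])
    (hfφ : ∀ b, f (φ b) = !![b, 0; 0, b])
    (hgen : Algebra.adjoin K ({X, Y} ∪ Set.range φ) = ⊤) : Function.Bijective f := by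
  have h2 : (2 : K) ≠ 0 := NeZero.ne 2
  set P : A := (2⁻¹ : K) • (1 + X) with hP
  set R : A := (2⁻¹ : K) • (1 - X) with hR
  have hPR : P + R = 1 := by
    rw [hP, hR, ← smul_add, show (1 + X + (1 - X) : A) = (2 : K) • 1 by
      rw [two_smul]; abel, smul_smul, inv_mul_cancel₀ h2, one_smul]
  have hXP : X * P = P := by
    rw [hP, mul_smul_comm, mul_add, hX, mul_one, add_comm]
  have hXR : X * R = -R := by
    rw [hR, mul_smul_comm, mul_sub, hX, mul_one, ← smul_neg, neg_sub]
  have hφP : ∀ b, φ b * P = P * φ b := fun b => by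
    rw [hP, mul_smul_comm, smul_mul_assoc, mul_add, add_mul, hφX, mul_one, one_mul]
  have hφR : ∀ b, φ b * R = R * φ b := fun b => by
    rw [hR, mul_smul_comm, smul_mul_assoc, mul_sub, sub_mul, hφX, mul_one, one_mul]
  let g : Matrix (Fin 2) (Fin 2) B → A := fun M =>
    P * φ (M 0 0) + (c⁻¹ : K) • (Y * R * φ (M 0 1)) + Y * P * φ (M 1 0) + R * φ (M 1 1)
  have h22 : (2⁻¹ + 2⁻¹ : K) = 1 := by rw [← two_mul, mul_inv_cancel₀ h2]
  have hfP : f P = !![1, 0; 0, 0] := by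
    rw [hP, map_smul, map_add, map_one, hfX]
    ext i j
    fin_cases i <;> fin_cases j <;> simp [← add_smul, h22]
  have hfR : f R = !![0, 0; 0, 1] := by
    rw [hR, map_smul, map_sub, map_one, hfX]
    ext i j
    fin_cases i <;> fin_cases j <;> simp [← add_smul, h22]
  have hfg : ∀ M, f (g M) = M := fun M => by
    simp only [g, map_add, map_smul, map_mul, hfP, hfR, hfφ, hfY]
    ext i j
    fin_cases i <;> fin_cases j <;> simp [smul_smul, hc]
  have hgf : ∀ (a : A) (M : Matrix (Fin 2) (Fin 2) B), g (f a * M) = a * g M := by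
    let T : Subalgebra K A :=
      { carrier := {a | ∀ M, g (f a * M) = a * g M}
        mul_mem' := fun {a b} ha hb M => by rw [map_mul, mul_assoc, ha, hb, mul_assoc]
        add_mem' := fun {a b} ha hb M => by
          have hadd : ∀ M N, g (M + N) = g M + g N := fun M N => by
            simp only [g, Matrix.add_apply, map_add, mul_add, smul_add]; abel
          rw [map_add, add_mul, hadd, ha, hb, add_mul]
        algebraMap_mem' := fun r M => by
          have hsm : g (r • M) = r • g M := by
            simp only [g, Matrix.smul_apply, map_smul, mul_smul_comm, smul_add, smul_comm c⁻¹ r]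
          rw [AlgHom.commutes, ← Algebra.smul_def, ← Algebra.smul_def, hsm] }
    have hT : T = ⊤ := by
      rw [eq_top_iff, ← hgen, Algebra.adjoin_le_iff]
      rintro a (ha | ⟨b, rfl⟩)
      · rcases ha with rfl | rfl
        · intro M
          have hXYP : a * Y * P = -(Y * P) := by rw [hXY, neg_mul, mul_assoc, hXP]
          have hXYR : a * Y * R = Y * R := by
            rw [hXY, neg_mul, mul_assoc, hXR, mul_neg, neg_neg]
          simp only [g, hfX, mul_add, mul_smul_comm, ← mul_assoc a, hXP, hXR, hXYP, hXYR]
          simp [Matrix.mul_apply]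
        · intro M
          have hYYP : a * a * P = c • P := by rw [hY, Algebra.smul_def]
          have hYYR : a * a * R = c • R := by rw [hY, Algebra.smul_def]
          simp only [g, hfY, mul_add, mul_smul_comm, ← mul_assoc a, hYYP, hYYR]
          simp [Matrix.mul_apply, ← Algebra.smul_def, smul_smul, hc]
          abel
      · intro M
        have h1 : φ b * Y * P = Y * P * φ b := by
          rw [hφY, mul_assoc, hφP, mul_assoc]
        have h2 : φ b * Y * R = Y * R * φ b := by
          rw [hφY, mul_assoc, hφR, mul_assoc]
        simp only [g, hfφ, mul_add, mul_smul_comm, ← mul_assoc (φ b), hφP, hφR, h1, h2]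
        simp [Matrix.mul_apply, mul_assoc]
    exact fun a => (hT ▸ Algebra.mem_top : a ∈ T)
  refine ⟨Function.LeftInverse.injective (g := g) fun a => ?_, fun M => ⟨g M, hfg M⟩⟩
  have h := hgf a 1
  rw [mul_one] at h
  rw [h]
  simp [g, hPR]

namespace DiagClifford

theorem bijective_of_generators [NeZero (2 : K)] {c : K} (hc : c ≠ 0) (w : κ → K)
    (X Y : A) (g : κ → A) (hX : X * X = 1) (hY : Y * Y = algebraMap K A c)
    (hg : ∀ k, g k * g k = algebraMap K A (w k)) (hXY : Y * X = -(X * Y))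
    (hXg : ∀ k, g k * X = -(X * g k)) (hYg : ∀ k, g k * Y = -(Y * g k))
    (hgg : ∀ k l, k ≠ l → g k * g l = -(g l * g k))
    (hgen : Algebra.adjoin K ({X, Y} ∪ Set.range g) = ⊤)
    (f : A →ₐ[K] Matrix (Fin 2) (Fin 2) (DiagClifford fun k => -c⁻¹ * w k))
    (hfX : f X = !![1, 0; 0, -1]) (hfY : f Y = !![0, algebraMap K _ c; 1, 0])
    (hfg : ∀ k, f (g k) = !![0, c • gen _ k; -gen _ k, 0]) : Function.Bijective f := by
  have hZZ : (X * Y) * (X * Y) = algebraMap K _ (-c) := by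
    rw [mul_assoc, ← mul_assoc Y, hXY, neg_mul, mul_neg, mul_assoc X Y Y, ← mul_assoc X X, hX,
      one_mul, hY, map_neg]
  have hZg : ∀ k, g k * (X * Y) = X * Y * g k := fun k => by
    rw [← mul_assoc, hXg, neg_mul, mul_assoc, hYg, mul_neg, neg_neg, mul_assoc]
  have key : ∀ k l, (X * Y * g k) * (X * Y * g l) = (-c) • (g k * g l) := fun k l => by
    rw [mul_assoc, ← mul_assoc (g k), hZg, mul_assoc (X * Y) (g k), ← mul_assoc (X * Y) (X * Y),
      hZZ, Algebra.smul_def]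
  let φ : DiagClifford (fun k => -c⁻¹ * w k) →ₐ[K] A :=
    lift _ (fun k => (-c⁻¹) • (X * Y * g k))
      (fun k => by
        rw [smul_mul_smul_comm, key, hg, smul_smul, Algebra.smul_def, ← map_mul]
        congr 1
        field_simp)
      (fun k l h => by
        rw [smul_mul_smul_comm, smul_mul_smul_comm, key, key, hgg k l h, smul_neg, smul_neg])
  have hφg : ∀ k, φ (gen _ k) = (-c⁻¹) • (X * Y * g k) := fun k => lift_gen _ _ _ _ _
  have hcomm : ∀ x : A, (∀ k, X * Y * g k * x = x * (X * Y * g k)) →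
      ∀ b, φ b * x = x * φ b := fun x hx b => by
    have hb : b ∈ Algebra.adjoin K (Set.range (gen fun k => -c⁻¹ * w k)) := by
      rw [adjoin_range_gen]; exact Algebra.mem_top
    induction hb using Algebra.adjoin_induction with
    | mem y hy =>
      obtain ⟨k, rfl⟩ := hy
      rw [hφg, smul_mul_assoc, mul_smul_comm, hx]
    | algebraMap r => rw [AlgHom.commutes, Algebra.commutes]
    | add y z _ _ hy hz => rw [map_add, add_mul, mul_add, hy, hz]
    | mul y z _ _ hy hz => rw [map_mul, mul_assoc, hz, ← mul_assoc, hy, mul_assoc]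
  have hφX := hcomm X fun k => by
    rw [mul_assoc, hXg, mul_neg, mul_assoc, ← mul_assoc Y, hXY]
    simp only [neg_mul, mul_neg, neg_neg, mul_assoc]
  have hφY := hcomm Y fun k => by
    rw [mul_assoc, hYg, mul_neg, mul_assoc X, ← mul_assoc Y Y, ← mul_assoc Y (X * Y),
      ← mul_assoc Y X, hXY]
    simp only [neg_mul, mul_assoc]
  have hfφ : ∀ b, f (φ b) = !![b, 0; 0, b] := fun b => by
    have hb : b ∈ Algebra.adjoin K (Set.range (gen fun k => -c⁻¹ * w k)) := by
      rw [adjoin_range_gen]; exact Algebra.mem_top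
    induction hb using Algebra.adjoin_induction with
    | mem y hy =>
      obtain ⟨k, rfl⟩ := hy
      rw [hφg, map_smul, map_mul, map_mul, hfX, hfY, hfg]
      ext a b; fin_cases a <;> fin_cases b <;>
        simp [smul_smul, hc]
    | algebraMap r =>
      rw [AlgHom.commutes, AlgHom.commutes]
      ext a b; fin_cases a <;> fin_cases b <;> simp [Matrix.algebraMap_matrix_apply]
    | add y z _ _ hy hz => 
      rw [map_add, map_add, hy, hz]
      ext a b; fin_cases a <;> fin_cases b <;> simp
    | mul y z _ _ hy hz =>
      rw [map_mul, map_mul, hy, hz]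
      ext a b; fin_cases a <;> fin_cases b <;> simp
  refine bijective_matrix_two f φ X Y c hc hX hY (by rw [hXY, neg_neg]) hφX hφY hfX hfY hfφ ?_
  rw [eq_top_iff, ← hgen, Algebra.adjoin_le_iff]
  rintro x (hx | ⟨k, rfl⟩)
  · exact Algebra.subset_adjoin (Or.inl hx)
  · have hk : g k = X * Y * φ (gen _ k) := by
      rw [hφg, mul_smul_comm, ← mul_assoc, hZZ, ← Algebra.smul_def, smul_smul]
      simp [hc]
    rw [SetLike.mem_coe, hk]
    exact mul_mem (mul_mem (Algebra.subset_adjoin (by simp)) (Algebra.subset_adjoin (by simp)))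
      (Algebra.subset_adjoin (Or.inr ⟨_, rfl⟩))

/-- Splitting off a plane which represents `1`. -/
theorem isMatrixOver_of_one [NeZero (2 : K)] {c : K} (hc : c ≠ 0) (w : κ → K) :
    IsMatrixOver K (DiagClifford (Sum.elim ![1, c] w)) (DiagClifford fun k => -c⁻¹ * w k) := by
  have hγ : ∀ k, gen (fun k => -c⁻¹ * w k) k * gen (fun k => -c⁻¹ * w k) k =
      (-c⁻¹ * w k) • (1 : DiagClifford fun k => -c⁻¹ * w k) := fun k => by
    rw [gen_mul_self, Algebra.algebraMap_eq_smul_one]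
  let x : Fin 2 ⊕ κ → Matrix (Fin 2) (Fin 2) (DiagClifford fun k => -c⁻¹ * w k) :=
    Sum.elim ![!![1, 0; 0, -1], !![0, algebraMap K _ c; 1, 0]]
      (fun k => !![0, c • gen _ k; -gen _ k, 0])
  have h1 : ∀ i, x i * x i = algebraMap K _ (Sum.elim ![1, c] w i) := by
    rintro (i | k)
    · fin_cases i <;> ext a b <;> fin_cases a <;> fin_cases b <;>
        simp [x, Matrix.algebraMap_matrix_apply, Algebra.algebraMap_eq_smul_one]
    · ext a b; fin_cases a <;> fin_cases b <;>
        simp [x, hγ, Matrix.algebraMap_matrix_apply, Algebra.algebraMap_eq_smul_one, hc,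
          smul_smul]
  have h2 : ∀ i j, i ≠ j → x i * x j = -(x j * x i) := by
    rintro (i | k) (j | l) h
    · fin_cases i <;> fin_cases j <;> first | exact absurd rfl h | skip
      all_goals
        ext a b
        fin_cases a <;> fin_cases b <;> simp [x, Algebra.algebraMap_eq_smul_one]
    · fin_cases i <;> ext a b <;> fin_cases a <;> fin_cases b <;>
        simp [x, Algebra.smul_def, Algebra.commutes]
    · fin_cases j <;> ext a b <;> fin_cases a <;> fin_cases b <;>
        simp [x, Algebra.smul_def, Algebra.commutes]
    · have := gen_anticomm (fun k => -c⁻¹ * w k) (fun e => h (congrArg _ e) : k ≠ l)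
      ext a b; fin_cases a <;> fin_cases b <;> simp [x, this]
  refine .of_matrix (AlgEquiv.ofBijective (lift _ x h1 h2) (bijective_of_generators hc w
    (gen _ (.inl 0)) (gen _ (.inl 1)) (fun k => gen _ (.inr k)) ?_ ?_ ?_ ?_ ?_ ?_ ?_ ?_ _
    (lift_gen _ _ _ _ _) (lift_gen _ _ _ _ _) (fun k => lift_gen _ _ _ _ _)))
  · simp [gen_mul_self]
  · simp [gen_mul_self]
  · simp [gen_mul_self]
  · exact gen_anticomm _ (by simp)
  · exact fun k => gen_anticomm _ (by simp)
  · exact fun k => gen_anticomm _ (by simp)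
  · exact fun k l h => gen_anticomm _ (by simpa using h)
  · rw [eq_top_iff, ← adjoin_range_gen]
    refine Algebra.adjoin_mono ?_
    rintro _ ⟨i | k, rfl⟩
    · fin_cases i <;> simp
    · exact Or.inr ⟨k, rfl⟩

end DiagClifford

end DiagClifford

end OrthChar
end

noncomputable section
namespace OrthChar

section DiagClifford

variable {K : Type*} [Field K] {ι κ : Type*} [Fintype ι] [DecidableEq ι] [Fintype κ] [DecidableEq κ]
  {A B : Type*} [Ring A] [Algebra K A] [Ring B] [Algebra K B]

namespace DiagClifford

section Volume

/-- The product of four elements. -/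
def volume (x : Fin 4 → A) : A := x 0 * x 1 * x 2 * x 3

theorem anticomm_mul_left {x z ω : A} (h : z * x = -(x * z)) (hω : z * ω = ω * z) :
    z * (x * ω) = -(x * ω * z) := by
  rw [← mul_assoc, h, neg_mul, mul_assoc, hω, mul_assoc]

theorem anticomm_mul_right {x z ω : A} (h : z * x = -(x * z)) (hω : z * ω = ω * z) :
    x * ω * z = -(z * (x * ω)) := by
  rw [anticomm_mul_left h hω, neg_neg]

theorem commute_volume {z : A} {x : Fin 4 → A} (h : ∀ i, z * x i = -(x i * z)) :
    z * volume x = volume x * z := by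
  have l : ∀ i t, z * (x i * t) = -(x i * (z * t)) := fun i t => by
    rw [← mul_assoc, h, neg_mul, mul_assoc]
  simp only [volume, mul_assoc, l, h, mul_neg, neg_neg]

variable {x : Fin 4 → A} {a : K} (ha : a * a = 1) (hsq : ∀ i, x i * x i = algebraMap K A a)
  (hanti : ∀ i j, i ≠ j → x i * x j = -(x j * x i))

include ha hsq hanti

theorem volume_facts :
    volume x * volume x = 1 ∧ ∀ i, volume x * x i = -(x i * volume x) := by
  have h10 := hanti 1 0 (by decide)
  have h20 := hanti 2 0 (by decide)
  have h30 := hanti 3 0 (by decide)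
  have h21 := hanti 2 1 (by decide)
  have h31 := hanti 3 1 (by decide)
  have h32 := hanti 3 2 (by decide)
  have l : ∀ {u v : A}, u * v = -(v * u) → ∀ t, u * (v * t) = -(v * (u * t)) := fun h t => by
    rw [← mul_assoc, h, neg_mul, mul_assoc]
  have s : ∀ i t, x i * (x i * t) = a • t := fun i t => by
    rw [← mul_assoc, hsq, Algebra.smul_def]
  have s' : ∀ i, x i * x i = a • 1 := fun i => by rw [hsq, Algebra.algebraMap_eq_smul_one]
  constructor
  · simp only [volume, mul_assoc, l h10, l h20, l h30, l h21, l h31, l h32,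
      s', mul_neg, neg_neg, mul_smul_comm, smul_smul, mul_one, smul_neg]
    rw [show a * (a * (a * a)) = 1 by rw [ha, mul_one, ha], one_smul]
  · intro i
    fin_cases i <;>
    simp [volume, mul_assoc, h30, h31, h32, l h10, l h20, l h30, l h21, l h31, l h32, s, s']

theorem volume_twist_mul (i j : Fin 4) :
    (x i * volume x) * (x j * volume x) = -(x i * x j) := by
  obtain ⟨h1, h2⟩ := volume_facts ha hsq hanti
  rw [mul_assoc, ← mul_assoc (volume x), h2, neg_mul, mul_assoc (x j), h1, mul_one, mul_neg]

theorem volume_twist : volume (fun i => x i * volume x) = volume x := by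
  rw [volume, volume_twist_mul ha hsq hanti 0 1, mul_assoc (-_),
    volume_twist_mul ha hsq hanti 2 3, neg_mul_neg, ← mul_assoc, volume]

end Volume

section Twist

variable {a b : K} (w : κ → K)

theorem gen_inl_mul_self (i : Fin 4) :
    gen (Sum.elim (fun _ : Fin 4 => a) w) (.inl i) * gen _ (.inl i) = algebraMap K _ a :=
  gen_mul_self _ _

theorem gen_inl_anticomm (i j : Fin 4) (h : i ≠ j) :
    gen (Sum.elim (fun _ : Fin 4 => a) w) (.inl i) * gen _ (.inl j) =
      -(gen _ (.inl j) * gen _ (.inl i)) :=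
  gen_anticomm _ (by simpa using h)

variable [NeZero (2 : K)]

/-- Replacing the generators `e i` of a subform `⟨a, a, a, a⟩`, `a = ±1`, by
`e i * (e 0 * e 1 * e 2 * e 3)`. -/
def twistHom (ha : a * a = 1) (hb : b = -a) :
    DiagClifford (Sum.elim (fun _ : Fin 4 => a) w) →ₐ[K]
      DiagClifford (Sum.elim (fun _ : Fin 4 => b) w) :=
  lift _ (Sum.elim (fun i => gen _ (.inl i) * volume fun i => gen _ (.inl i))
      (fun k => gen _ (.inr k)))
    (by
      have hbb : b * b = 1 := by rw [hb, neg_mul_neg, ha]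
      rintro (i | k)
      · exact (volume_twist_mul hbb (gen_inl_mul_self w) (gen_inl_anticomm w) i i).trans
          (by rw [gen_inl_mul_self]; simp [hb])
      · exact gen_mul_self _ _)
    (by
      have hbb : b * b = 1 := by rw [hb, neg_mul_neg, ha]
      have hx : ∀ (k : κ) (i : Fin 4), _ := fun k i =>
        gen_anticomm (Sum.elim (fun _ : Fin 4 => b) w)
          (show (Sum.inr k : Fin 4 ⊕ κ) ≠ .inl i by simp)
      have hω := fun k => commute_volume (hx k)
      rintro (i | k) (j | m) h
      · refine (volume_twist_mul hbb (gen_inl_mul_self w) (gen_inl_anticomm w) i j).trans ?_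
        rw [gen_inl_anticomm w i j fun e => h (by rw [e])]
        exact congrArg _ (volume_twist_mul hbb (gen_inl_mul_self w) (gen_inl_anticomm w) j i).symm
      · exact anticomm_mul_right (hx m i) (hω m)
      · exact anticomm_mul_left (hx k j) (hω k)
      · exact gen_anticomm _ h)

theorem twistHom_comp (ha : a * a = 1) (hb : b = -a) (hbb : b * b = 1) (ha' : a = -b) :
    (twistHom w hbb ha').comp (twistHom w ha hb) = AlgHom.id K _ := by
  have hval : ∀ i, twistHom w hbb ha' (gen _ (.inl i)) = gen _ (.inl i) * volume fun i =>
    gen _ (.inl i) := fun i => lift_gen _ _ _ _ _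
  have hvol : twistHom w hbb ha' (volume fun i => gen _ (.inl i)) =
      volume fun i => gen _ (.inl i) := by
    refine Eq.trans ?_ (volume_twist ha (gen_inl_mul_self w) (gen_inl_anticomm w))
    simp only [volume, map_mul, hval]
  refine algHom_ext ?_
  rintro (i | k)
  · have hval' : twistHom w ha hb (gen _ (.inl i)) = gen _ (.inl i) *
        volume fun i => gen _ (.inl i) := lift_gen _ _ _ _ _
    rw [AlgHom.comp_apply, hval', map_mul, hval, hvol, mul_assoc,
      (volume_facts ha (gen_inl_mul_self w) (gen_inl_anticomm w)).1, mul_one]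
    rfl
  · have h1 : twistHom w ha hb (gen _ (.inr k)) = gen _ (.inr k) := lift_gen _ _ _ _ _
    have h2 : twistHom w hbb ha' (gen _ (.inr k)) = gen _ (.inr k) := lift_gen _ _ _ _ _
    rw [AlgHom.comp_apply, h1, h2]
    rfl

/-- `⟨1, 1, 1, 1⟩` and `⟨-1, -1, -1, -1⟩` may be exchanged. -/
def twistEquiv (ha : a * a = 1) (hb : b = -a) :
    DiagClifford (Sum.elim (fun _ : Fin 4 => a) w) ≃ₐ[K]
      DiagClifford (Sum.elim (fun _ : Fin 4 => b) w) :=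
  AlgEquiv.ofAlgHom (twistHom w ha hb)
    (twistHom w (by rw [hb, neg_mul_neg, ha]) (by rw [hb, neg_neg]))
    (twistHom_comp _ _ _ _ _) (twistHom_comp _ _ _ _ _)

end Twist

theorem isMatrixOver_of_hyperbolic [NeZero (2 : K)] (w : κ → K) :
    IsMatrixOver K (DiagClifford (Sum.elim ![1, -1] w)) (DiagClifford w) :=
  (isMatrixOver_of_one (c := (-1 : K)) (by simp) w).trans
    (.of_equiv (reindex (Equiv.refl κ) fun k => by norm_num))

/-- The bijection which moves the heads of the first two summands to the front. -/
def finSuccSumEquiv (n : ℕ) (κ : Type*) :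
    Fin (n + 1) ⊕ (Fin (n + 1) ⊕ κ) ≃ Fin 2 ⊕ (Fin n ⊕ (Fin n ⊕ κ)) where
  toFun := Sum.elim (Fin.cases (.inl 0) (fun i => .inr (.inl i)))
    (Sum.elim (Fin.cases (.inl 1) (fun i => .inr (.inr (.inl i)))) (fun k => .inr (.inr (.inr k))))
  invFun := Sum.elim ![.inl 0, .inr (.inl 0)] (Sum.elim (fun i => .inl i.succ)
    (Sum.elim (fun i => .inr (.inl i.succ)) (fun k => .inr (.inr k))))
  left_inv := by
    rintro (i | i | k)
    · refine Fin.cases ?_ (fun i => ?_) i <;> simp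
    · refine Fin.cases ?_ (fun i => ?_) i <;> simp
    · simp
  right_inv := by
    rintro (i | i | i | k)
    · fin_cases i <;> simp
    all_goals simp

theorem isMatrixOver_of_hyperbolics [NeZero (2 : K)] (n : ℕ) (w : κ → K) :
    IsMatrixOver K (DiagClifford (Sum.elim (fun _ : Fin n => (1 : K))
      (Sum.elim (fun _ : Fin n => (-1 : K)) w))) (DiagClifford w) := by
  induction n with
  | zero =>
    exact .of_equiv (reindex ((Equiv.emptySum _ _).trans (Equiv.emptySum _ _)) (by
      rintro (i | i | k)
      · exact i.elim0
      · exact i.elim0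
      · rfl))
  | succ n ih =>
    refine (IsMatrixOver.of_equiv (reindex (finSuccSumEquiv n κ)
      (w' := Sum.elim ![1, -1] (Sum.elim (fun _ : Fin n => (1 : K))
        (Sum.elim (fun _ : Fin n => (-1 : K)) w))) ?_)).trans
      ((isMatrixOver_of_hyperbolic _).trans ih)
    rintro (i | i | k)
    · refine Fin.cases ?_ (fun i => ?_) i <;> simp [finSuccSumEquiv]
    · refine Fin.cases ?_ (fun i => ?_) i <;> simp [finSuccSumEquiv]
    · simp [finSuccSumEquiv]

theorem isMatrixOver_of_neg_one_eight [NeZero (2 : K)] (w : κ → K) :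
    IsMatrixOver K (DiagClifford (Sum.elim (fun _ : Fin 4 => (-1 : K))
      (Sum.elim (fun _ : Fin 4 => (-1 : K)) w))) (DiagClifford w) :=
  (IsMatrixOver.of_equiv (twistEquiv (b := 1) _ (by norm_num) (by norm_num))).trans
    (isMatrixOver_of_hyperbolics 4 w)

theorem isMatrixOver_of_neg_one_six [NeZero (2 : K)] (w : κ → K) :
    IsMatrixOver K (DiagClifford (Sum.elim (fun _ : Fin 4 => (-1 : K))
      (Sum.elim (fun _ : Fin 2 => (-1 : K)) fun k => -w k))) (DiagClifford w) := by
  refine (IsMatrixOver.of_equiv (twistEquiv (b := 1) _ (by norm_num) (by norm_num))).trans ?_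
  obtain ⟨e₀⟩ : Nonempty (Fin 4 ≃ Fin 2 ⊕ Fin 2) := ⟨Fintype.equivOfCardEq (by simp)⟩
  let e : Fin 4 ⊕ (Fin 2 ⊕ κ) ≃ Fin 2 ⊕ (Fin 2 ⊕ (Fin 2 ⊕ κ)) :=
    (Equiv.sumCongr e₀ (Equiv.refl _)).trans
      ((Equiv.sumAssoc _ _ _).trans (Equiv.sumCongr (Equiv.refl _)
        ((Equiv.sumAssoc _ _ _).symm.trans ((Equiv.sumCongr (Equiv.sumComm _ _)
          (Equiv.refl _)).trans (Equiv.sumAssoc _ _ _)))))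
  refine (IsMatrixOver.of_equiv (reindex e (w' := Sum.elim (fun _ => (1 : K))
    (Sum.elim (fun _ => (-1 : K)) (Sum.elim ![1, 1] fun k => -w k))) ?_)).trans
    ((isMatrixOver_of_hyperbolics 2 _).trans ((isMatrixOver_of_one one_ne_zero _).trans
      (.of_equiv (reindex (Equiv.refl κ) fun k => by norm_num))))
  rintro (i | i | k)
  · rcases h : e₀ i with j | j
    · simp [e, h]
    · fin_cases j <;> simp [e, h]
  · simp [e]
  · simp [e]

theorem isMatrixOver_of_neg_one [NeZero (2 : K)] (m : ℕ) {α : Type*} [Fintype α] [DecidableEq α]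
    (hα : Fintype.card α = 8 * m + 6) (w : κ → K) :
    IsMatrixOver K (DiagClifford (Sum.elim (fun _ : α => (-1 : K)) fun k => -w k))
      (DiagClifford w) := by
  have key : ∀ n, n = 8 * m + 6 → IsMatrixOver K (DiagClifford (Sum.elim
      (fun _ : Fin n => (-1 : K)) fun k => -w k)) (DiagClifford w) := by
    clear hα
    induction m with
    | zero =>
      intro n hn
      obtain ⟨e⟩ : Nonempty (Fin n ≃ Fin 4 ⊕ Fin 2) := ⟨Fintype.equivOfCardEq (by simp [hn])⟩
      refine (IsMatrixOver.of_equiv (reindex ((Equiv.sumCongr e (Equiv.refl κ)).trans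
        (Equiv.sumAssoc _ _ _)) ?_)).trans (isMatrixOver_of_neg_one_six w)
      rintro (i | k)
      · rcases h : e i with j | j <;> simp [h]
      · rfl
    | succ m ih =>
      intro n hn
      obtain ⟨N, hN⟩ : ∃ N, N = 8 * m + 6 := ⟨_, rfl⟩
      obtain ⟨e⟩ : Nonempty (Fin n ≃ Fin 4 ⊕ (Fin 4 ⊕ Fin N)) :=
        ⟨Fintype.equivOfCardEq (by simp [hn, hN]; ring)⟩
      refine (IsMatrixOver.of_equiv (reindex (w' := Sum.elim (fun _ : Fin 4 => (-1 : K))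
        (Sum.elim (fun _ : Fin 4 => (-1 : K)) (Sum.elim (fun _ : Fin N => (-1 : K))
          fun k => -w k))) ((Equiv.sumCongr e (Equiv.refl κ)).trans
        ((Equiv.sumAssoc _ _ _).trans (Equiv.sumCongr (Equiv.refl _) (Equiv.sumAssoc _ _ _))))
        ?_)).trans ((isMatrixOver_of_neg_one_eight _).trans (ih N hN))
      rintro (i | k)
      · rcases h : e i with j | j | j <;> simp [h]
      · simp
  obtain ⟨e⟩ : Nonempty (α ≃ Fin (8 * m + 6)) := ⟨Fintype.equivOfCardEq (by simp [hα])⟩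
  refine (IsMatrixOver.of_equiv (reindex (Equiv.sumCongr e (Equiv.refl κ)) ?_)).trans (key _ rfl)
  rintro (i | k) <;> simp

/-- The Clifford algebra of a binary form is a quaternion algebra. -/
def quaternionEquiv (w : Fin 2 → K) : DiagClifford w ≃ₐ[K] QuaternionAlgebra K (w 0) 0 (w 1) :=
  (CliffordAlgebra.equivOfIsometry
    { LinearEquiv.finTwoArrow K K with
      map_app' := fun v => by
        simp [QuadraticMap.weightedSumSquares_apply, CliffordAlgebraQuaternion.Q_apply] }).trans
    CliffordAlgebraQuaternion.equiv

end DiagClifford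

end DiagClifford

end OrthChar
end

noncomputable section
namespace OrthChar

section EvenClifford

variable {K : Type*} [Field K] {W W' : Type*} [AddCommGroup W] [Module K W] [AddCommGroup W']
  [Module K W']

open CliffordAlgebra in
/-- A similitude induces a homomorphism between the even Clifford algebras. -/
def evenHomOfSimilitude {Q : QuadraticForm K W} {Q' : QuadraticForm K W'} (e : W →ₗ[K] W') {a : K}
    (ha : a ≠ 0) (h : ∀ x, Q' (e x) = a * Q x) : even Q →ₐ[K] even Q' :=
  even.lift Q
    { bilin := a⁻¹ • ((even.ι Q').bilin.compl₁₂ e e)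
      contract := fun m => by
        simp only [LinearMap.smul_apply, LinearMap.compl₁₂_apply]
        rw [(even.ι Q').contract, h, map_mul, Algebra.algebraMap_eq_smul_one a, smul_mul_assoc,
          one_mul, smul_smul, inv_mul_cancel₀ ha, one_smul]
      contract_mid := fun m₁ m₂ m₃ => by
        simp only [LinearMap.smul_apply, LinearMap.compl₁₂_apply]
        rw [smul_mul_smul_comm, (even.ι Q').contract_mid, h, smul_smul, smul_smul]
        congr 1
        field_simp }

open CliffordAlgebra in
/-- A similitude induces an isomorphism between the even Clifford algebras. -/
def evenEquivOfSimilitude {Q : QuadraticForm K W} {Q' : QuadraticForm K W'} (e : W ≃ₗ[K] W') {a : K}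
    (ha : a ≠ 0) (h : ∀ x, Q' (e x) = a * Q x) : even Q ≃ₐ[K] even Q' :=
  AlgEquiv.ofAlgHom (evenHomOfSimilitude e.toLinearMap ha h)
    (evenHomOfSimilitude e.symm.toLinearMap (inv_ne_zero ha) (fun x => by
      have := h (e.symm x)
      rw [e.apply_symm_apply] at this
      rw [LinearEquiv.coe_coe, this, inv_mul_cancel_left₀ ha]))
    (by
      refine even.algHom_ext _ (EvenHom.ext (LinearMap.ext₂ fun x y => ?_))
      simp [evenHomOfSimilitude, ha])
    (by
      refine even.algHom_ext _ (EvenHom.ext (LinearMap.ext₂ fun x y => ?_))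
      simp [evenHomOfSimilitude, ha])

variable {ι : Type*} [Fintype ι] [DecidableEq ι]

/-- The even Clifford algebra of `c⟨1, w⟩` is the Clifford algebra of `-w`. -/
def evenEquivDiagClifford (Q : QuadraticForm K W) (e : W ≃ₗ[K] (ι → K) × K) {c : K} (hc : c ≠ 0)
    (w : ι → K) (hQ : ∀ v, Q v = c * (∑ i, w i * (e v).1 i ^ 2 + (e v).2 ^ 2)) :
    CliffordAlgebra.even Q ≃ₐ[K] DiagClifford fun i => -w i :=
  (evenEquivOfSimilitude e (a := -c⁻¹) (by simpa using hc) fun v => by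
    rw [CliffordAlgebra.EquivEven.Q'_apply, QuadraticMap.weightedSumSquares_apply, hQ]
    simp only [smul_eq_mul, neg_mul, Finset.sum_neg_distrib, inv_mul_cancel_left₀ hc, ← pow_two]
    ring).trans
    (CliffordAlgebra.equivEven (QuadraticMap.weightedSumSquares K fun i => -w i)).symm

variable [NeZero (2 : K)]

open DiagClifford

/-- Replacing the last of four generators by its product with the other ones. -/
def DiagClifford.lastTwist (c d : Fin 4 → K) (s : K) (h0 : d 0 = c 0) (h1 : d 1 = c 1)
    (h2 : d 2 = c 2) (h3 : d 3 = s ^ 2 * (c 0 * c 1 * c 2 * c 3)) :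
    DiagClifford d →ₐ[K] DiagClifford c :=
  have h10 := gen_anticomm c (i := 1) (j := 0) (by decide)
  have h20 := gen_anticomm c (i := 2) (j := 0) (by decide)
  have h30 := gen_anticomm c (i := 3) (j := 0) (by decide)
  have h21 := gen_anticomm c (i := 2) (j := 1) (by decide)
  have h31 := gen_anticomm c (i := 3) (j := 1) (by decide)
  have h32 := gen_anticomm c (i := 3) (j := 2) (by decide)
  have l : ∀ {u v : DiagClifford c}, u * v = -(v * u) → ∀ t, u * (v * t) = -(v * (u * t)) :=
    fun h t => by rw [← mul_assoc, h, neg_mul, mul_assoc]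
  have sq : ∀ i t, gen c i * (gen c i * t) = c i • t := fun i t => by
    rw [← mul_assoc, gen_mul_self, Algebra.smul_def]
  have sq' : ∀ i, gen c i * gen c i = c i • 1 := fun i => by
    rw [gen_mul_self, Algebra.algebraMap_eq_smul_one]
  lift d ![gen c 0, gen c 1, gen c 2, s • (gen c 3 * (gen c 0 * gen c 1 * gen c 2))]
    (by
      intro i
      fin_cases i
      · simp [gen_mul_self, h0]
      · simp [gen_mul_self, h1]
      · simp [gen_mul_self, h2]
      · simp [h3, mul_assoc, h32, l h10, l h20, l h30, l h21, l h31, l h32,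
          sq', smul_smul, Algebra.algebraMap_eq_smul_one]
        ring_nf)
    (by
      intro i j hij
      fin_cases i <;> fin_cases j <;> first | exact absurd rfl hij | skip
      all_goals
        simp [mul_assoc, h10, h20, h21, h30, h31, h32, l h10, l h20, l h30, l h21, l h31,
          l h32, sq, sq', smul_smul, mul_comm])

theorem DiagClifford.lastTwist_comp (c d : Fin 4 → K) (s t : K) (h0 : d 0 = c 0) (h1 : d 1 = c 1)
    (h2 : d 2 = c 2) (h3 : d 3 = s ^ 2 * (c 0 * c 1 * c 2 * c 3)) (h0' : c 0 = d 0)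
    (h1' : c 1 = d 1) (h2' : c 2 = d 2) (h3' : c 3 = t ^ 2 * (d 0 * d 1 * d 2 * d 3))
    (hst : s * t * (c 0 * c 1 * c 2) = -1) :
    (lastTwist c d s h0 h1 h2 h3).comp (lastTwist d c t h0' h1' h2' h3') = AlgHom.id K _ := by
  have h10 := gen_anticomm c (i := 1) (j := 0) (by decide)
  have h20 := gen_anticomm c (i := 2) (j := 0) (by decide)
  have h21 := gen_anticomm c (i := 2) (j := 1) (by decide)
  have l : ∀ {u v : DiagClifford c}, u * v = -(v * u) → ∀ t, u * (v * t) = -(v * (u * t)) :=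
    fun h t => by rw [← mul_assoc, h, neg_mul, mul_assoc]
  have sq' : ∀ i, gen c i * gen c i = c i • 1 := fun i => by
    rw [gen_mul_self, Algebra.algebraMap_eq_smul_one]
  refine algHom_ext fun i => ?_
  rw [AlgHom.comp_apply, lastTwist, lastTwist, lift_gen]
  fin_cases i
  · simp [lift_gen]
  · simp [lift_gen]
  · simp [lift_gen]
  · simp [lift_gen, mul_assoc, l h10, l h20, l h21, sq', smul_smul]
    rw [← neg_smul]
    convert one_smul K _ using 2
    linear_combination -hst

/-- `⟨-1, -1, -2, -6⟩` has the Clifford algebra of `⟨1, -1, -1, -6⟩`. -/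
theorem isMatrixOver_rank_four (h3 : (3 : K) ≠ 0) :
    IsMatrixOver K (DiagClifford ![(-1 : K), -1, -2, -6]) (QuaternionAlgebra K (-1) 0 (-6)) := by
  have h2 : (2 : K) ≠ 0 := NeZero.ne 2
  have e₁ : DiagClifford ![(-1 : K), -1, -2, -6] ≃ₐ[K] DiagClifford ![(-1 : K), -1, -2, 3] :=
    AlgEquiv.ofAlgHom
      (lastTwist _ _ 1 rfl rfl rfl (by simp; norm_num))
      (lastTwist _ _ (2⁻¹) rfl rfl rfl (by simp; field_simp; norm_num))
      (lastTwist_comp _ _ _ _ _ _ _ _ _ _ _ _ (by simp [h2]))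
      (lastTwist_comp _ _ _ _ _ _ _ _ _ _ _ _ (by simp [h2]))
  have e₂ : DiagClifford ![(-1 : K), -1, -2, 3] ≃ₐ[K]
      DiagClifford (Sum.elim ![(1 : K), -1] ![(-1 : K), -6]) :=
    CliffordAlgebra.equivOfIsometry
      { toFun := fun x => Sum.elim ![-2 * x 2 + 3 * x 3, x 1] ![x 0, x 2 - x 3]
        map_add' := fun x y => by
          ext (i | i) <;> fin_cases i <;> simp <;> ring
        map_smul' := fun r x => by
          ext (i | i) <;> fin_cases i <;> simp <;> ring
        invFun := fun y => ![y (.inr 0), y (.inl 1), y (.inl 0) + 3 * y (.inr 1),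
          y (.inl 0) + 2 * y (.inr 1)]
        left_inv := fun x => by
          ext i; fin_cases i <;> simp <;> ring
        right_inv := fun y => by
          ext (i | i) <;> fin_cases i <;> simp <;> ring
        map_app' := fun x => by
          simp [QuadraticMap.weightedSumSquares_apply, Fin.sum_univ_four]
          ring }
  exact (IsMatrixOver.of_equiv (e₁.trans e₂)).trans ((isMatrixOver_of_hyperbolic _).trans
    (.of_equiv (quaternionEquiv _)))

end EvenClifford

section Quaternion

variable {K : Type*} [Field K]

theorem quaternion_isMatrixOver_of_norm [NeZero (2 : K)] {a b x y : K} (ha : a ≠ 0) (hb : b ≠ 0)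
    (h : b = x ^ 2 - a * y ^ 2) : IsMatrixOver K (QuaternionAlgebra K a 0 b) K := by
  have h2 : (2 : K) ≠ 0 := NeZero.ne 2
  let B : QuaternionAlgebra.Basis (Matrix (Fin 2) (Fin 2) K) a 0 b :=
    { i := !![0, a; 1, 0]
      j := !![x, -a * y; y, -x]
      k := !![a * y, -a * x; x, -a * y]
      i_mul_i := by ext i j; fin_cases i <;> fin_cases j <;> simp
      j_mul_j := by
        rw [h]; ext i j; fin_cases i <;> fin_cases j <;> simp <;> ring
      i_mul_j := by ext i j; fin_cases i <;> fin_cases j <;> simp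
      j_mul_i := by ext i j; fin_cases i <;> fin_cases j <;> simp <;> ring }
  refine .of_matrix (AlgEquiv.ofBijective B.liftHom ?_)
  have hinj : Function.Injective B.liftHom := by
    rw [injective_iff_map_eq_zero]
    intro q hq
    have hq' : B.lift q = 0 := hq
    have e00 := congrFun (congrFun hq' 0) 0
    have e01 := congrFun (congrFun hq' 0) 1
    have e10 := congrFun (congrFun hq' 1) 0
    have e11 := congrFun (congrFun hq' 1) 1
    simp [QuaternionAlgebra.Basis.lift, B, Matrix.algebraMap_matrix_apply] at e00 e01 e10 e11
    have hre : q.re = 0 := by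
      have : 2 * q.re = 0 := by linear_combination e00 + e11
      simpa [h2] using this
    have hi : q.imI = 0 := by
      have : 2 * a * q.imI = 0 := by linear_combination e01 + a * e10
      simpa [h2, ha] using this
    have hA : q.imJ * x + q.imK * (a * y) = 0 := by linear_combination e00 - hre
    have hB : q.imJ * y + q.imK * x = 0 := by linear_combination e10 - hi
    have hj : q.imJ = 0 := by
      have : b * q.imJ = 0 := by linear_combination x * hA - a * y * hB + q.imJ * h
      simpa [hb] using this
    have hk : q.imK = 0 := by
      have : b * q.imK = 0 := by linear_combination x * hB - y * hA + q.imK * h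
      simpa [hb] using this
    ext <;> simp [hre, hi, hj, hk]
  refine ⟨hinj, ?_⟩
  have := LinearMap.injective_iff_surjective_of_finrank_eq_finrank (f := B.liftHom.toLinearMap)
    (by rw [QuaternionAlgebra.finrank_eq_four, Module.finrank_matrix]; simp)
  exact this.mp hinj

variable [NeZero (2 : K)] {a b : K} (ha : a ≠ 0) (hb : b ≠ 0)

include ha hb

theorem quaternion_isCentral : Algebra.IsCentral K (QuaternionAlgebra K a 0 b) := by
  have h2 : (2 : K) ≠ 0 := NeZero.ne 2
  refine ⟨fun z hz => ?_⟩
  rw [Subalgebra.mem_center_iff] at hz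
  have hi := hz ⟨0, 1, 0, 0⟩
  have hj := hz ⟨0, 0, 1, 0⟩
  have hJ := congrArg QuaternionAlgebra.imK hi
  have hI := congrArg QuaternionAlgebra.imK hj
  have hK := congrArg QuaternionAlgebra.imJ hi
  simp at hI hJ hK
  have h : ∀ x : K, x = -x ∨ -x = x → x = 0 := fun x hx => by
    have : 2 * x = 0 := by
      rcases hx with h | h
      · linear_combination h
      · linear_combination -h
    simpa [h2] using this
  rw [Algebra.mem_bot]
  exact ⟨z.re, by
    ext
    · simp
    · simpa using (h _ (.inr hI)).symm
    · simpa using (h _ (.inl hJ)).symm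
    · have := h _ (.inl hK)
      simp only [mul_eq_zero, ha, false_or] at this
      simp [this]⟩

theorem quaternion_isSimple : IsSimpleRing (QuaternionAlgebra K a 0 b) := by
  have h2 : (2 : K) ≠ 0 := NeZero.ne 2
  refine ⟨⟨fun I => ?_⟩⟩
  by_cases hI : ∃ x ∈ I, x.re ≠ 0
  · right
    obtain ⟨x, hx, hx0⟩ := hI
    have h1 : a • x + ⟨0, 1, 0, 0⟩ * x * ⟨0, 1, 0, 0⟩ ∈ I := by
      rw [Algebra.smul_def]
      exact I.add_mem (I.mul_mem_left _ _ hx) (I.mul_mem_right _ _ (I.mul_mem_left _ _ hx))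
    set y := a • x + ⟨0, 1, 0, 0⟩ * x * ⟨0, 1, 0, 0⟩ with hy
    have h3 : b • y + ⟨0, 0, 1, 0⟩ * y * ⟨0, 0, 1, 0⟩ ∈ I := by
      rw [Algebra.smul_def]
      exact I.add_mem (I.mul_mem_left _ _ h1) (I.mul_mem_right _ _ (I.mul_mem_left _ _ h1))
    obtain ⟨r, hr⟩ : ∃ r, r = 2 * 2 * a * b * x.re := ⟨_, rfl⟩
    have h4 : b • y + ⟨0, 0, 1, 0⟩ * y * ⟨0, 0, 1, 0⟩ =
        algebraMap K (QuaternionAlgebra K a 0 b) r := by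
      ext <;> simp [hy] <;> try rw [hr]
      all_goals ring
    rw [h4] at h3
    have h5 := I.mul_mem_left (algebraMap K (QuaternionAlgebra K a 0 b) r⁻¹) _ h3
    rw [← map_mul, inv_mul_cancel₀ (by simp [hr, h2, ha, hb, hx0]), map_one] at h5
    exact I.one_mem_iff.mp h5
  · left
    push Not at hI
    rw [eq_bot_iff]
    intro x hx
    have h1 := hI _ (I.mul_mem_left ⟨0, 1, 0, 0⟩ _ hx)
    have h3 := hI _ (I.mul_mem_left ⟨0, 0, 1, 0⟩ _ hx)
    have h4 := hI _ (I.mul_mem_left ⟨0, 0, 0, 1⟩ _ hx)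
    simp [ha, hb] at h1 h3 h4
    rw [TwoSidedIdeal.mem_bot]
    ext <;> simp [hI _ hx, *]

end Quaternion

end OrthChar
end

noncomputable section
namespace OrthChar

section Brauer

theorem sameBrauerClass_of_isMatrixOver.{u, v} {K : Type u} [Field K] {A B D : Type v} [Ring A]
    [Algebra K A] [Ring B] [Algebra K B] [Ring D] [Algebra K D] [Algebra.IsCentral K D]
    [IsSimpleRing D] [FiniteDimensional K D] (hA : IsMatrixOver K A D) (hB : IsMatrixOver K B D) :
    SameBrauerClass K A B := by
  obtain ⟨N, hN, ⟨e⟩⟩ := hA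
  obtain ⟨M, hM, ⟨e'⟩⟩ := hB
  have : NeZero N := ⟨hN⟩
  have : NeZero M := ⟨hM⟩
  let A' : CSA.{u, v} K :=
    { carrier := A
      isCentral := Algebra.IsCentral.of_algEquiv _ _ _ e.symm
      isSimple := IsSimpleRing.of_ringEquiv e.symm.toRingEquiv inferInstance
      fin_dim := Module.Finite.equiv e.symm.toLinearEquiv }
  let B' : CSA.{u, v} K :=
    { carrier := B
      isCentral := Algebra.IsCentral.of_algEquiv _ _ _ e'.symm
      isSimple := IsSimpleRing.of_ringEquiv e'.symm.toRingEquiv inferInstance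
      fin_dim := Module.Finite.equiv e'.symm.toLinearEquiv }
  refine ⟨A', B', ⟨AlgEquiv.refl⟩, ⟨AlgEquiv.refl⟩, M, N, hM, hN, ⟨?_⟩⟩
  have e₁ : Matrix (Fin M) (Fin M) A ≃ₐ[K] Matrix (Fin M × Fin N) (Fin M × Fin N) D :=
    e.mapMatrix.trans (Matrix.compAlgEquiv (Fin M) (Fin N) D K)
  have e₂ : Matrix (Fin N) (Fin N) B ≃ₐ[K] Matrix (Fin N × Fin M) (Fin N × Fin M) D :=
    e'.mapMatrix.trans (Matrix.compAlgEquiv (Fin N) (Fin M) D K)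
  exact (e₁.trans (Matrix.reindexAlgEquiv K D (Equiv.prodComm _ _))).trans e₂.symm

variable {K : Type*} [Field K] {A D : Type*} [Ring A] [Algebra K A] [Ring D] [Algebra K D]

theorem IsMatrixOver.baseChange (L : Type*) [Field L] [Algebra K L] (h : IsMatrixOver K A D) :
    IsMatrixOver L (L ⊗[K] A) (L ⊗[K] D) := by
  obtain ⟨N, hN, ⟨e⟩⟩ := h
  have : Nonempty (Fin N) := ⟨⟨0, by omega⟩⟩
  have e₁ : L ⊗[K] A ≃ₐ[L] Matrix Unit Unit L ⊗[K] Matrix (Fin N) (Fin N) D :=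
    Algebra.TensorProduct.congr (Matrix.uniqueAlgEquiv (m := Unit) (R := L) (A := L)).symm e
  exact .of_matrix (e₁.trans (Matrix.kroneckerTMulAlgEquiv Unit (Fin N) K L L D))

theorem quaternion_baseChange [NeZero (2 : K)] (L : Type*) [Field L] [Algebra K L] {a b : K}
    (ha : a ≠ 0) (hb : b ≠ 0) : Nonempty (L ⊗[K] QuaternionAlgebra K a 0 b ≃ₐ[L]
      QuaternionAlgebra L (algebraMap K L a) 0 (algebraMap K L b)) := by
  have inj := (algebraMap K L).injective
  have : NeZero (2 : L) := ⟨by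
    have := inj.ne (NeZero.ne (2 : K)); rwa [map_ofNat, map_zero] at this⟩
  have hs : IsSimpleRing (QuaternionAlgebra L (algebraMap K L a) 0 (algebraMap K L b)) :=
    quaternion_isSimple (by rwa [Ne, map_eq_zero]) (by rwa [Ne, map_eq_zero])
  let q := QuaternionAlgebra.Basis.self K (c₁ := a) (c₂ := 0) (c₃ := b)
  let Q : QuaternionAlgebra.Basis (L ⊗[K] QuaternionAlgebra K a 0 b)
      (algebraMap K L a) 0 (algebraMap K L b) :=
    { i := 1 ⊗ₜ q.i
      j := 1 ⊗ₜ q.j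
      k := 1 ⊗ₜ q.k
      i_mul_i := by
        rw [Algebra.TensorProduct.tmul_mul_tmul, q.i_mul_i, TensorProduct.tmul_add,
          TensorProduct.tmul_smul]
        simp [Algebra.TensorProduct.one_def, algebraMap_smul]
      j_mul_j := by
        rw [Algebra.TensorProduct.tmul_mul_tmul, q.j_mul_j, TensorProduct.tmul_smul]
        simp [Algebra.TensorProduct.one_def, algebraMap_smul]
      i_mul_j := by
        rw [Algebra.TensorProduct.tmul_mul_tmul, q.i_mul_j, one_mul]
      j_mul_i := by
        rw [Algebra.TensorProduct.tmul_mul_tmul, q.j_mul_i, one_mul, TensorProduct.tmul_sub]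
        simp [TensorProduct.tmul_neg] }
  have hnt : Nontrivial (L ⊗[K] QuaternionAlgebra K a 0 b) := inferInstance
  have hinj : Function.Injective Q.liftHom := RingHom.injective Q.liftHom.toRingHom
  refine ⟨(AlgEquiv.ofBijective Q.liftHom ⟨hinj, ?_⟩).symm⟩
  have := LinearMap.injective_iff_surjective_of_finrank_eq_finrank (f := Q.liftHom.toLinearMap)
    (by rw [QuaternionAlgebra.finrank_eq_four, Module.finrank_baseChange,
      QuaternionAlgebra.finrank_eq_four])
  exact this.mp hinj

/-- A matrix algebra over a division algebra `D ≠ K` is not a matrix algebra over `K`. -/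
theorem not_matrix_of_noZeroDivisors [NoZeroDivisors D] {d : D}
    (hd : d ∉ Set.range (algebraMap K D)) {m n : Type*} [Fintype m] [DecidableEq m] [Fintype n]
    [DecidableEq n] [Nonempty n] (e : Matrix m m D ≃ₐ[K] Matrix n n K) : False := by
  obtain ⟨i⟩ := ‹Nonempty n›
  set E : Matrix m m D := e.symm (Matrix.single i i 1) with hE
  have hE0 : E ≠ 0 := by
    rw [hE, Ne, EmbeddingLike.map_eq_zero_iff]
    intro h
    have := congrFun (congrFun h i) i
    simp at this
  have key : ∀ X, ∃ c : K, E * X * E = c • E := fun X => by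
    refine ⟨e X i i, e.injective ?_⟩
    rw [map_mul, map_mul, map_smul, hE, AlgEquiv.apply_symm_apply, Matrix.single_mul_mul_single]
    simp
  obtain ⟨p, r, hu⟩ : ∃ p r, E p r ≠ 0 := by
    by_contra! h
    exact hE0 (Matrix.ext h)
  have key' : ∀ d : D, ∃ c : K, d * E p r = algebraMap K D c := fun d => by
    obtain ⟨c, hc⟩ := key (Matrix.single r p d)
    have h := congrFun (congrFun hc p) r
    rw [Matrix.mul_assoc, Matrix.mul_apply, Finset.sum_eq_single r] at h
    · rw [Matrix.single_mul_apply_same, Matrix.smul_apply, Algebra.smul_def, Algebra.commutes] at h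
      refine ⟨c, sub_eq_zero.mp ?_⟩
      have : E p r * (d * E p r - algebraMap K D c) = 0 := by rw [mul_sub, h, sub_self]
      exact (mul_eq_zero.mp this).resolve_left hu
    · intro j _ hj
      rw [Matrix.single_mul_apply_of_ne _ _ _ _ _ hj, mul_zero]
    · simp
  obtain ⟨c₁, h₁⟩ := key' 1
  obtain ⟨c, hc⟩ := key' d
  rw [one_mul] at h₁
  have hc₁ : c₁ ≠ 0 := fun h => hu (by rw [h₁, h, map_zero])
  refine hd ⟨c * c₁⁻¹, ?_⟩
  rw [map_mul, ← hc, h₁, mul_assoc, ← map_mul, mul_inv_cancel₀ hc₁, map_one, mul_one]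

theorem quaternion_noZeroDivisors {a b : K}
    (h : ∀ x y z : K, z ^ 2 * b = x ^ 2 - a * y ^ 2 → z = 0) (ha : ¬ IsSquare a) :
    NoZeroDivisors (QuaternionAlgebra K a 0 b) := by
  have hsq : ∀ x y : K, x ^ 2 - a * y ^ 2 = 0 → x = 0 ∧ y = 0 := fun x y hxy => by
    have hy : y = 0 := by
      by_contra hy
      exact ha ⟨x / y, by field_simp; linear_combination -hxy⟩
    subst hy
    exact ⟨by simpa using hxy, rfl⟩
  have norm : ∀ x : QuaternionAlgebra K a 0 b, star x * x = 0 → x = 0 := fun x hx => by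
    have h0 := congrArg QuaternionAlgebra.re hx
    simp at h0
    have h1 : x.imJ ^ 2 - a * x.imK ^ 2 = 0 := by
      refine h (x.re * x.imJ + a * x.imI * x.imK) (x.re * x.imK + x.imI * x.imJ) _ ?_
      linear_combination -(x.imJ ^ 2 - a * x.imK ^ 2) * h0
    obtain ⟨hj, hk⟩ := hsq _ _ h1
    obtain ⟨hr, hi⟩ := hsq x.re x.imI (by rw [hj, hk] at h0; linear_combination h0)
    ext <;> simp [hr, hi, hj, hk]
  have norm' : ∀ x : QuaternionAlgebra K a 0 b, ∃ c : K, star x * x = algebraMap K _ c :=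
    fun x => ⟨_, QuaternionAlgebra.star_mul_eq_coe x⟩
  refine ⟨fun {x y} hxy => ?_⟩
  obtain ⟨c, hc⟩ := norm' x
  have h1 : c • y = 0 := by
    rw [Algebra.smul_def, ← hc, mul_assoc, hxy, mul_zero]
  rcases smul_eq_zero.mp h1 with h1 | h1
  · exact .inl (norm x (by rw [hc, h1, map_zero]))
  · exact .inr h1

theorem not_sameBrauerClass_of_noZeroDivisors.{u, v} {L : Type u} [Field L] {A : Type v}
    {D : Type*} {B : Type v} [Ring A] [Algebra L A] [Ring B] [Algebra L B] [Ring D] [Algebra L D]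
    [NoZeroDivisors D] {d : D} (hd : d ∉ Set.range (algebraMap L D)) (hA : IsMatrixOver L A D)
    (e : B ≃ₐ[L] L) : ¬ SameBrauerClass L A B := by
  rintro ⟨A', B', ⟨eA⟩, ⟨eB⟩, m, n, hm, hn, ⟨f⟩⟩
  obtain ⟨N, hN, ⟨g⟩⟩ := hA
  have : Nonempty (Fin n) := ⟨⟨0, by omega⟩⟩
  have e₁ : Matrix (Fin m × Fin N) (Fin m × Fin N) D ≃ₐ[L] Matrix (Fin m) (Fin m) A' :=
    ((eA.trans g).mapMatrix.trans (Matrix.compAlgEquiv (Fin m) (Fin N) D L)).symm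
  exact not_matrix_of_noZeroDivisors hd ((e₁.trans f).trans (eB.trans e).mapMatrix)

end Brauer

end OrthChar
end

noncomputable section
namespace OrthChar

section SpecialLinear

open Matrix

variable {F : Type*} [Field F]

/-- The unipotent matrix `(1 x; 0 1)`. -/
def upper (x : F) : SpecialLinearGroup (Fin 2) F := ⟨!![1, x; 0, 1], by simp⟩

/-- The matrix `(0 1; -1 0)`. -/
def weyl : SpecialLinearGroup (Fin 2) F := ⟨!![0, 1; -1, 0], by simp⟩

/-- The companion matrix of `X ^ 2 - t X + 1`. -/
def companion (t : F) : SpecialLinearGroup (Fin 2) F := ⟨!![0, -1; 1, t], by simp⟩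

@[simp]
theorem coe_upper (x : F) : (upper x : Matrix (Fin 2) (Fin 2) F) = !![1, x; 0, 1] := rfl

@[simp]
theorem coe_weyl : ((weyl : SpecialLinearGroup (Fin 2) F) : Matrix (Fin 2) (Fin 2) F) =
    !![0, 1; -1, 0] := rfl

@[simp]
theorem coe_companion (t : F) : (companion t : Matrix (Fin 2) (Fin 2) F) = !![0, -1; 1, t] := rfl

@[simp]
theorem coe_matA (s : Fˣ) : (matA s : Matrix (Fin 2) (Fin 2) F) =
    !![(s : F), 0; 0, (s⁻¹ : Fˣ)] := rfl

/-- The trace of a matrix in `SL₂`. -/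
def tr (g : SpecialLinearGroup (Fin 2) F) : F := g 0 0 + g 1 1

theorem det_eq_one (g : SpecialLinearGroup (Fin 2) F) : g 0 0 * g 1 1 - g 0 1 * g 1 0 = 1 := by
  have := g.2
  rwa [det_fin_two] at this

theorem tr_mul (g h : SpecialLinearGroup (Fin 2) F) :
    tr (g * h) = g 0 0 * h 0 0 + g 0 1 * h 1 0 + (g 1 0 * h 0 1 + g 1 1 * h 1 1) := by
  simp [tr, mul_apply, Fin.sum_univ_two]

theorem tr_mul_tr (g h : SpecialLinearGroup (Fin 2) F) :
    tr g * tr h = tr (g * h) + tr (g * h⁻¹) := by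
  rw [tr_mul, tr_mul, SpecialLinearGroup.SL2_inv_expl]
  simp [tr]
  ring

theorem upper_mul (x y : F) : upper x * upper y = upper (x + y) := by
  ext i j
  fin_cases i <;> fin_cases j <;> simp [mul_apply, Fin.sum_univ_two, add_comm]

theorem upper_zero : upper (0 : F) = 1 := by
  ext i j
  fin_cases i <;> fin_cases j <;> simp

theorem upper_inv (x : F) : (upper x)⁻¹ = upper (-x) := by
  rw [inv_eq_iff_mul_eq_one, upper_mul, add_neg_cancel, upper_zero]

theorem matA_mul_upper (s : Fˣ) (x : F) :
    matA s * upper x = upper ((s : F) ^ 2 * x) * matA s := by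
  ext i j
  fin_cases i <;> fin_cases j <;> simp [mul_apply, Fin.sum_univ_two]
  field_simp

theorem matA_mul (s t : Fˣ) : matA s * matA t = matA (s * t) := by
  ext i j
  fin_cases i <;> fin_cases j <;> simp [mul_apply, Fin.sum_univ_two, mul_comm]

theorem matA_one : matA (1 : Fˣ) = 1 := by
  ext i j
  fin_cases i <;> fin_cases j <;> simp

theorem matA_pow (s : Fˣ) (n : ℕ) : matA s ^ n = matA (s ^ n) := by
  induction n with
  | zero => rw [pow_zero, pow_zero, matA_one]
  | succ n ih => rw [pow_succ, pow_succ, ih, matA_mul]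

theorem matA_inv (s : Fˣ) : (matA s)⁻¹ = matA s⁻¹ := by
  rw [inv_eq_iff_mul_eq_one, matA_mul, mul_inv_cancel, matA_one]

theorem matA_injective : Function.Injective (matA : Fˣ → _) := fun s t h => by
  have := congrArg (fun g : SpecialLinearGroup (Fin 2) F => g 0 0) h
  simpa [Units.ext_iff] using this

theorem tr_upper (x : F) : tr (upper x) = 2 := by
  simp [tr]; norm_num

theorem tr_upper_matA (x : F) (s : Fˣ) : tr (upper x * matA s) = s + (s : F)⁻¹ := by
  rw [tr_mul]; simp

theorem tr_upper_weyl_upper_matA_weyl (x y : F) (s : Fˣ) :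
    tr (upper x * (weyl⁻¹ * upper y * matA s * weyl)) = s + (s : F)⁻¹ - x * y * (s : F)⁻¹ := by
  rw [tr_mul]
  simp [SpecialLinearGroup.coe_inv, adjugate_fin_two_of, mul_apply, Fin.sum_univ_two]
  ring

section CharTwo

variable [CharP F 2]

theorem pow_two_eq_one_of_tr_eq_zero {g : SpecialLinearGroup (Fin 2) F} (h : tr g = 0) :
    g ^ 2 = 1 := by
  have hd := det_eq_one g
  have h11 : g 1 1 = g 0 0 := by
    rw [tr] at h
    rw [eq_neg_of_add_eq_zero_right h, CharTwo.neg_eq]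
  rw [h11] at hd
  have h2 : (2 : F) = 0 := CharTwo.two_eq_zero
  ext i j
  fin_cases i <;> fin_cases j <;> simp [pow_two, mul_apply, Fin.sum_univ_two, h11]
  · linear_combination hd + g 0 1 * g 1 0 * h2
  · linear_combination g 0 0 * g 0 1 * h2
  · linear_combination g 0 0 * g 1 0 * h2
  · linear_combination hd + g 0 1 * g 1 0 * h2

theorem dvd_of_tr_pow_eq_zero {g : SpecialLinearGroup (Fin 2) F} (hg : Odd (orderOf g)) {k : ℕ}
    (h : tr (g ^ k) = 0) : orderOf g ∣ k := by
  have := pow_two_eq_one_of_tr_eq_zero h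
  rw [← pow_mul] at this
  exact (Nat.Coprime.dvd_mul_right (Nat.Coprime.symm (Nat.coprime_two_left.mpr hg))).mp
    (orderOf_dvd_of_pow_eq_one this)

theorem eq_of_tr_pow_eq {g : SpecialLinearGroup (Fin 2) F} (hg : Odd (orderOf g)) {k l : ℕ}
    (hl : 0 < l) (hkl : k + l < orderOf g) (hle : l ≤ k) (h : tr (g ^ k) = tr (g ^ l)) :
    k = l := by
  have h2 : (2 : F) = 0 := CharTwo.two_eq_zero
  have hsq : ∀ m, tr (g ^ (2 * m)) = tr (g ^ m) ^ 2 := fun m => by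
    have := tr_mul_tr (g ^ m) (g ^ m)
    have h1 : tr (1 : SpecialLinearGroup (Fin 2) F) = 2 := by simp [tr]; norm_num
    rw [mul_inv_cancel, h1, h2, add_zero, ← pow_add] at this
    rw [two_mul, ← this, sq]
  have key := tr_mul_tr (g ^ (k + l)) (g ^ (k - l))
  have e1 : g ^ (k + l) * g ^ (k - l) = g ^ (2 * k) := by
    rw [← pow_add]; congr 1; omega
  have e2 : g ^ (k + l) * (g ^ (k - l))⁻¹ = g ^ (2 * l) := by
    rw [mul_inv_eq_iff_eq_mul, ← pow_add]; congr 1; omega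
  rw [e1, e2, hsq, hsq, h, CharTwo.add_self_eq_zero, mul_eq_zero] at key
  rcases key with h0 | h0
  · have := Nat.le_of_dvd (by omega) (dvd_of_tr_pow_eq_zero hg h0); omega
  · have := Nat.eq_zero_of_dvd_of_lt (dvd_of_tr_pow_eq_zero hg h0) (by omega); omega

theorem exists_conj_companion [Finite F] {g : SpecialLinearGroup (Fin 2) F} (hg : g ≠ 1) :
    ∃ h : SpecialLinearGroup (Fin 2) F, g = h * companion (tr g) * h⁻¹ := by
  have hd := det_eq_one g
  obtain ⟨x, y, hxy⟩ : ∃ x y : F,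
      x * (g 1 0 * x + g 1 1 * y) - y * (g 0 0 * x + g 0 1 * y) ≠ 0 := by
    by_contra! H
    have h1 : g 1 0 = 0 := by simpa using H 1 0
    have h2 : g 0 1 = 0 := by simpa using H 0 1
    have h3 : g 1 1 = g 0 0 := by
      have := H 1 1
      rw [h1, h2] at this
      linear_combination this
    have h4 : g 0 0 = 1 := by
      rw [h1, h2, h3] at hd
      have : g 0 0 ^ 2 = 1 ^ 2 := by linear_combination hd
      exact CharTwo.sq_injective this
    exact hg (by ext i j; fin_cases i <;> fin_cases j <;> simp [h1, h2, h3, h4])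
  have : Fintype F := Fintype.ofFinite F
  obtain ⟨s, hs⟩ : ∃ s, s ^ 2 = x * (g 1 0 * x + g 1 1 * y) - y * (g 0 0 * x + g 0 1 * y) :=
    (Finite.injective_iff_surjective.mp (CharTwo.sq_injective (R := F))) _
  have hs0 : s ≠ 0 := fun h => hxy (by rw [← hs, h]; simp)
  obtain ⟨h, hh⟩ : ∃ h : SpecialLinearGroup (Fin 2) F, (h : Matrix (Fin 2) (Fin 2) F) =
      !![x / s, (g 0 0 * x + g 0 1 * y) / s; y / s, (g 1 0 * x + g 1 1 * y) / s] :=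
    ⟨⟨_, by rw [det_fin_two_of]; field_simp; linear_combination -hs⟩, rfl⟩
  refine ⟨h, eq_mul_inv_iff_mul_eq.mpr ?_⟩
  ext i j
  fin_cases i <;> fin_cases j <;>
    simp [mul_apply, Fin.sum_univ_two, tr, hh] <;> field_simp
  · linear_combination -x * hd
  · linear_combination -y * hd

end CharTwo

section ConjugacyClasses

variable [Fintype F] {q : ℕ} {ν : Fˣ} {b : SpecialLinearGroup (Fin 2) F}

theorem charP_two_of_card {n : ℕ} (h : Fintype.card F = 2 ^ n) : CharP F 2 := by
  have : Fact (Nat.Prime 2) := ⟨Nat.prime_two⟩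
  obtain ⟨p, hp⟩ := CharP.exists F
  obtain ⟨m, hpp, hm⟩ := FiniteField.card F p
  have : p ∣ 2 ^ n := by rw [← h, hm]; exact dvd_pow_self p m.ne_zero
  have := (Nat.prime_dvd_prime_iff_eq hpp Nat.prime_two).mp (hpp.dvd_of_dvd_pow this)
  rwa [this] at hp

/-- Representatives of the conjugacy classes of non-identity elements. -/
def classRep (q : ℕ) (ν : Fˣ) (b : SpecialLinearGroup (Fin 2) F) :
    Unit ⊕ (Finset.Icc 1 ((q - 2) / 2) ⊕ Finset.Icc 1 (q / 2)) → SpecialLinearGroup (Fin 2) F :=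
  Sum.elim (fun _ => matC) (Sum.elim (fun l => matA ν ^ (l : ℕ)) fun m => b ^ (m : ℕ))

theorem orderOf_matA (hν : ∀ x : Fˣ, x ∈ Subgroup.zpowers ν) :
    orderOf (matA ν) = Fintype.card F - 1 := by
  have h1 : orderOf ν = Fintype.card F - 1 := by
    rw [orderOf_eq_card_of_forall_mem_zpowers hν, Nat.card_units, Nat.card_eq_fintype_card]
  rw [← h1]
  refine orderOf_eq_orderOf_iff.mpr fun n => ?_
  rw [matA_pow, ← matA_one, matA_injective.eq_iff]

variable (hF : Fintype.card F = q) (hq : Even q) (hq4 : 4 ≤ q) [CharP F 2]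
  (hν : ∀ x : Fˣ, x ∈ Subgroup.zpowers ν) (hb : orderOf b = q + 1)

include hF hq hq4 hν hb

theorem bijective_tr_classRep : Function.Bijective fun i => tr (classRep q ν b i) := by
  have ha : orderOf (matA ν) = q - 1 := by rw [orderOf_matA hν, hF]
  have ha' : Odd (orderOf (matA ν)) := by rw [ha]; exact Nat.Even.sub_odd (by omega) hq odd_one
  have hb' : Odd (orderOf b) := by rw [hb]; exact hq.add_odd odd_one
  have hc : tr (matC : SpecialLinearGroup (Fin 2) F) = 0 := by
    simp [tr, matC]; rw [one_add_one_eq_two, CharTwo.two_eq_zero]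
  have ha0 : ∀ l ∈ Finset.Icc 1 ((q - 2) / 2), tr (matA ν ^ l) ≠ 0 := fun l hl h => by
    rw [Finset.mem_Icc] at hl
    have := Nat.le_of_dvd (by omega) (dvd_of_tr_pow_eq_zero ha' h)
    omega
  have hb0 : ∀ m ∈ Finset.Icc 1 (q / 2), tr (b ^ m) ≠ 0 := fun l hl h => by
    rw [Finset.mem_Icc] at hl
    have := Nat.le_of_dvd (by omega) (dvd_of_tr_pow_eq_zero hb' h)
    omega
  have hab : ∀ l ∈ Finset.Icc 1 ((q - 2) / 2), ∀ m ∈ Finset.Icc 1 (q / 2),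
      tr (matA ν ^ l) ≠ tr (b ^ m) := fun l hl m hm h => by
    rw [Finset.mem_Icc] at hl hm
    have h1 : matA ν ^ l ≠ 1 := fun h1 => by
      have := Nat.le_of_dvd (by omega) (orderOf_dvd_of_pow_eq_one h1); omega
    have h2 : b ^ m ≠ 1 := fun h1 => by
      have := Nat.le_of_dvd (by omega) (orderOf_dvd_of_pow_eq_one h1); omega
    obtain ⟨x, hx⟩ := exists_conj_companion h1
    obtain ⟨y, hy⟩ := exists_conj_companion h2
    have hxy : b ^ m = (y * x⁻¹) * matA ν ^ l * (y * x⁻¹)⁻¹ := by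
      rw [hy, ← h]
      conv_rhs => rw [hx]
      group
    have h3 : (b ^ m) ^ (q - 1) = 1 := by
      rw [hxy, conj_pow, ← pow_mul, mul_comm l, pow_mul, ← ha, pow_orderOf_eq_one, one_pow]
      group
    have h4 : orderOf b ∣ m * (q - 1) := orderOf_dvd_of_pow_eq_one (by rw [pow_mul, h3])
    have h5 : Nat.Coprime (q + 1) (q - 1) := by
      have : (q + 1).gcd (q - 1) ∣ 2 := by
        have := Nat.dvd_sub (Nat.gcd_dvd_left (q + 1) (q - 1)) (Nat.gcd_dvd_right (q + 1) (q - 1))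
        rwa [show q + 1 - (q - 1) = 2 by omega] at this
      rcases (Nat.dvd_prime Nat.prime_two).mp this with h | h
      · exact h
      · have := Nat.gcd_dvd_left (q + 1) (q - 1)
        rw [h] at this
        obtain ⟨k, hk⟩ := hq
        omega
    rw [hb] at h4
    have := Nat.le_of_dvd (by omega) (h5.dvd_of_dvd_mul_right h4)
    omega
  rw [Fintype.bijective_iff_injective_and_card]
  refine ⟨?_, ?_⟩
  · have inj : ∀ (g : SpecialLinearGroup (Fin 2) F) (N : ℕ), Odd (orderOf g) →
        2 * N < orderOf g → ∀ k l : Finset.Icc 1 N,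
        tr (g ^ (k : ℕ)) = tr (g ^ (l : ℕ)) → k = l := by
      rintro g N hg hN ⟨k, hk⟩ ⟨l, hl⟩ h
      rw [Finset.mem_Icc] at hk hl
      rw [Subtype.mk.injEq]
      rcases le_total l k with h1 | h1
      · exact eq_of_tr_pow_eq hg (by omega) (by omega) h1 h
      · exact (eq_of_tr_pow_eq hg (by omega) (by omega) h1 h.symm).symm
    rintro (u | l | m) (u' | l' | m') h
    · rfl
    · exact absurd (h.symm.trans hc) (ha0 _ l'.2)
    · exact absurd (h.symm.trans hc) (hb0 _ m'.2)
    · exact absurd (h.trans hc) (ha0 _ l.2)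
    · rw [inj _ _ ha' (by omega) _ _ h]
    · exact absurd h (hab _ l.2 _ m'.2)
    · exact absurd (h.trans hc) (hb0 _ m.2)
    · exact absurd h.symm (hab _ l'.2 _ m.2)
    · rw [inj _ _ hb' (by omega) _ _ h]
  · obtain ⟨k, hk⟩ := hq
    simp [hF]
    omega

theorem classRep_ne_one (i) : classRep q ν b i ≠ 1 := by
  have ha : orderOf (matA ν) = q - 1 := by rw [orderOf_matA hν, hF]
  rcases i with u | l | m
  · intro h
    have : (matC : SpecialLinearGroup (Fin 2) F) 1 0 = (1 : SpecialLinearGroup (Fin 2) F) 1 0 :=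
      congrArg (fun g : SpecialLinearGroup (Fin 2) F => g 1 0) h
    simp [matC] at this
  · intro h
    have hl := Finset.mem_Icc.mp l.2
    have := Nat.le_of_dvd (by omega) (orderOf_dvd_of_pow_eq_one h)
    omega
  · intro h
    have hm := Finset.mem_Icc.mp m.2
    have := Nat.le_of_dvd (by omega) (orderOf_dvd_of_pow_eq_one h)
    omega

variable {χ : SpecialLinearGroup (Fin 2) F → ℂ} (hχ : ∀ g h, χ (h * g * h⁻¹) = χ g)

omit hF hq hq4 hν hb in
theorem apply_eq_companion (hχ : ∀ g h, χ (h * g * h⁻¹) = χ g)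
    {g : SpecialLinearGroup (Fin 2) F} (hg : g ≠ 1) : χ g = χ (companion (tr g)) := by
  obtain ⟨h, hh⟩ := exists_conj_companion hg
  conv_lhs => rw [hh, hχ]

include hχ

theorem apply_classRep (i) : χ (companion (tr (classRep q ν b i))) = χ (classRep q ν b i) :=
  (apply_eq_companion hχ (classRep_ne_one hF hq hq4 hν hb i)).symm

theorem apply_cases (g : SpecialLinearGroup (Fin 2) F) :
    g = 1 ∨ ∃ i, χ g = χ (classRep q ν b i) := by
  refine or_iff_not_imp_left.mpr fun hg => ?_
  obtain ⟨i, hi⟩ := (bijective_tr_classRep hF hq hq4 hν hb).2 (tr g)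
  exact ⟨i, by rw [apply_eq_companion hχ hg, ← apply_classRep hF hq hq4 hν hb hχ, ← hi]⟩

theorem sum_companion : ∑ t, χ (companion t) = χ matC +
    (∑ l ∈ Finset.Icc 1 ((q - 2) / 2), χ (matA ν ^ l) + ∑ m ∈ Finset.Icc 1 (q / 2), χ (b ^ m)) := by
  rw [← (bijective_tr_classRep hF hq hq4 hν hb).sum_comp]
  simp only [apply_classRep hF hq hq4 hν hb hχ]
  rw [Fintype.sum_sum_type, Fintype.sum_sum_type]
  simp only [classRep, Sum.elim_inl, Sum.elim_inr, Finset.univ_unique, Finset.sum_singleton]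
  rw [Finset.sum_coe_sort (Finset.Icc 1 ((q - 2) / 2)) (fun l => χ (matA ν ^ l)),
    Finset.sum_coe_sort (Finset.Icc 1 (q / 2)) (fun l => χ (b ^ l))]

theorem apply_companion_zero : χ (companion 0) = χ matC := by
  have h : χ matC = χ (companion (tr matC)) :=
    apply_eq_companion hχ (classRep_ne_one hF hq hq4 hν hb (.inl ()))
  rw [h]
  simp [tr, matC]
  rw [one_add_one_eq_two, CharTwo.two_eq_zero]

end ConjugacyClasses

end SpecialLinear

end OrthChar
end

noncomputable section
namespace OrthChar

section Average

variable {G : Type*} [Group G] [Fintype G]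

/-- The action of the element `∑ c g • g` of the group algebra. -/
def average {k W : Type*} [Field k] [AddCommGroup W] [Module k W] (c : G → ℚ)
    (σ : Representation k G W) : W →ₗ[k] W :=
  ∑ g, (c g : k) • σ g

theorem average_apply {k W : Type*} [Field k] [AddCommGroup W] [Module k W] (c : G → ℚ)
    (σ : Representation k G W) (x : W) : average c σ x = ∑ g, (c g : k) • σ g x := by
  simp [average, LinearMap.sum_apply]

theorem span_orbit_eq_top {k W : Type*} [Field k] [AddCommGroup W] [Module k W]
    {σ : Representation k G W} (hσ : σ.IsIrreducible) {x : W} (hx : x ≠ 0) :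
    Submodule.span k (Set.range fun g => σ g x) = ⊤ := by
  let P : Subrepresentation σ :=
    { toSubmodule := Submodule.span k (Set.range fun g => σ g x)
      apply_mem_toSubmodule := fun g y hy => by
        induction hy using Submodule.span_induction with
        | mem y hy =>
          obtain ⟨h, rfl⟩ := hy
          exact Submodule.subset_span ⟨g * h, by simp⟩
        | zero => simp
        | add y z _ _ hy hz => rw [map_add]; exact add_mem hy hz
        | smul a y _ hy => rw [map_smul]; exact Submodule.smul_mem _ _ hy }
  have : IsSimpleOrder (Subrepresentation σ) := hσ
  rcases eq_bot_or_eq_top P with h | h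
  · exfalso
    have hxP : x ∈ P := Submodule.subset_span ⟨1, by simp⟩
    rw [h] at hxP
    exact hx hxP
  · exact congrArg Subrepresentation.toSubmodule h

theorem eq_zero_of_forall_apply_eq_zero {k W : Type*} [Field k] [AddCommGroup W] [Module k W]
    {σ : Representation k G W} (hσ : σ.IsIrreducible) {φ : W →ₗ[k] k} (hφ : φ ≠ 0) {x : W}
    (hx : ∀ g, φ (σ g x) = 0) : x = 0 := by
  by_contra h0
  refine hφ (LinearMap.ext fun y => ?_)
  have hy : y ∈ Submodule.span k (Set.range fun g => σ g x) := by
    rw [span_orbit_eq_top hσ h0]; trivial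
  induction hy using Submodule.span_induction with
  | mem y hy => obtain ⟨h, rfl⟩ := hy; exact hx h
  | zero => simp
  | add y z _ _ hy hz => rw [map_add, hy, hz]; simp
  | smul a y _ hy => rw [map_smul, hy]; simp

end Average

section Rational

variable {G V : Type*} [Group G] [Fintype G] [AddCommGroup V] [Module ℂ V]
  {ρ : Representation ℂ G V} {v : V} {φ : V →ₗ[ℂ] ℂ} (K : IntermediateField ℚ ℂ)

variable (ρ v) in
/-- The `K`-span of the orbit of `v`. -/
def orbitSpan : Submodule K V := Submodule.span K (Set.range fun g => ρ g v)

variable {K}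

theorem apply_mem_orbitSpan (g : G) {w : V} (hw : w ∈ orbitSpan ρ v K) :
    ρ g w ∈ orbitSpan ρ v K := by
  rw [orbitSpan] at hw
  induction hw using Submodule.span_induction with
  | mem y hy =>
    obtain ⟨h, rfl⟩ := hy
    exact Submodule.subset_span ⟨g * h, by simp⟩
  | zero => simp
  | add y z _ _ hy hz => rw [map_add]; exact add_mem hy hz
  | smul a y _ hy =>
    have : ρ g (a • y) = a • ρ g y := map_smul (ρ g) (a : ℂ) y
    rw [this]; exact Submodule.smul_mem _ _ hy

theorem apply_orbitSpan_mem (hK : ∀ g, φ (ρ g v) ∈ K) {w : V} (hw : w ∈ orbitSpan ρ v K) :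
    φ w ∈ K := by
  rw [orbitSpan] at hw
  induction hw using Submodule.span_induction with
  | mem y hy => obtain ⟨h, rfl⟩ := hy; exact hK h
  | zero => simp
  | add y z _ _ hy hz => rw [map_add]; exact add_mem hy hz
  | smul a y _ hy =>
    have : φ (a • y) = a * φ y := map_smul φ (a : ℂ) y
    rw [this]; exact mul_mem a.2 hy

theorem linearIndependent_complex (hρ : ρ.IsIrreducible) (hφ : φ ≠ 0) (hK : ∀ g, φ (ρ g v) ∈ K)
    {ι : Type*} [Fintype ι] {w : ι → orbitSpan ρ v K} (hw : LinearIndependent K w) :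
    LinearIndependent ℂ fun i => (w i : V) := by
  rw [Fintype.linearIndependent_iff] at hw ⊢
  intro c hc
  suffices h : ∀ ℓ : Module.Dual K ℂ, ∀ i, ℓ (c i) = 0 from
    fun i => (Module.forall_dual_apply_eq_zero_iff K (c i)).mp fun ℓ => h ℓ i
  intro ℓ
  apply hw
  apply Subtype.ext
  refine eq_zero_of_forall_apply_eq_zero hρ hφ fun g => ?_
  have h1 : ∀ i, ∃ k : K, (k : ℂ) = φ (ρ g (w i)) := fun i =>
    ⟨⟨_, apply_orbitSpan_mem hK (apply_mem_orbitSpan g (w i).2)⟩, rfl⟩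
  choose k hk using h1
  have h2 : ∑ i, c i * (k i : ℂ) = 0 := by
    have := congrArg (fun y => φ (ρ g y)) hc
    simpa [hk] using this
  have h3 : ∑ i, ℓ (c i) * k i = 0 := by
    have := congrArg ℓ h2
    rw [map_sum, map_zero] at this
    rw [← this]
    refine Finset.sum_congr rfl fun i _ => ?_
    rw [mul_comm (c i), mul_comm]
    exact (map_smul ℓ (k i) (c i)).symm
  have h4 : (((∑ i, ℓ (c i) • w i : orbitSpan ρ v K)) : V) = ∑ i, (ℓ (c i) : ℂ) • (w i : V) := by
    push_cast
    rfl
  rw [h4, map_sum, map_sum]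
  simp only [map_smul, smul_eq_mul, ← hk]
  exact_mod_cast h3

theorem span_orbitSpan (hρ : ρ.IsIrreducible) (hv : v ≠ 0) {ι : Type*} {w : ι → orbitSpan ρ v K}
    (hw : ⊤ ≤ Submodule.span K (Set.range w)) :
    ⊤ ≤ Submodule.span ℂ (Set.range fun i => (w i : V)) := by
  rw [← span_orbit_eq_top hρ hv, Submodule.span_le]
  have h : ∀ y : orbitSpan ρ v K, (y : V) ∈ Submodule.span ℂ (Set.range fun i => (w i : V)) :=
    fun y => by
      have hy : y ∈ Submodule.span K (Set.range w) := hw trivial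
      induction hy using Submodule.span_induction with
      | mem y hy => obtain ⟨i, rfl⟩ := hy; exact Submodule.subset_span ⟨i, rfl⟩
      | zero => simp
      | add y z _ _ hy hz => exact add_mem hy hz
      | smul a y _ hy => exact Submodule.smul_mem _ (a : ℂ) hy
  rintro _ ⟨g, rfl⟩
  exact h ⟨_, Submodule.subset_span ⟨g, rfl⟩⟩

instance : FiniteDimensional K (orbitSpan ρ v K) :=
  FiniteDimensional.span_of_finite K (Set.finite_range _)

/-- A `K`-basis of the orbit span is a `ℂ`-basis of `V`. -/
def complexBasis (hρ : ρ.IsIrreducible) (hv : v ≠ 0) (hφ : φ ≠ 0) (hK : ∀ g, φ (ρ g v) ∈ K)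
    {ι : Type*} [Fintype ι] (β : Module.Basis ι K (orbitSpan ρ v K)) : Module.Basis ι ℂ V :=
  .mk (linearIndependent_complex hρ hφ hK β.linearIndependent) (span_orbitSpan hρ hv β.span_eq.ge)

theorem finrank_orbitSpan (hρ : ρ.IsIrreducible) (hv : v ≠ 0) (hφ : φ ≠ 0)
    (hK : ∀ g, φ (ρ g v) ∈ K) : Module.finrank K (orbitSpan ρ v K) = Module.finrank ℂ V := by
  rw [Module.finrank_eq_card_basis
    (complexBasis hρ hv hφ hK (Module.finBasis K (orbitSpan ρ v K)))]
  simp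

variable (ρ v K) in
/-- The action of `G` on the orbit span. -/
def orbitRep : Representation K G (orbitSpan ρ v K) where
  toFun g :=
    { toFun := fun w => ⟨ρ g w, apply_mem_orbitSpan g w.2⟩
      map_add' := fun x y => by ext; simp
      map_smul' := fun a x => by
        ext
        exact map_smul (ρ g) (a : ℂ) (x : V) }
  map_one' := by ext; simp
  map_mul' g h := by ext; simp

theorem coe_orbitRep (g : G) (w : orbitSpan ρ v K) : (orbitRep ρ v K g w : V) = ρ g w := rfl

theorem orbitRep_isIrreducible (hρ : ρ.IsIrreducible) (hv : v ≠ 0) (hφ : φ ≠ 0)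
    (hK : ∀ g, φ (ρ g v) ∈ K) {c : G → ℚ} (hc : average c ρ = φ.smulRight v) :
    (orbitRep ρ v K).IsIrreducible := by
  let v' : orbitSpan ρ v K := ⟨v, Submodule.subset_span ⟨1, by simp⟩⟩
  have htop : Submodule.span K (Set.range fun g => orbitRep ρ v K g v') = ⊤ := by
    rw [eq_top_iff]
    rintro ⟨x, hx⟩ -
    rw [orbitSpan] at hx
    induction hx using Submodule.span_induction with
    | mem y hy => obtain ⟨g, rfl⟩ := hy; exact Submodule.subset_span ⟨g, rfl⟩
    | zero => exact zero_mem _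
    | add y z hy' hz' hy hz => exact add_mem (hy hy') (hz hz')
    | smul a y hy' hy => exact Submodule.smul_mem _ a (hy hy')
  have key : ∀ P : Subrepresentation (orbitRep ρ v K), ∀ x ∈ P, x ≠ 0 → P = ⊤ := by
    intro P x hx hx0
    obtain ⟨g, hg⟩ : ∃ g, φ (ρ g x) ≠ 0 := by
      by_contra! H
      exact hx0 (Subtype.ext (eq_zero_of_forall_apply_eq_zero hρ hφ H))
    let a : K := ⟨φ (ρ g x), apply_orbitSpan_mem hK (apply_mem_orbitSpan g x.2)⟩
    have ha : a ≠ 0 := fun h => hg (congrArg Subtype.val h)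
    have hav : a • v' ∈ P.toSubmodule := by
      have h1 : a • v' = ∑ h, (c h : K) • orbitRep ρ v K h (orbitRep ρ v K g x) := by
        ext
        have := LinearMap.congr_fun hc (ρ g x)
        rw [average_apply, LinearMap.smulRight_apply] at this
        push_cast
        simp only [coe_orbitRep]
        change φ (ρ g x) • v = ∑ h, ((c h : K) : ℂ) • _
        rw [← this]
        norm_cast
      rw [h1]
      exact Submodule.sum_mem _ fun h _ => Submodule.smul_mem _ _
        (P.apply_mem_toSubmodule _ (P.apply_mem_toSubmodule _ hx))
    have hv' : v' ∈ P.toSubmodule := by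
      have := P.toSubmodule.smul_mem a⁻¹ hav
      rwa [smul_smul, inv_mul_cancel₀ ha, one_smul] at this
    refine Subrepresentation.toSubmodule_injective (top_le_iff.mp ?_)
    change ⊤ ≤ P.toSubmodule
    rw [← htop, Submodule.span_le]
    rintro _ ⟨h, rfl⟩
    exact P.apply_mem_toSubmodule h hv'
  have hnt : Nontrivial (Subrepresentation (orbitRep ρ v K)) := by
    refine ⟨⊥, ⊤, fun h => hv ?_⟩
    have h1 : v' ∈ (⊤ : Subrepresentation (orbitRep ρ v K)) := trivial
    rw [← h] at h1
    exact congrArg Subtype.val (show v' = 0 from h1)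
  refine ⟨fun P => ?_⟩
  by_cases h : ∃ x ∈ P, x ≠ 0
  · obtain ⟨x, hx, hx0⟩ := h
    exact .inr (key P x hx hx0)
  · push Not at h
    refine .inl (le_bot_iff.mp fun x hx => ?_)
    exact h x hx

end Rational

end OrthChar
end

noncomputable section
namespace OrthChar

section Irreducible

variable {G k W W' : Type*} [Group G] [Field k] [AddCommGroup W] [Module k W] [AddCommGroup W']
  [Module k W']

theorem isIrreducible_of_linearEquiv {σ : Representation k G W} {σ' : Representation k G W'}
    (hσ : σ.IsIrreducible) (e : W ≃ₗ[k] W') (he : ∀ g x, e (σ g x) = σ' g (e x)) :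
    σ'.IsIrreducible := by
  have hs : IsSimpleOrder (Subrepresentation σ) := hσ
  have he' : ∀ g y, e.symm (σ' g y) = σ g (e.symm y) := fun g y => by
    rw [e.symm_apply_eq, he, e.apply_symm_apply]
  let f : Subrepresentation σ' → Subrepresentation σ := fun P =>
    { toSubmodule := P.toSubmodule.comap e.toLinearMap
      apply_mem_toSubmodule := fun g x hx => by
        rw [Submodule.mem_comap] at hx ⊢
        exact (he g x).symm ▸ P.apply_mem_toSubmodule g hx }
  have hf : Function.Injective f := fun P P' h => by
    apply Subrepresentation.toSubmodule_injective
    exact Submodule.comap_injective_of_surjective e.surjective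
      (congrArg Subrepresentation.toSubmodule h)
  have hbot : f ⊥ = ⊥ := by
    apply Subrepresentation.toSubmodule_injective
    exact LinearMap.ker_eq_bot.mpr e.injective
  have htop : f ⊤ = ⊤ := rfl
  have : Nontrivial (Subrepresentation σ') :=
    ⟨⊥, ⊤, fun h => bot_ne_top (by rw [← hbot, h, htop] : (⊥ : Subrepresentation σ) = ⊤)⟩
  refine ⟨fun P => ?_⟩
  rcases eq_bot_or_eq_top (f P) with h | h
  · exact .inl (hf (h.trans hbot.symm))
  · exact .inr (hf (h.trans htop.symm))

end Irreducible

section Existence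

variable {G V : Type*} [Group G] [Fintype G] [AddCommGroup V] [Module ℂ V]
  [FiniteDimensional ℂ V] {ρ : Representation ℂ G V} {v : V} {φ : V →ₗ[ℂ] ℂ}

theorem re_mul_of_mem_realCharField (a b : realCharField ρ) :
    ((a * b : realCharField ρ) : ℂ).re = (a : ℂ).re * (b : ℂ).re := by
  have h : ∀ a : realCharField ρ, (a : ℂ).im = 0 := fun a => by
    obtain ⟨r, hr⟩ := IntermediateField.mem_bot.mp a.2.2
    rw [← hr]; exact Complex.ofReal_im r
  push_cast
  rw [Complex.mul_re, h a, zero_mul, sub_zero]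

/-- The sum of the translates of the standard symmetric form. -/
def averagedForm {K : Type*} [Field K] {N : ℕ} (σ : Representation K G (Fin N → K)) :
    LinearMap.BilinForm K (Fin N → K) :=
  ∑ g, LinearMap.compl₁₂ (dotProductBilin K K) (σ g) (σ g)

theorem averagedForm_apply {K : Type*} [Field K] {N : ℕ} (σ : Representation K G (Fin N → K))
    (x y : Fin N → K) : averagedForm σ x y = ∑ g, ∑ i, σ g x i * σ g y i := by
  simp [averagedForm, LinearMap.sum_apply, dotProduct]

theorem averagedForm_isInvariant {K : Type*} [Field K] {N : ℕ}
    (σ : Representation K G (Fin N → K)) : IsInvariantForm σ (averagedForm σ) := by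
  refine ⟨fun x y => ?_, fun h x y => ?_⟩
  · simp only [averagedForm_apply, mul_comm]
  · simp only [averagedForm_apply]
    rw [← Equiv.sum_comp (Equiv.mulRight h)
      (fun g => ∑ i, σ g x i * σ g y i)]
    simp

theorem nonempty_orthModel (hρ : ρ.IsIrreducible) (hv : v ≠ 0) (hφ : φ ≠ 0)
    (hK : ∀ g, φ (ρ g v) ∈ realCharField ρ) {c : G → ℚ} (hc : average c ρ = φ.smulRight v) :
    Nonempty (OrthModel ρ) := by
  let β := Module.finBasis (realCharField ρ) (orbitSpan ρ v (realCharField ρ))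
  set N := Module.finrank (realCharField ρ) (orbitSpan ρ v (realCharField ρ))
  let e : orbitSpan ρ v (realCharField ρ) ≃ₗ[realCharField ρ]
      (Fin N → (realCharField ρ)) := β.equivFun
  let σ : Representation (realCharField ρ) G (Fin N → (realCharField ρ)) :=
    { toFun := fun g => e.toLinearMap ∘ₗ orbitRep ρ v (realCharField ρ) g ∘ₗ e.symm.toLinearMap
      map_one' := by ext; simp
      map_mul' := fun g h => by ext; simp }
  have hσ : ∀ g x, e (orbitRep ρ v (realCharField ρ) g x) = σ g (e x) := fun g x => by simp [σ]
  let γ := complexBasis hρ hv hφ hK β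
  let δ : Module.Basis (Fin N) ℂ (ℂ ⊗[realCharField ρ] (Fin N → (realCharField ρ))) :=
    Algebra.TensorProduct.basis ℂ (Pi.basisFun (realCharField ρ) (Fin N))
  let f : V ≃ₗ[ℂ] ℂ ⊗[realCharField ρ] (Fin N → (realCharField ρ)) := γ.equiv δ (Equiv.refl _)
  have hγ : ∀ i, γ i = β i := fun i => by simp [γ, complexBasis]
  have hfβ : ∀ x : orbitSpan ρ v (realCharField ρ), f x = 1 ⊗ₜ e x := fun x => by
    have h1 : (f.toLinearMap.restrictScalars (realCharField ρ)) ∘ₗ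
        (orbitSpan ρ v (realCharField ρ)).subtype =
        (TensorProduct.mk (realCharField ρ) ℂ (Fin N → (realCharField ρ)) 1) ∘ₗ e.toLinearMap := by
      refine β.ext fun i => ?_
      simp only [LinearMap.comp_apply, Submodule.subtype_apply, LinearEquiv.coe_coe,
        LinearMap.restrictScalars_apply, TensorProduct.mk_apply]
      rw [← hγ, Module.Basis.equiv_apply]
      simp only [δ, e, Equiv.refl_apply, Algebra.TensorProduct.basis_apply, Pi.basisFun_apply,
        Module.Basis.equivFun_self]
      refine congrArg (fun y => 1 ⊗ₜ[realCharField ρ] y) (funext fun j => ?_)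
      refine Eq.trans ?_ (β.equivFun_self i j).symm
      simp [Pi.single_apply, eq_comm]
    exact LinearMap.congr_fun h1 x
  have hN : 0 < N := by
    refine Module.finrank_pos_iff_exists_ne_zero.mpr ⟨⟨v, Submodule.subset_span ⟨1, by simp⟩⟩, ?_⟩
    exact fun h => hv (congrArg Subtype.val h)
  exact ⟨{
    W := Fin N → (realCharField ρ)
    σ := σ
    irreducible := isIrreducible_of_linearEquiv (orbitRep_isIrreducible hρ hv hφ hK hc) e hσ
    constituent := by
      refine ⟨f.toLinearMap, f.injective, fun g => ?_⟩
      have h2 : f.toLinearMap ∘ₗ ρ g = (σ g).baseChange ℂ ∘ₗ f.toLinearMap := by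
        refine γ.ext fun i => ?_
        simp only [LinearMap.comp_apply, LinearEquiv.coe_coe]
        rw [hγ, hfβ, ← coe_orbitRep, hfβ, hσ, LinearMap.baseChange_tmul]
      exact LinearMap.congr_fun h2
    F := averagedForm σ
    invariant := averagedForm_isInvariant σ
    ne_zero := fun h => by
      let x : Fin N → (realCharField ρ) := Pi.single ⟨0, hN⟩ 1
      have h0 : averagedForm σ x x = 0 := by rw [h]; rfl
      rw [averagedForm_apply] at h0
      have h1 := congrArg (fun a : realCharField ρ => (a : ℂ).re) h0
      simp only [AddSubmonoidClass.coe_finsetSum, Complex.re_sum, re_mul_of_mem_realCharField,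
        ZeroMemClass.coe_zero, Complex.zero_re] at h1
      rw [Finset.sum_eq_zero_iff_of_nonneg
        fun g _ => Finset.sum_nonneg fun i _ => mul_self_nonneg _] at h1
      have h2 := h1 1 (Finset.mem_univ _)
      rw [Finset.sum_eq_zero_iff_of_nonneg fun i _ => mul_self_nonneg _] at h2
      simpa [x] using h2 ⟨0, hN⟩ (Finset.mem_univ _) }⟩

end Existence

section Models

variable {G V : Type*} [Group G] [Fintype G] [AddCommGroup V] [Module ℂ V]
  [FiniteDimensional ℂ V] {ρ : Representation ℂ G V} {v : V} {φ : V →ₗ[ℂ] ℂ}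

theorem OrthModel.exists_intertwiner (M : OrthModel ρ) {x : V} (hx : x ≠ 0) :
    ∃ T : V →ₗ[realCharField ρ] M.W, (∀ g y, T (ρ g y) = M.σ g (T y)) ∧ T x ≠ 0 := by
  obtain ⟨f, hf, hfσ⟩ := M.constituent
  let β := Module.finBasis (realCharField ρ) M.W
  let δ := Algebra.TensorProduct.basis ℂ β
  have hfx : f x ≠ 0 := fun h => hx (hf (by rw [h, map_zero]))
  obtain ⟨i, hi⟩ : ∃ i, δ.repr (f x) i ≠ 0 := by
    by_contra! H
    exact hfx (δ.repr.map_eq_zero_iff.mp (Finsupp.ext H))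
  obtain ⟨ℓ, hℓ⟩ : ∃ ℓ : Module.Dual (realCharField ρ) ℂ, ℓ (δ.repr (f x) i) ≠ 0 := by
    by_contra! H
    exact hi ((Module.forall_dual_apply_eq_zero_iff (realCharField ρ) _).mp H)
  let S : ℂ ⊗[realCharField ρ] M.W →ₗ[realCharField ρ] M.W :=
    (TensorProduct.lid (realCharField ρ) M.W).toLinearMap ∘ₗ ℓ.rTensor M.W
  have hSt : ∀ a w, S (a ⊗ₜ w) = ℓ a • w := fun a w => rfl
  refine ⟨S ∘ₗ f.restrictScalars (realCharField ρ), fun g y => ?_, fun h => hℓ ?_⟩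
  · have hS : ∀ z, S ((M.σ g).baseChange ℂ z) = M.σ g (S z) := fun z => by
      induction z with
      | zero => simp
      | tmul a w =>
        rw [LinearMap.baseChange_tmul]
        rw [hSt, hSt, map_smul]
      | add a b ha hb => rw [map_add, map_add, ha, hb, map_add, map_add]
    simp [hfσ, hS]
  · have hS : ∀ z, β.repr (S z) i = ℓ (δ.repr z i) := fun z => by
      induction z with
      | zero => simp
      | tmul a w =>
        rw [hSt, map_smul, Algebra.TensorProduct.basis_repr_tmul]
        simp only [Finsupp.smul_apply, Finsupp.mapRange_apply, smul_eq_mul]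
        rw [mul_comm (ℓ a)]
        refine Eq.trans ?_ (congrArg ℓ (mul_comm _ _))
        exact (map_smul ℓ (β.repr w i) a).symm
      | add a b ha hb => simp [ha, hb]
    rw [← hS]
    simpa using congrArg (fun w => β.repr w i) h

theorem average_symm {K W : Type*} [Field K] [AddCommGroup W] [Module K W] {c : G → ℚ}
    (hc : ∀ g, c g⁻¹ = c g) {σ : Representation K G W} {F : LinearMap.BilinForm K W}
    (hF : IsInvariantForm σ F) (x y : W) : F (average c σ x) y = F x (average c σ y) := by
  simp only [average_apply, map_sum, LinearMap.sum_apply, map_smul, LinearMap.smul_apply]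
  rw [← Equiv.sum_comp (Equiv.inv G)]
  refine Finset.sum_congr rfl fun g _ => ?_
  rw [Equiv.inv_apply, hc, ← hF.2 g, ← Module.End.mul_apply, ← map_mul, mul_inv_cancel, map_one,
    Module.End.one_apply]

/-- The Gram matrix of an orbit in an orthogonal model. -/
theorem OrthModel.exists_orbit (M : OrthModel ρ) (hρ : ρ.IsIrreducible) (hv : φ v = 1)
    {m : G → realCharField ρ} (hm : ∀ g, (m g : ℂ) = φ (ρ g v)) {c : G → ℚ}
    (hcs : ∀ g, c g⁻¹ = c g) (hc : average c ρ = φ.smulRight v) :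
    M.dim ≤ Module.finrank ℂ V ∧
    ∃ (w : M.W) (a : realCharField ρ), a ≠ 0 ∧ ∀ g, M.F w (M.σ g w) = a * m g := by
  have hv0 : v ≠ 0 := fun h => by simp [h] at hv
  have hφ : φ ≠ 0 := fun h => by simp [h] at hv
  have hK : ∀ g, φ (ρ g v) ∈ (realCharField ρ) := fun g => hm g ▸ (m g).2
  obtain ⟨T, hT, hTv⟩ := M.exists_intertwiner hv0
  have hspan := span_orbit_eq_top M.irreducible hTv
  constructor
  · rw [← finrank_orbitSpan hρ hv0 hφ hK, OrthModel.dim]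
    refine LinearMap.finrank_le_finrank_of_surjective
      (f := T ∘ₗ (orbitSpan ρ v (realCharField ρ)).subtype) ?_
    rw [← LinearMap.range_eq_top, ← top_le_iff, ← hspan, Submodule.span_le]
    rintro _ ⟨g, rfl⟩
    exact ⟨⟨ρ g v, Submodule.subset_span ⟨g, rfl⟩⟩, hT g v⟩
  · have hTavg : ∀ y, T (average c ρ y) = average c M.σ (T y) := fun y => by
      simp only [average_apply, map_sum, ← hT]
      refine Finset.sum_congr rfl fun g _ => ?_
      refine (congrArg T ?_).trans (map_smul T (c g : realCharField ρ) (ρ g y))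
      change ((c g : ℚ) : ℂ) • _ = (((c g : ℚ) : (realCharField ρ)) : ℂ) • ρ g y
      norm_cast
    have hw : ∀ g, average c M.σ (M.σ g (T v)) = m g • T v := fun g => by
      rw [← hT, ← hTavg, hc, LinearMap.smulRight_apply, ← hm]
      exact map_smul T (m g) v
    have hm1 : m 1 = 1 := Subtype.ext (by rw [hm]; simpa using hv)
    have hF : ∀ g, M.F (T v) (M.σ g (T v)) = M.F (T v) (T v) * m g := fun g => by
      have h1 := average_symm hcs M.invariant (T v) (M.σ g (T v))
      have h2 := hw 1
      rw [map_one, Module.End.one_apply, hm1, one_smul] at h2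
      rw [h2, hw, map_smul, smul_eq_mul, mul_comm] at h1
      exact h1
    refine ⟨T v, M.F (T v) (T v), fun h0 => M.ne_zero ?_, hF⟩
    refine LinearMap.ext_on_range hspan fun g => LinearMap.ext_on_range hspan fun h => ?_
    rw [← M.invariant.2 g⁻¹, ← Module.End.mul_apply, ← map_mul, ← Module.End.mul_apply,
      ← map_mul, inv_mul_cancel, map_one, Module.End.one_apply, hF, h0, zero_mul]
    rfl

end Models

section RankOne

variable {G V : Type*} [Group G] [Fintype G] [AddCommGroup V] [Module ℂ V]
  [FiniteDimensional ℂ V] {ρ : Representation ℂ G V}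

theorem exists_smulRight_of_trace_eq_one {e : V →ₗ[ℂ] V} (he : e * e = e)
    (htr : LinearMap.trace ℂ V e = 1) : ∃ (φ : V →ₗ[ℂ] ℂ) (v : V), φ v = 1 ∧ e = φ.smulRight v := by
  have hproj : LinearMap.IsProj e.range e :=
    ⟨fun x => ⟨x, rfl⟩, fun x ⟨y, hy⟩ => by rw [← hy, ← Module.End.mul_apply, he]⟩
  have h1 : Module.finrank ℂ e.range = 1 := by
    have := hproj.trace
    rw [htr] at this
    exact_mod_cast this.symm
  obtain ⟨v, hv0, hv⟩ := finrank_eq_one_iff'.mp h1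
  have hc : ∀ x, ∃ a : ℂ, a • (v : V) = e x := fun x => by
    obtain ⟨a, ha⟩ := hv ⟨e x, x, rfl⟩
    exact ⟨a, congrArg Subtype.val ha⟩
  choose φ hφ using hc
  have hv0' : (v : V) ≠ 0 := fun h => hv0 (Subtype.ext h)
  have inj : ∀ a b : ℂ, a • (v : V) = b • (v : V) → a = b := fun a b h =>
    smul_left_injective ℂ hv0' h
  refine ⟨{ toFun := φ, map_add' := fun x y => inj _ _ ?_, map_smul' := fun a x => inj _ _ ?_ },
    v, ?_, ?_⟩
  · rw [add_smul, hφ, hφ, hφ, map_add]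
  · rw [smul_assoc, hφ, hφ, map_smul]; rfl
  · refine inj _ _ ?_
    change φ v • (v : V) = _
    rw [hφ, one_smul, hproj.map_id _ v.2]
  · ext x
    exact (hφ x).symm

end RankOne

end OrthChar
end

noncomputable section
namespace OrthChar

section Gram

open Matrix

variable {F : Type*} [Field F] [Fintype F]

section Forms

variable [CharP F 2] {K W : Type*} [Field K] [CharZero K] [AddCommGroup W] [Module K W]
  {σ : Representation K (SpecialLinearGroup (Fin 2) F) W} {B : LinearMap.BilinForm K W}
  (hB : IsInvariantForm σ B) {lam : F → ℤ} (h0 : lam 0 = 1) (hsum : ∑ x, lam x = 0)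
  {χ : SpecialLinearGroup (Fin 2) F → K} {X : F → K} (hX : ∀ g ≠ 1, χ g = X (tr g))
  {w : W} {a : K}
  (hw : ∀ g, B w (σ g w) = a * ((Fintype.card F : K)⁻¹ * ∑ x, (lam x : K) * χ (upper x * g)))

include hB in
theorem IsInvariantForm.apply_apply (g h : SpecialLinearGroup (Fin 2) F) (x y : W) :
    B (σ g x) (σ h y) = B x (σ (g⁻¹ * h) y) := by
  rw [← hB.2 g⁻¹, ← Module.End.mul_apply, ← map_mul, ← Module.End.mul_apply, ← map_mul,
    inv_mul_cancel, map_one, Module.End.one_apply]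

include h0 hsum in
theorem sum_lam_mul (f : F → K) (c : K) (hf : ∀ x ≠ 0, f x = c) :
    ∑ x, (lam x : K) * f x = f 0 - c := by
  classical
  have h1 : ∀ x, (lam x : K) * f x = lam x * c + if x = 0 then f 0 - c else 0 := fun x => by
    split_ifs with h
    · rw [h, h0]; push_cast; ring
    · rw [hf x h, add_zero]
  rw [Finset.sum_congr rfl fun x _ => h1 x, Finset.sum_add_distrib, ← Finset.sum_mul]
  have : ∑ x, (lam x : K) = 0 := by exact_mod_cast hsum
  rw [this]; simp

include hX in
theorem sum_lam_apply_upper (hsum : ∑ x, lam x = 0) (s : Fˣ) (hs : s ≠ 1) :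
    ∑ x, (lam x : K) * χ (upper x * matA s) = 0 := by
  have h1 : ∀ x, χ (upper x * matA s) = X (s + (s : F)⁻¹) := fun x => by
    rw [hX _ ?_, tr_upper_matA]
    intro h
    have := congrArg (fun g : SpecialLinearGroup (Fin 2) F => g 0 0) h
    simp [mul_apply, Fin.sum_univ_two] at this
    exact hs this
  rw [Finset.sum_congr rfl fun x _ => by rw [h1 x], ← Finset.sum_mul]
  have : ∑ x, (lam x : K) = 0 := by exact_mod_cast hsum
  rw [this, zero_mul]

variable (σ w) in
/-- The vector `∑ u_y w v`. -/
def bigCell : W := ∑ y : F, σ (upper y * weyl) w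

variable (hχ : χ 1 - X 0 = Fintype.card F)

include hB h0 hsum hX hw hχ in
theorem form_torus (s r : Fˣ) [Decidable (s = r)] :
    B (σ (matA s) w) (σ (matA r) w) = if s = r then a else 0 := by
  rw [hB.apply_apply, matA_inv, matA_mul, hw]
  split_ifs with h
  · rw [h, inv_mul_cancel, matA_one]
    simp only [mul_one]
    rw [sum_lam_mul h0 hsum _ (X 0), upper_zero, hχ, inv_mul_cancel₀ (by simp), mul_one]
    intro x hx
    rw [hX _ ?_, tr_upper, CharTwo.two_eq_zero]
    intro h
    have := congrArg (fun g : SpecialLinearGroup (Fin 2) F => g 0 1) h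
    simp at this
    exact hx this
  · rw [sum_lam_apply_upper hX hsum _ (by rw [Ne, inv_mul_eq_one]; exact h), mul_zero, mul_zero]

include hB hsum hw in
theorem form_torus_bigCell (s : Fˣ) : B (σ (matA s) w) (bigCell σ w) = 0 := by
  have key : ∀ (t : Fˣ) (x y : F), upper x * (matA t * (upper y * weyl)) =
      matA t * (upper ((t : F)⁻¹ ^ 2 * x + y) * weyl) := fun t x y => by
    rw [← upper_mul, ← mul_assoc, ← mul_assoc, ← mul_assoc, ← mul_assoc, matA_mul_upper,
      ← mul_assoc, inv_pow, mul_inv_cancel₀ (by simp), one_mul]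
  rw [bigCell, map_sum]
  simp only [hB.apply_apply, hw, matA_inv, key]
  rw [← Finset.mul_sum, ← Finset.mul_sum, Finset.sum_comm]
  simp only [← Finset.mul_sum]
  have h1 : ∀ x, ∑ y, χ (matA s⁻¹ * (upper (((s⁻¹ : Fˣ) : F)⁻¹ ^ 2 * x + y) * weyl)) =
      ∑ y, χ (matA s⁻¹ * (upper y * weyl)) := fun x =>
    Equiv.sum_comp (Equiv.addLeft (((s⁻¹ : Fˣ) : F)⁻¹ ^ 2 * x))
      (fun y => χ (matA s⁻¹ * (upper y * weyl)))
  simp only [h1]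
  have : ∑ x, (lam x : K) = 0 := by exact_mod_cast hsum
  rw [← Finset.sum_mul, this, zero_mul, mul_zero, mul_zero]

include hB h0 hsum hX hw in
theorem form_bigCell_torus (s : Fˣ) : B (bigCell σ w) (σ (matA s) (bigCell σ w)) =
    a * (∑ y, χ (weyl⁻¹ * upper y * matA s * weyl) - ∑ t, X t) := by
  have hne : (Fintype.card F : K) ≠ 0 := by simp
  have key : ∀ y y' : F, (upper y * weyl)⁻¹ * (matA s * (upper y' * weyl)) =
      weyl⁻¹ * upper (-y + (s : F) ^ 2 * y') * matA s * weyl := fun y y' => by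
    rw [← upper_mul, _root_.mul_inv_rev, upper_inv, ← mul_assoc (matA s), matA_mul_upper]
    simp only [mul_assoc]
  have h1 : B (bigCell σ w) (σ (matA s) (bigCell σ w)) =
      Fintype.card F * ∑ y, B w (σ (weyl⁻¹ * upper y * matA s * weyl) w) := by
    simp only [bigCell, map_sum, LinearMap.sum_apply, ← Module.End.mul_apply, ← map_mul]
    simp only [hB.apply_apply, key]
    rw [Finset.sum_comm]
    have h2 : ∀ y, ∑ y', B w (σ (weyl⁻¹ * upper (-y + (s : F) ^ 2 * y') * matA s * weyl) w) =
        ∑ y, B w (σ (weyl⁻¹ * upper y * matA s * weyl) w) := fun y =>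
      Equiv.sum_comp ((Equiv.mulLeft₀ ((s : F) ^ 2) (by simp)).trans (Equiv.addLeft (-y)))
        (fun y => B w (σ (weyl⁻¹ * upper y * matA s * weyl) w))
    simp only [h2]
    simp
  rw [h1]
  simp only [hw]
  rw [← Finset.mul_sum, ← Finset.mul_sum, Finset.sum_comm]
  simp only [← Finset.mul_sum]
  rw [sum_lam_mul h0 hsum _ (∑ t, X t)]
  · simp only [upper_zero, one_mul]
    field_simp
  · intro x hx
    have h3 : ∀ y, χ (upper x * (weyl⁻¹ * upper y * matA s * weyl)) =
        X (s + (s : F)⁻¹ - x * y * (s : F)⁻¹) := fun y => by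
      rw [hX _ ?_, tr_upper_weyl_upper_matA_weyl]
      intro h
      have h4 : upper x * (weyl⁻¹ * upper y * matA s * weyl) * weyl⁻¹ * (matA s)⁻¹ =
          weyl⁻¹ * (matA s)⁻¹ := by rw [h, one_mul]
      have h5 : upper x * weyl⁻¹ * upper y = weyl⁻¹ * (matA s)⁻¹ := by
        rw [← h4]; group
      rw [matA_inv] at h5
      have := congrArg (fun g : SpecialLinearGroup (Fin 2) F => g 0 0) h5
      simp [SpecialLinearGroup.coe_inv, adjugate_fin_two_of, mul_apply, Fin.sum_univ_two] at this
      exact hx this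
    simp only [h3]
    refine Equiv.sum_comp (((Equiv.mulLeft₀ (-x * (s : F)⁻¹) (by simp [hx])).trans
      (Equiv.addLeft (s + (s : F)⁻¹)))) X |>.symm.trans ?_ |>.symm
    refine Finset.sum_congr rfl fun y _ => congrArg X ?_
    simp
    ring

include hB h0 hsum hX hw in
theorem form_bigCell : B (bigCell σ w) (bigCell σ w) =
    a * (χ 1 + (Fintype.card F - 1) * X 0 - ∑ t, X t) := by
  classical
  have h := form_bigCell_torus hB h0 hsum hX hw 1
  rw [matA_one, map_one, Module.End.one_apply] at h
  rw [h]
  congr 2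
  have h1 : ∀ y, χ (weyl⁻¹ * upper y * 1 * weyl) = X 0 + if y = 0 then χ 1 - X 0 else 0 :=
    fun y => by
      split_ifs with hy
      · rw [hy, upper_zero, mul_one, mul_one, inv_mul_cancel]; ring
      · rw [hX _ ?_, add_zero]
        · congr 1
          have := tr_upper_weyl_upper_matA_weyl 0 y 1
          rw [upper_zero, one_mul, matA_one] at this
          rw [this]
          simp [one_add_one_eq_two, CharTwo.two_eq_zero]
        · intro h
          have h2 : upper y = 1 := by
            have : weyl * (weyl⁻¹ * upper y * 1 * weyl) * weyl⁻¹ = 1 := by rw [h]; group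
            rw [← this]; group
          have := congrArg (fun g : SpecialLinearGroup (Fin 2) F => g 0 1) h2
          simp at this
          exact hy this
  simp only [h1, Finset.sum_add_distrib]
  simp
  ring

include hB h0 hsum hX hw in
theorem form_bigCell_torus_of_ne (s : Fˣ) (hs : s ≠ 1) :
    B (bigCell σ w) (σ (matA s) (bigCell σ w)) =
    a * (Fintype.card F * X (s + (s : F)⁻¹) - ∑ t, X t) := by
  rw [form_bigCell_torus hB h0 hsum hX hw]
  congr 2
  have h1 : ∀ y, χ (weyl⁻¹ * upper y * matA s * weyl) = X (s + (s : F)⁻¹) := fun y => by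
    have h2 := tr_upper_weyl_upper_matA_weyl 0 y s
    rw [upper_zero, one_mul] at h2
    rw [hX _ ?_, h2]
    · simp
    · intro h
      have h3 : upper y * matA s = 1 := by
        have : weyl * (weyl⁻¹ * upper y * matA s * weyl) * weyl⁻¹ = 1 := by rw [h]; group
        rw [← this]; group
      have := congrArg (fun g : SpecialLinearGroup (Fin 2) F => g 0 0) h3
      simp [mul_apply, Fin.sum_univ_two] at this
      exact hs this
  simp [h1]

end Forms

section Additive

/-- A nontrivial additive character of a field of characteristic two. -/
theorem exists_lam [CharP F 2] : ∃ lam : F → ℤ, lam 0 = 1 ∧ (∀ x y, lam (x + y) = lam x * lam y) ∧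
    ∑ x, lam x = 0 := by
  have hz : ∀ a b : ZMod 2, (if a + b = 0 then (1 : ℤ) else -1) =
      (if a = 0 then 1 else -1) * (if b = 0 then 1 else -1) := by decide
  classical
  have : Fact (Nat.Prime 2) := ⟨Nat.prime_two⟩
  letI := ZMod.algebra F 2
  obtain ⟨ℓ, hℓ⟩ : ∃ ℓ : Module.Dual (ZMod 2) F, ℓ 1 ≠ 0 := by
    by_contra! H
    exact one_ne_zero ((Module.forall_dual_apply_eq_zero_iff (ZMod 2) (1 : F)).mp H)
  refine ⟨fun x => if ℓ x = 0 then 1 else -1, by simp, fun x y => ?_, ?_⟩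
  · beta_reduce
    rw [map_add, hz]
  · set S := ∑ x, if ℓ x = 0 then (1 : ℤ) else -1 with hS
    have h : S = -S := by
      conv_lhs => rw [hS, ← Equiv.sum_comp (Equiv.addRight (1 : F))]
      rw [hS, ← Finset.sum_neg_distrib]
      refine Finset.sum_congr rfl fun x _ => ?_
      rw [Equiv.coe_addRight, map_add, hz, if_neg hℓ]
      ring
    omega

end Additive

end Gram

end OrthChar
end

noncomputable section
namespace OrthChar

section OrthogonalBasis

variable {K W : Type*} [Field K] [AddCommGroup W] [Module K W] [FiniteDimensional K W]
  {ι : Type*} [Fintype ι] [DecidableEq ι] {B : LinearMap.BilinForm K W}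

theorem exists_basis_of_orthogonal {u : ι → W} {d : ι → K} (hd : ∀ i, d i ≠ 0)
    (hu : ∀ i j, B (u i) (u j) = if i = j then d i else 0)
    (hcard : Module.finrank K W ≤ Fintype.card ι) : ∃ β : Module.Basis ι K W, ∀ i, β i = u i := by
  have hli : LinearIndependent K u := by
    refine LinearMap.BilinForm.linearIndependent_of_iIsOrtho (B := B) (fun i j hij => ?_)
      fun i => ?_
    · change B (u i) (u j) = 0
      rw [hu, if_neg hij]
    · rw [hu, if_pos rfl]; exact hd i
  have hcard' : Fintype.card ι = Module.finrank K W :=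
    le_antisymm hli.fintype_card_le_finrank hcard
  rcases isEmpty_or_nonempty ι with h | h
  · have : Subsingleton W := by
      rw [Fintype.card_eq_zero] at hcard'
      exact Module.finrank_zero_iff.mp hcard'.symm
    exact ⟨Module.Basis.empty W, fun i => h.elim i⟩
  · exact ⟨basisOfLinearIndependentOfCardEqFinrank hli hcard', fun i => by simp⟩

theorem bilin_apply_self (β : Module.Basis ι K W) {d : ι → K}
    (hβ : ∀ i j, B (β i) (β j) = if i = j then d i else 0) (x : W) :
    B x x = ∑ i, d i * β.repr x i ^ 2 := by
  rw [← LinearMap.BilinForm.sum_repr_mul_repr_mul β x x, Finsupp.sum_fintype _ _ (by simp)]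
  refine Finset.sum_congr rfl fun i _ => ?_
  rw [Finsupp.sum_fintype _ _ (by simp), Finset.sum_eq_single i]
  · simp [hβ]; ring
  · intro j _ hj; simp [hβ, hj.symm]
  · simp

theorem hasSignedDisc_of_basis (β : Module.Basis ι K W) {d : ι → K}
    (hβ : ∀ i j, B (β i) (β j) = if i = j then d i else 0) {s : K} {t : K} (ht : t ≠ 0)
    (hs : (-1) ^ (Fintype.card ι * (Fintype.card ι - 1) / 2) * ∏ i, d i = t ^ 2 * s) :
    HasSignedDisc B s := by
  intro γ
  have hN : Fintype.card ι = Module.finrank K W := (Module.finrank_eq_card_basis β).symm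
  let e : ι ≃ Fin (Module.finrank K W) := Fintype.equivFinOfCardEq hN
  let β' := β.reindex e
  have hdiag : LinearMap.BilinForm.toMatrix β' B = Matrix.diagonal fun i => d (e.symm i) := by
    ext i j
    rw [LinearMap.BilinForm.toMatrix_apply, Matrix.diagonal_apply]
    simp [β', hβ]
  have hdet : (LinearMap.BilinForm.toMatrix γ B).det =
      (β'.toMatrix γ).det ^ 2 * ∏ i, d i := by
    rw [← LinearMap.BilinForm.toMatrix_mul_basis_toMatrix β' γ B, Matrix.det_mul, Matrix.det_mul,
      Matrix.det_transpose, hdiag, Matrix.det_diagonal, Equiv.prod_comp e.symm d]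
    ring
  have hunit : (β'.toMatrix γ).det ≠ 0 := by
    intro h
    have := congrArg Matrix.det (Module.Basis.toMatrix_mul_toMatrix_flip γ β')
    rw [Matrix.det_mul, h, mul_zero, Matrix.det_one] at this
    exact zero_ne_one this
  refine ⟨Units.mk0 ((β'.toMatrix γ).det * t) (mul_ne_zero hunit ht), ?_⟩
  rw [hN] at hs
  rw [hdet, Units.val_mk0]
  linear_combination (β'.toMatrix γ).det ^ 2 * hs

variable {α κ : Type*} [Fintype α] [DecidableEq α] [Fintype κ] [DecidableEq κ]

theorem even_isMatrixOver [NeZero (2 : K)] (β : Module.Basis (α ⊕ κ) K W) {a : K} (ha : a ≠ 0)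
    {b : κ → K}
    (hβ : ∀ i j, B (β i) (β j) = if i = j then Sum.elim (fun _ => a) (fun k => a * b k) i else 0)
    (o : α) : IsMatrixOver K (CliffordAlgebra.even (halfQuadraticForm B))
      (DiagClifford (Sum.elim (fun _ : {x : α // x ≠ o} => (-1 : K)) fun k => -b k)) := by
  have h2 : (2 : K) ≠ 0 := NeZero.ne 2
  let f : ({x : α // x ≠ o} ⊕ κ) ⊕ Unit ≃ α ⊕ κ :=
    { toFun := Sum.elim (Sum.map Subtype.val id) fun _ => .inl o
      invFun := Sum.elim (fun x => if h : x = o then .inr () else .inl (.inl ⟨x, h⟩))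
        fun k => .inl (.inr k)
      left_inv := by
        rintro ((⟨x, hx⟩ | k) | u) <;> simp [dif_neg, *]
      right_inv := by
        rintro (x | k) <;> simp
        split_ifs with h
        · simp [h]
        · simp }
  let e : W ≃ₗ[K] (({x : α // x ≠ o} ⊕ κ) → K) × K :=
    { toFun := fun x => (fun i => β.repr x (f (.inl i)), β.repr x (f (.inr ())))
      map_add' := fun x y => by ext <;> simp
      map_smul' := fun c x => by ext <;> simp
      invFun := fun p => β.equivFun.symm fun i => Sum.elim p.1 (fun _ => p.2) (f.symm i)
      left_inv := fun x => by
        rw [LinearEquiv.symm_apply_eq]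
        funext i
        obtain ⟨j, rfl⟩ := f.surjective i
        rw [Equiv.symm_apply_apply]
        rcases j with j | ⟨⟩ <;> simp
      right_inv := fun p => by
        have : ∀ j, β.repr (β.equivFun.symm fun i => Sum.elim p.1 (fun _ => p.2) (f.symm i)) (f j)
            = Sum.elim p.1 (fun _ => p.2) j := fun j => by
          rw [← Module.Basis.equivFun_apply, LinearEquiv.apply_symm_apply, Equiv.symm_apply_apply]
        ext i
        · exact this (.inl i)
        · exact this (.inr ()) }
  have hQ : ∀ x, halfQuadraticForm B x = (2⁻¹ * a) * (∑ i : {x : α // x ≠ o} ⊕ κ,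
      Sum.elim (fun _ => 1) b i * (e x).1 i ^ 2 + (e x).2 ^ 2) := fun x => by
    have h1 : halfQuadraticForm B x = 2⁻¹ * B x x := rfl
    rw [h1, bilin_apply_self β hβ, ← f.sum_comp, Fintype.sum_sum_type, Fintype.sum_sum_type,
      Fintype.sum_sum_type]
    simp only [Finset.univ_unique, Finset.sum_singleton, e, f, Equiv.coe_fn_mk, Sum.elim_inl,
      Sum.elim_inr, Sum.map_inl, Sum.map_inr, id_eq, LinearEquiv.coe_mk, LinearMap.coe_mk,
      AddHom.coe_mk, mul_assoc, ← Finset.mul_sum, one_mul]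
    rw [← mul_add, ← mul_add]
  refine .of_equiv ((evenEquivDiagClifford _ e (by simp [h2, ha]) _ hQ).trans
    (DiagClifford.reindex (Equiv.refl _) ?_))
  rintro (i | i) <;> simp

end OrthogonalBasis

section EmptyForm

variable {K : Type*} [Field K]

theorem isMatrixOver_of_isEmpty {κ : Type*} [Fintype κ] [IsEmpty κ] (w : κ → K) :
    IsMatrixOver K (DiagClifford w) K := by
  let e : (QuadraticMap.weightedSumSquares K w).IsometryEquiv (0 : QuadraticForm K Unit) :=
    { toFun := fun _ => ()
      invFun := fun _ => 0
      map_add' := fun _ _ => rfl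
      map_smul' := fun _ _ => rfl
      left_inv := fun _ => Subsingleton.elim _ _
      right_inv := fun _ => rfl
      map_app' := fun x => by simp [QuadraticMap.weightedSumSquares_apply] }
  exact .of_equiv ((CliffordAlgebra.equivOfIsometry e).trans CliffordAlgebraRing.equiv)

end EmptyForm

end OrthChar
end

noncomputable section
namespace OrthChar

open Matrix

section Average

variable {F : Type*} [Field F] [Fintype F] {lam : F → ℤ}

open Classical in
/-- The coefficients of the idempotent of the group algebra attached to an additive character. -/
def unipotentCoeff (lam : F → ℤ) (g : SpecialLinearGroup (Fin 2) F) : ℚ :=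
  (Fintype.card F : ℚ)⁻¹ * ∑ x, if upper x = g then (lam x : ℚ) else 0

theorem unipotentCoeff_inv [CharP F 2] (g : SpecialLinearGroup (Fin 2) F) :
    unipotentCoeff lam g⁻¹ = unipotentCoeff lam g := by
  classical
  simp only [unipotentCoeff]
  congr 1
  refine Finset.sum_congr rfl fun x _ => ?_
  have : upper x = g⁻¹ ↔ upper x = g := by
    rw [← inv_eq_iff_eq_inv, upper_inv, CharTwo.neg_eq]
  simp only [this]

variable [Fintype (SpecialLinearGroup (Fin 2) F)]

theorem average_unipotentCoeff {k W : Type*} [Field k] [CharZero k] [AddCommGroup W] [Module k W]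
    (σ : Representation k (SpecialLinearGroup (Fin 2) F) W) :
    average (unipotentCoeff lam) σ =
      (Fintype.card F : k)⁻¹ • ∑ x, (lam x : k) • σ (upper x) := by
  classical
  rw [average, Finset.smul_sum]
  have h1 : ∀ g, ((unipotentCoeff lam g : ℚ) : k) • σ g =
      ∑ x, if upper x = g then (Fintype.card F : k)⁻¹ • (lam x : k) • σ (upper x) else 0 :=
    fun g => by
      rw [unipotentCoeff]
      push_cast
      rw [Finset.mul_sum, Finset.sum_smul]
      refine Finset.sum_congr rfl fun x _ => ?_
      split_ifs with h
      · rw [h, smul_smul, Rat.cast_intCast]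
      · simp
  simp only [h1]
  rw [Finset.sum_comm]
  simp

variable {V : Type*} [AddCommGroup V] [Module ℂ V]
  {ρ : Representation ℂ (SpecialLinearGroup (Fin 2) F) V}

theorem average_unipotentCoeff_mul_self [CharP F 2] (h0 : lam 0 = 1)
    (hadd : ∀ x y, lam (x + y) = lam x * lam y) :
    average (unipotentCoeff lam) ρ * average (unipotentCoeff lam) ρ =
      average (unipotentCoeff lam) ρ := by
  have hsq : ∀ y, (lam y : ℂ) * lam y = 1 := fun y => by
    rw [← Int.cast_mul, ← hadd, CharTwo.add_self_eq_zero, h0, Int.cast_one]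
  have h1 : ∀ y, (∑ x, (lam x : ℂ) • ρ (upper x)) * ρ (upper y) =
      (lam y : ℂ) • ∑ x, (lam x : ℂ) • ρ (upper x) := fun y => by
    rw [Finset.sum_mul, Finset.smul_sum, ← Equiv.sum_comp (Equiv.addRight y)
      fun x => (lam y : ℂ) • (lam x : ℂ) • ρ (upper x)]
    refine Finset.sum_congr rfl fun x _ => ?_
    rw [smul_mul_assoc, ← map_mul, upper_mul, Equiv.coe_addRight, hadd, smul_smul]
    push_cast
    congr 1
    linear_combination -(lam x : ℂ) * hsq y
  rw [average_unipotentCoeff]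
  set E := ∑ x, (lam x : ℂ) • ρ (upper x) with hE
  have h2 : E * E = (Fintype.card F : ℂ) • E := by
    conv_lhs => rw [hE, Finset.mul_sum]
    have h3 : ∀ y, E * (lam y : ℂ) • ρ (upper y) = E := fun y => by
      rw [mul_smul_comm, hE, h1, smul_smul, hsq, one_smul]
    rw [Finset.sum_congr rfl fun y _ => h3 y, Finset.sum_const, Finset.card_univ,
      Nat.cast_smul_eq_nsmul]
  rw [smul_mul_smul_comm, h2, smul_smul]
  congr 1
  have : (Fintype.card F : ℂ) ≠ 0 := by simp
  field_simp

theorem trace_average_unipotentCoeff_mul [FiniteDimensional ℂ V]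
    (g : SpecialLinearGroup (Fin 2) F) :
    LinearMap.trace ℂ V (average (unipotentCoeff lam) ρ * ρ g) =
      (Fintype.card F : ℂ)⁻¹ * ∑ x, (lam x : ℂ) * ρ.character (upper x * g) := by
  rw [average_unipotentCoeff, smul_mul_assoc, Finset.sum_mul, map_smul, map_sum, smul_eq_mul]
  congr 1
  refine Finset.sum_congr rfl fun x _ => ?_
  rw [smul_mul_assoc, map_smul, smul_eq_mul, ← map_mul]
  rfl

variable [CharP F 2] [FiniteDimensional ℂ V]

/-- Models exist, and contain an orbit with known Gram matrix. -/
theorem orthModel_orbit (hρ : ρ.IsIrreducible) {χ : SpecialLinearGroup (Fin 2) F → realCharField ρ}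
    (hχ : ∀ g, (χ g : ℂ) = ρ.character g) {c : realCharField ρ}
    (hc : ∀ x ≠ 0, χ (upper x) = c) (hdeg : χ 1 - c = Fintype.card F) :
    Nonempty (OrthModel ρ) ∧ ∃ lam : F → ℤ, lam 0 = 1 ∧ ∑ x, lam x = 0 ∧ ∀ M : OrthModel ρ,
      M.dim ≤ Module.finrank ℂ V ∧ ∃ (w : M.W) (a : realCharField ρ), a ≠ 0 ∧
        ∀ g, M.F w (M.σ g w) =
          a * ((Fintype.card F : realCharField ρ)⁻¹ *
            ∑ x, (lam x : realCharField ρ) * χ (upper x * g)) := by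
  obtain ⟨lam, h0, hadd, hsum⟩ := exists_lam (F := F)
  have htr : LinearMap.trace ℂ V (average (unipotentCoeff lam) ρ) = 1 := by
    have h1 := trace_average_unipotentCoeff_mul (lam := lam) (ρ := ρ) 1
    rw [map_one, mul_one] at h1
    rw [h1]
    simp only [mul_one]
    rw [sum_lam_mul h0 hsum _ (c : ℂ) fun x hx => by rw [← hχ, hc x hx], upper_zero, ← hχ]
    have h2 := congrArg Subtype.val hdeg
    push_cast at h2
    rw [h2]
    exact inv_mul_cancel₀ (by simp)
  obtain ⟨φ, v, hv, he⟩ := exists_smulRight_of_trace_eq_one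
    (average_unipotentCoeff_mul_self (ρ := ρ) h0 hadd) htr
  have hm : ∀ g, (((Fintype.card F : realCharField ρ)⁻¹ *
      ∑ x, (lam x : realCharField ρ) * χ (upper x * g) : realCharField ρ) : ℂ) =
      φ (ρ g v) := fun g => by
    have h1 := trace_average_unipotentCoeff_mul (lam := lam) (ρ := ρ) g
    have h2 : φ.smulRight v * ρ g = (φ ∘ₗ ρ g).smulRight v := rfl
    rw [he, h2, LinearMap.trace_smulRight, LinearMap.comp_apply] at h1
    rw [h1]
    push_cast
    simp only [hχ]
  have hv0 : v ≠ 0 := fun h => by simp [h] at hv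
  have hφ : φ ≠ 0 := fun h => by simp [h] at hv
  refine ⟨nonempty_orthModel hρ hv0 hφ (fun g => ?_) he, lam, h0, hsum, fun M => ?_⟩
  · rw [← hm g]; exact Subtype.property _
  · exact M.exists_orbit hρ hv hm unipotentCoeff_inv he

end Average

section Families

variable {F : Type*} [Field F] [Fintype F] [CharP F 2] {K W : Type*} [Field K] [CharZero K]
  [AddCommGroup W] [Module K W] [FiniteDimensional K W]
  {σ : Representation K (SpecialLinearGroup (Fin 2) F) W} {B : LinearMap.BilinForm K W}
  (hB : IsInvariantForm σ B) {lam : F → ℤ} (h0 : lam 0 = 1) (hsum : ∑ x, lam x = 0)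
  {χ : SpecialLinearGroup (Fin 2) F → K} {X : F → K} (hX : ∀ g ≠ 1, χ g = X (tr g))
  {w : W} {a : K} (ha : a ≠ 0)
  (hw : ∀ g, B w (σ g w) = a * ((Fintype.card F : K)⁻¹ * ∑ x, (lam x : K) * χ (upper x * g)))
  [DecidableEq F]

include hB h0 hsum hX ha hw

theorem exists_basis_torus {q : ℕ} (hF : Fintype.card F = q)
    (h1 : χ 1 = q - 1) (hX0 : X 0 = -1) (hdim : Module.finrank K W ≤ q - 1) :
    ∃ β : Module.Basis (Fˣ ⊕ Empty) K W, ∀ i j, B (β i) (β j) =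
      if i = j then Sum.elim (fun _ => a) (fun k => a * Empty.elim k) i else 0 := by
  have hχ : χ 1 - X 0 = Fintype.card F := by rw [h1, hX0, hF]; ring
  have hu : ∀ i j : Fˣ ⊕ Empty, B (Sum.elim (fun s => σ (matA s) w) Empty.elim i)
      (Sum.elim (fun s => σ (matA s) w) Empty.elim j) =
      if i = j then Sum.elim (fun _ => a) (fun k => a * Empty.elim k) i else 0 := by
    rintro (s | ⟨⟨⟩⟩) (r | ⟨⟨⟩⟩)
    simp [form_torus hB h0 hsum hX hw hχ]
  obtain ⟨β, hβ⟩ := exists_basis_of_orthogonal (by rintro (s | ⟨⟨⟩⟩); simpa) hu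
    (by rw [Fintype.card_sum, Fintype.card_units, hF]; simpa)
  exact ⟨β, fun i j => by rw [hβ, hβ, hu]⟩

theorem exists_basis_steinberg {q : ℕ} (hF : Fintype.card F = q)
    (h1 : χ 1 = q) (hX0 : X 0 = 0) (hT : ∑ t, X t = -1) (hdim : Module.finrank K W ≤ q) :
    ∃ β : Module.Basis (Fˣ ⊕ Unit) K W, ∀ i j, B (β i) (β j) =
      if i = j then Sum.elim (fun _ => a) (fun _ => a * (q + 1)) i else 0 := by
  have hq : 1 ≤ q := by rw [← hF]; exact Fintype.card_pos
  have hχ : χ 1 - X 0 = Fintype.card F := by rw [h1, hX0, hF]; ring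
  have hz := form_bigCell hB h0 hsum hX hw
  have hvz := form_torus_bigCell hB hsum hw
  rw [h1, hX0, hT] at hz
  have hu : ∀ i j : Fˣ ⊕ Unit, B (Sum.elim (fun s => σ (matA s) w) (fun _ => bigCell σ w) i)
      (Sum.elim (fun s => σ (matA s) w) (fun _ => bigCell σ w) j) =
      if i = j then Sum.elim (fun _ => a) (fun _ => a * (q + 1)) i else 0 := by
    rintro (s | s) (r | r)
    · simp [form_torus hB h0 hsum hX hw hχ]
    · simp [hvz]
    · simp [hvz, hB.1 (bigCell σ w)]
    · simp [hz]
  obtain ⟨β, hβ⟩ := exists_basis_of_orthogonal (by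
      rintro (s | s)
      · simpa
      · simpa [ha] using Nat.cast_add_one_ne_zero q) hu
    (by rw [Fintype.card_sum, Fintype.card_units, hF]; simp; omega)
  exact ⟨β, fun i j => by rw [hβ, hβ, hu]⟩

theorem exists_basis_principal {q : ℕ} (hF : Fintype.card F = q)
    (h1 : χ 1 = q + 1) (hX0 : X 0 = 1) (hT : ∑ t, X t = 0) {ν : Fˣ} (hν : ν ≠ 1)
    {θ : K} (hθ : X (ν + (ν : F)⁻¹) = θ) (hδ : 4 - θ ^ 2 ≠ 0) {r s : K} (hr : r ≠ 0) (hs : s ≠ 0)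
    (hdim : Module.finrank K W ≤ q + 1) :
    ∃ β : Module.Basis (Fˣ ⊕ Fin 2) K W, ∀ i j, B (β i) (β j) = if i = j then
      Sum.elim (fun _ => a)
        (fun k => a * ![2 * q * r ^ 2, q * (4 - θ ^ 2) / 2 * s ^ 2] k) i else 0 := by
  have hq : 1 ≤ q := by rw [← hF]; exact Fintype.card_pos
  have hq0 : (q : K) ≠ 0 := by exact_mod_cast (by omega : q ≠ 0)
  have h2 : (2 : K) ≠ 0 := two_ne_zero
  have hχ : χ 1 - X 0 = Fintype.card F := by rw [h1, hX0, hF]; ring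
  have hzz := form_bigCell hB h0 hsum hX hw
  have hvz := form_torus_bigCell hB hsum hw
  have hztz := form_bigCell_torus_of_ne hB h0 hsum hX hw ν hν
  rw [h1, hX0, hT, hF] at hzz
  rw [hθ, hT, hF] at hztz
  set z := bigCell σ w with hz
  have htzz : B (σ (matA ν) z) z = B z (σ (matA ν) z) := hB.1 _ _
  have htztz : B (σ (matA ν) z) (σ (matA ν) z) = B z z := hB.2 _ _ _
  have hvtz : ∀ s, B (σ (matA s) w) (σ (matA ν) z) = 0 := fun s => by
    have h := hB.2 (matA ν) (σ (matA (ν⁻¹ * s)) w) z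
    rwa [hvz, ← Module.End.mul_apply, ← map_mul, matA_mul, mul_inv_cancel_left] at h
  set z' := σ (matA ν) z - (θ / 2) • z with hz'
  have hvz' : ∀ s, B (σ (matA s) w) z' = 0 := fun s => by
    rw [hz', map_sub, map_smul, hvtz, hvz, smul_zero, sub_zero]
  have hzz' : B z z' = 0 := by
    rw [hz', map_sub, map_smul, hztz, hzz, smul_eq_mul]; field_simp; ring
  have hz'z' : B z' z' = a * (q * (4 - θ ^ 2) / 2) := by
    have : B z' z' = B (σ (matA ν) z) z' := by
      have h := LinearMap.BilinForm.sub_left (B₁ := B) (σ (matA ν) z) ((θ / 2) • z) z'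
      rw [← hz'] at h
      rw [h, LinearMap.BilinForm.smul_left, hzz', mul_zero, sub_zero]
    rw [this, hz', map_sub, map_smul, htztz, htzz, hztz, hzz, smul_eq_mul]; field_simp; ring
  let u : Fˣ ⊕ Fin 2 → W := Sum.elim (fun s => σ (matA s) w) ![r • z, s • z']
  have hu : ∀ i j : Fˣ ⊕ Fin 2, B (u i) (u j) = if i = j then Sum.elim (fun _ => a)
        (fun k => a * ![2 * q * r ^ 2, q * (4 - θ ^ 2) / 2 * s ^ 2] k) i else 0 := by
    rintro (x | x) (y | y)
    · simp [u, form_torus hB h0 hsum hX hw hχ]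
    · fin_cases y <;> simp [u, hvz, hvz']
    · fin_cases x <;> simp [u, hvz, hvz', hB.1 z, hB.1 z']
    · fin_cases x <;> fin_cases y <;> simp [u, hzz, hzz', hz'z', hB.1 z' z] <;> ring
  obtain ⟨β, hβ⟩ := exists_basis_of_orthogonal (by
      rintro (x | x)
      · simpa
      · fin_cases x <;> simp [ha, hq0, hr, hs, hδ]) hu
    (by rw [Fintype.card_sum, Fintype.card_units, hF]; simp; omega)
  exact ⟨β, fun i j => by rw [hβ, hβ, hu]⟩

end Families

end OrthChar
end

noncomputable section
namespace OrthChar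

section CliffordPart

variable {G V : Type*} [Group G] [AddCommGroup V] [Module ℂ V] {ρ : Representation ℂ G V}
  {α κ : Type*} [Fintype α] [DecidableEq α] [Fintype κ] [DecidableEq κ]

theorem OrthModel.c_isMatrixOver_of_basis (M : OrthModel ρ)
    (β : Module.Basis (α ⊕ κ) (realCharField ρ) M.W) {a : realCharField ρ} (ha : a ≠ 0)
    {b : κ → realCharField ρ}
    (hβ : ∀ i j, M.F (β i) (β j) =
      if i = j then Sum.elim (fun _ => a) (fun k => a * b k) i else 0)
    (o : α) (hodd : Odd (Fintype.card α + Fintype.card κ)) :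
    M.CliffordDefined ∧ IsMatrixOver (realCharField ρ) M.c
      (DiagClifford (Sum.elim (fun _ : {x : α // x ≠ o} => (-1 : realCharField ρ))
        fun k => -b k)) := by
  have hdim : M.dim = Fintype.card α + Fintype.card κ := by
    rw [OrthModel.dim, Module.finrank_eq_card_basis β, Fintype.card_sum]
  rw [← hdim] at hodd
  refine ⟨.inl hodd, ?_⟩
  have hc : M.c = CliffordAlgebra.even (halfQuadraticForm M.F) := by
    rw [OrthModel.c, cliffordPart, if_neg]
    exact Nat.not_even_iff_odd.mpr hodd
  exact (IsMatrixOver.of_equiv (Subalgebra.equivOfEq _ _ hc)).trans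
    (even_isMatrixOver β ha hβ o)

end CliffordPart

section Weights

variable {K : Type*} [Field K] [NeZero (2 : K)] {α : Type*} [Fintype α] [DecidableEq α]

theorem isMatrixOver_neg_one_of_card {m : ℕ} (hα : Fintype.card α = 8 * m + 6) (b : Empty → K) :
    IsMatrixOver K (DiagClifford (Sum.elim (fun _ : α => (-1 : K)) fun k => -b k)) K :=
  (DiagClifford.isMatrixOver_of_neg_one m hα b).trans (isMatrixOver_of_isEmpty b)

theorem isMatrixOver_neg_one_of_card_two (hα : Fintype.card α = 2) (b : Empty → K) :
    IsMatrixOver K (DiagClifford (Sum.elim (fun _ : α => (-1 : K)) fun k => -b k))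
      (QuaternionAlgebra K (-1) 0 (-1)) := by
  let e : α ⊕ Empty ≃ Fin 2 := (Equiv.sumEmpty α Empty).trans (Fintype.equivFinOfCardEq hα)
  refine .of_equiv ((DiagClifford.reindex (w' := fun _ => (-1 : K)) e ?_).trans
    (DiagClifford.quaternionEquiv _))
  rintro (i | ⟨⟨⟩⟩)
  rfl

theorem isMatrixOver_principal {m : ℕ} (hα : Fintype.card α = 8 * m + 6) (b : Fin 2 → K) :
    IsMatrixOver K (DiagClifford (Sum.elim (fun _ : α => (-1 : K)) fun k => -b k))
      (QuaternionAlgebra K (b 0) 0 (b 1)) :=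
  (DiagClifford.isMatrixOver_of_neg_one m hα b).trans (.of_equiv (DiagClifford.quaternionEquiv b))

theorem isMatrixOver_principal_four (hα : Fintype.card α = 2) (h3 : (3 : K) ≠ 0) {b : Fin 2 → K}
    (hb0 : b 0 = 2) (hb1 : b 1 = 6) :
    IsMatrixOver K (DiagClifford (Sum.elim (fun _ : α => (-1 : K)) fun k => -b k))
      (QuaternionAlgebra K (-1) 0 (-6)) := by
  let e : α ⊕ Fin 2 ≃ Fin 4 :=
    (Equiv.sumCongr (Fintype.equivFinOfCardEq hα) (Equiv.refl _)).trans finSumFinEquiv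
  refine (IsMatrixOver.of_equiv (DiagClifford.reindex (w' := ![(-1 : K), -1, -2, -6]) e ?_)).trans
    (isMatrixOver_rank_four h3)
  rintro (i | i)
  · obtain ⟨j, rfl⟩ := (Fintype.equivFinOfCardEq hα).symm.surjective i
    fin_cases j <;> simp [e, finSumFinEquiv] <;> rfl
  · fin_cases i <;> simp [e, finSumFinEquiv, hb0, hb1] <;> rfl

theorem quaternion_one_isMatrixOver {b : K} (hb : b ≠ 0) :
    IsMatrixOver K (QuaternionAlgebra K 1 0 b) K := by
  have h2 : (2 : K) ≠ 0 := NeZero.ne 2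
  exact quaternion_isMatrixOver_of_norm (x := (b + 1) / 2) (y := (b - 1) / 2) one_ne_zero hb
    (by field_simp; ring)

end Weights

end OrthChar
end

noncomputable section
namespace OrthChar

section Hensel

variable {L : Type*} [NormedField L] [IsUltrametricDist L] [CompleteSpace L]

theorem isSquare_one_add {t : L} (h2 : ‖(2 : L)‖ = 1) (ht : ‖t‖ < 1) : IsSquare (1 + t) := by
  have h20 : (2 : L) ≠ 0 := fun h => by simp [h] at h2
  let f : L → L := fun y => (t - y ^ 2) / 2
  have hf : Set.MapsTo f (Metric.closedBall 0 ‖t‖) (Metric.closedBall 0 ‖t‖) := fun y hy => by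
    rw [mem_closedBall_zero_iff] at hy ⊢
    rw [norm_div, h2, div_one]
    rw [sub_eq_add_neg]
    refine (IsUltrametricDist.norm_add_le_max _ _).trans (max_le le_rfl ?_)
    rw [norm_neg, norm_pow]
    nlinarith [norm_nonneg y]
  have hc : ContractingWith ‖t‖₊ (hf.restrict f _ _) := by
    refine ⟨ht, LipschitzWith.of_dist_le_mul fun y z => ?_⟩
    have hy := mem_closedBall_zero_iff.mp y.2
    have hz := mem_closedBall_zero_iff.mp z.2
    have h : f y - f z = -((y + z : L) * (y - z)) / 2 := by simp only [f]; ring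
    rw [Subtype.dist_eq, Subtype.dist_eq, dist_eq_norm, dist_eq_norm]
    change ‖f y - f z‖ ≤ _
    rw [h, norm_div, h2, div_one, norm_neg, norm_mul]
    refine mul_le_mul_of_nonneg_right ?_ (norm_nonneg _)
    exact (IsUltrametricDist.norm_add_le_max _ _).trans (max_le hy hz)
  obtain ⟨y, -, hy, -⟩ := hc.exists_fixedPoint' (Metric.isClosed_closedBall.isComplete) hf
    (x := 0) (by simp) (edist_ne_top _ _)
  refine ⟨1 + y, ?_⟩
  have : (t - y ^ 2) / 2 = y := hy
  field_simp at this
  linear_combination this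

theorem isSquare_of_norm_sub_lt {u x : L} (h2 : ‖(2 : L)‖ = 1) (hx : ‖x‖ = 1)
    (h : ‖u - x ^ 2‖ < 1) : IsSquare u := by
  have hx0 : x ≠ 0 := fun h => by simp [h] at hx
  obtain ⟨y, hy⟩ := isSquare_one_add (t := (u - x ^ 2) / x ^ 2) h2
    (by rw [norm_div, norm_pow, hx, one_pow, div_one]; exact h)
  refine ⟨x * y, ?_⟩
  have : u = x ^ 2 * (1 + (u - x ^ 2) / x ^ 2) := by field_simp; ring
  rw [this, hy]
  ring

end Hensel

section Completion

open NumberField IsDedekindDomain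

variable {K : Type*} [Field K] [NumberField K] {v : HeightOneSpectrum (𝓞 K)}

variable (v) in
/-- The map from the ring of integers to a completion. -/
abbrev toCompletion : 𝓞 K →+* v.adicCompletion K := algebraMap (𝓞 K) (v.adicCompletion K)

theorem valued_algebraMap (k : K) :
    Valued.v (algebraMap K (v.adicCompletion K) k) = v.valuation K k :=
  v.valuedAdicCompletion_eq_valuation' k

theorem valued_toCompletion (r : 𝓞 K) : Valued.v (toCompletion v r) = v.intValuation r := by
  rw [toCompletion, IsScalarTower.algebraMap_apply (𝓞 K) K, valued_algebraMap,
    v.valuation_of_algebraMap]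

theorem valued_toCompletion_lt_one {r : 𝓞 K} :
    Valued.v (toCompletion v r) < 1 ↔ r ∈ v.asIdeal := by
  rw [valued_toCompletion, v.intValuation_lt_one_iff_mem]

theorem valued_toCompletion_eq_one {r : 𝓞 K} :
    Valued.v (toCompletion v r) = 1 ↔ r ∉ v.asIdeal := by
  rw [← valued_toCompletion_lt_one, not_lt, valued_toCompletion]
  exact ⟨fun h => h.ge, fun h => le_antisymm (v.intValuation_le_one r) h⟩

theorem norm_lt_one_iff {x : v.adicCompletion K} : ‖x‖ < 1 ↔ Valued.v x < 1 :=
  Valued.toNormedField.norm_lt_one_iff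

theorem norm_eq_one_iff {x : v.adicCompletion K} : ‖x‖ = 1 ↔ Valued.v x = 1 := by
  have h1 : ‖x‖ ≤ 1 ↔ Valued.v x ≤ 1 := Valued.toNormedField.norm_le_one_iff
  have h2 : 1 ≤ ‖x‖ ↔ 1 ≤ Valued.v x := by rw [← not_lt, norm_lt_one_iff, not_lt]
  exact le_antisymm_iff.trans ((and_congr h1 h2).trans le_antisymm_iff.symm)

theorem isSquare_of_valued_sub_lt (h2 : (2 : 𝓞 K) ∉ v.asIdeal) {u x : v.adicCompletion K}
    (hx : Valued.v x = 1) (h : Valued.v (u - x ^ 2) < 1) : IsSquare u := by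
  refine isSquare_of_norm_sub_lt ?_ (norm_eq_one_iff.mpr hx)
    (norm_lt_one_iff.mpr h)
  rw [norm_eq_one_iff]
  rw [← map_ofNat (toCompletion v) 2]
  exact valued_toCompletion_eq_one.mpr h2

theorem isSquare_toCompletion (h2 : (2 : 𝓞 K) ∉ v.asIdeal) {a r : 𝓞 K} (ha : a ∉ v.asIdeal)
    (hr : a - r ^ 2 ∈ v.asIdeal) : IsSquare (toCompletion v a) := by
  refine isSquare_of_valued_sub_lt (x := toCompletion v r) h2
    (valued_toCompletion_eq_one.mpr fun h => ha ?_) ?_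
  · have := v.asIdeal.add_mem hr (v.asIdeal.mul_mem_left r h)
    rwa [← pow_two, sub_add_cancel] at this
  · rw [← map_pow, ← map_sub]; exact valued_toCompletion_lt_one.mpr hr

theorem exists_residue_norm (h2 : (2 : 𝓞 K) ∉ v.asIdeal) {a b : 𝓞 K} (ha : a ∉ v.asIdeal) :
    ∃ x y : 𝓞 K, x ^ 2 - a * y ^ 2 - b ∈ v.asIdeal := by
  let k := 𝓞 K ⧸ v.asIdeal
  have : v.asIdeal.IsMaximal := v.isMaximal
  letI : Field k := Ideal.Quotient.field _
  letI : Fintype k := Fintype.ofFinite k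
  have ha' : Ideal.Quotient.mk v.asIdeal a ≠ 0 := by rwa [Ne, Ideal.Quotient.eq_zero_iff_mem]
  have hodd : Fintype.card k % 2 = 1 := by
    refine FiniteField.odd_card_of_char_ne_two fun h => h2 ?_
    have h' : ((2 : ℕ) : k) = 0 := by rw [← h]; exact CharP.cast_eq_zero k _
    rw [← Ideal.Quotient.eq_zero_iff_mem]
    exact_mod_cast h'
  obtain ⟨x, y, hxy⟩ := FiniteField.exists_root_sum_quadratic (R := k)
    (f := Polynomial.X ^ 2)
    (g := Polynomial.C (-Ideal.Quotient.mk v.asIdeal a) * Polynomial.X ^ 2 +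
      Polynomial.C (-Ideal.Quotient.mk v.asIdeal b))
    (Polynomial.degree_X_pow 2) (by
      have := Polynomial.degree_quadratic (b := 0) (c := -Ideal.Quotient.mk v.asIdeal b)
        (neg_ne_zero.mpr ha')
      simpa using this) hodd
  obtain ⟨x, rfl⟩ := Ideal.Quotient.mk_surjective x
  obtain ⟨y, rfl⟩ := Ideal.Quotient.mk_surjective y
  refine ⟨x, y, Ideal.Quotient.eq_zero_iff_mem.mp ?_⟩
  simp only [Polynomial.eval_add, Polynomial.eval_mul, Polynomial.eval_pow, Polynomial.eval_X,
    Polynomial.eval_C] at hxy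
  simp only [map_sub, map_mul, map_pow]
  linear_combination hxy

theorem exists_local_norm (h2 : (2 : 𝓞 K) ∉ v.asIdeal) {a b : 𝓞 K} (ha : a ∉ v.asIdeal)
    (hb : b ∉ v.asIdeal) :
    ∃ x y, toCompletion v b = x ^ 2 - toCompletion v a * y ^ 2 := by
  obtain ⟨x, y, h⟩ := exists_residue_norm (b := b) h2 ha
  by_cases hx : x ∈ v.asIdeal
  · have hy : y ∉ v.asIdeal := fun hy => hb <| by
      have h1 : b = x * x - (a * y) * y - (x ^ 2 - a * y ^ 2 - b) := by ring
      rw [h1]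
      exact sub_mem (sub_mem (v.asIdeal.mul_mem_left _ hx) (v.asIdeal.mul_mem_left _ hy)) h
    have ha1 := valued_toCompletion_eq_one.mpr ha
    have ha0 : toCompletion v a ≠ 0 := fun h => by simp [h] at ha1
    obtain ⟨z, hz⟩ := isSquare_of_valued_sub_lt
      (u := (toCompletion v x ^ 2 - toCompletion v b) / toCompletion v a) (x := toCompletion v y) h2
      (valued_toCompletion_eq_one.mpr hy) (by
        have h1 : (toCompletion v x ^ 2 - toCompletion v b) / toCompletion v a -
            toCompletion v y ^ 2 = toCompletion v (x ^ 2 - a * y ^ 2 - b) / toCompletion v a := by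
          simp only [map_sub, map_mul, map_pow]; field_simp; ring
        rw [h1, map_div₀, ha1, div_one]
        exact valued_toCompletion_lt_one.mpr h)
    refine ⟨toCompletion v x, z, ?_⟩
    rw [div_eq_iff ha0] at hz
    linear_combination -hz
  · obtain ⟨z, hz⟩ := isSquare_of_valued_sub_lt
      (u := toCompletion v b + toCompletion v a * toCompletion v y ^ 2) (x := toCompletion v x) h2
      (valued_toCompletion_eq_one.mpr hx) (by
        have h1 : toCompletion v b + toCompletion v a * toCompletion v y ^ 2 -
            toCompletion v x ^ 2 = toCompletion v (-(x ^ 2 - a * y ^ 2 - b)) := by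
          simp only [map_sub, map_mul, map_pow, map_neg]; ring
        rw [h1]
        exact valued_toCompletion_lt_one.mpr (neg_mem h))
    exact ⟨z, toCompletion v y, by linear_combination hz⟩

theorem exists_toCompletion_sub_lt {t : v.adicCompletion K} (ht : Valued.v t ≤ 1) :
    ∃ r : 𝓞 K, Valued.v (toCompletion v r - t) < 1 := by
  have hopen : IsOpen {y : v.adicCompletion K | Valued.v (y - t) < 1} := by
    have h1 : {y : v.adicCompletion K | Valued.v (y - t) < 1} = {y | ‖y - t‖ < 1} := by
      ext y; exact norm_lt_one_iff.symm
    rw [h1]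
    exact isOpen_lt (by fun_prop) continuous_const
  obtain ⟨k, hk⟩ := (v.denseRange_algebraMap K).exists_mem_open hopen ⟨t, by simp⟩
  have hk1 : v.valuation K k ≤ 1 := by
    rw [← valued_algebraMap]
    have := Valued.v.map_add (algebraMap K (v.adicCompletion K) k - t) t
    rw [sub_add_cancel] at this
    exact this.trans (max_le (le_of_lt hk) ht)
  obtain ⟨r, hr⟩ := v.exists_valuation_sub_lt_of_integer hk1 1
  refine ⟨r, ?_⟩
  have h1 : toCompletion v r - t = algebraMap K (v.adicCompletion K) (algebraMap (𝓞 K) K r - k) +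
      (algebraMap K (v.adicCompletion K) k - t) := by
    rw [map_sub, toCompletion, IsScalarTower.algebraMap_apply (𝓞 K) K]; ring
  rw [h1]
  refine Valued.v.map_add_lt ?_ hk
  rw [valued_algebraMap]
  exact hr

theorem valued_sub_mul_sq {a : 𝓞 K} (ha : a ∉ v.asIdeal)
    (hns : ∀ r : 𝓞 K, a - r ^ 2 ∉ v.asIdeal) (x y : v.adicCompletion K) :
    ∃ w : v.adicCompletion K,
      Valued.v (x ^ 2 - toCompletion v a * y ^ 2) = Valued.v w ^ 2 := by
  have ha1 := valued_toCompletion_eq_one.mpr ha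
  have hx2 : Valued.v (x ^ 2) = Valued.v x ^ 2 := map_pow _ _ _
  have hy2 : Valued.v (toCompletion v a * y ^ 2) = Valued.v y ^ 2 := by
    rw [map_mul, ha1, one_mul, map_pow]
  rcases lt_trichotomy (Valued.v x) (Valued.v y) with h | h | h
  · refine ⟨y, ?_⟩
    rw [← hy2]
    apply Valuation.map_sub_eq_of_lt_right
    rw [hx2, hy2]
    exact pow_lt_pow_left₀ h zero_le' two_ne_zero
  · by_cases hy : y = 0
    · rw [hy, map_zero, map_eq_zero] at h
      exact ⟨0, by simp [h, hy]⟩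
    refine ⟨y, ?_⟩
    have hy0 : Valued.v y ≠ 0 := by rwa [Ne, map_eq_zero]
    have ht : Valued.v (x / y) = 1 := by rw [map_div₀, h, div_self hy0]
    obtain ⟨r, hr⟩ := exists_toCompletion_sub_lt ht.le
    have h1 : Valued.v (toCompletion v r) ≤ 1 := by
      rw [valued_toCompletion]; exact v.intValuation_le_one r
    have h3 : Valued.v ((x / y) ^ 2 - toCompletion v a) = 1 := by
      have h4 : Valued.v (toCompletion v (-(a - r ^ 2))) = 1 :=
        valued_toCompletion_eq_one.mpr fun h => hns r (by simpa using neg_mem h)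
      have h5 : (x / y) ^ 2 - toCompletion v a = toCompletion v (-(a - r ^ 2)) -
          (toCompletion v r - x / y) * (toCompletion v r + x / y) := by
        simp only [map_neg, map_sub, map_pow]; ring
      rw [h5, Valuation.map_sub_eq_of_lt_left, h4]
      rw [h4, map_mul]
      refine mul_lt_one_of_nonneg_of_lt_one_left zero_le' hr ?_
      exact (Valued.v.map_add _ _).trans (max_le h1 ht.le)
    have h6 : x ^ 2 - toCompletion v a * y ^ 2 = ((x / y) ^ 2 - toCompletion v a) * y ^ 2 := by
      field_simp
    rw [h6, map_mul, h3, one_mul, map_pow]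
  · refine ⟨x, ?_⟩
    rw [← hx2]
    apply Valuation.map_sub_eq_of_lt_left
    rw [hx2, hy2]
    exact pow_lt_pow_left₀ h zero_le' two_ne_zero

open WithZero in
theorem eq_zero_of_mul_eq_norm {a b : 𝓞 K} (ha : a ∉ v.asIdeal)
    (hns : ∀ r : 𝓞 K, a - r ^ 2 ∉ v.asIdeal) (hb : v.intValuation b = exp (-1 : ℤ))
    {x y z : v.adicCompletion K}
    (h : z ^ 2 * toCompletion v b = x ^ 2 - toCompletion v a * y ^ 2) : z = 0 := by
  by_contra hz
  obtain ⟨w, hw⟩ := valued_sub_mul_sq ha hns x y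
  rw [← h, map_mul, map_pow, valued_toCompletion, hb] at hw
  have hz0 : Valued.v z ≠ 0 := by rwa [Ne, map_eq_zero]
  have hw0 : Valued.v w ≠ 0 := fun h0 => by simp [h0, hz0] at hw
  rw [← exp_log hz0, ← exp_log hw0, ← exp_nsmul, ← exp_nsmul, ← exp_add, exp_inj] at hw
  simp only [nsmul_eq_mul] at hw
  push_cast at hw
  omega

theorem not_isSquare_toCompletion {a : 𝓞 K} (ha : a ∉ v.asIdeal)
    (hns : ∀ r : 𝓞 K, a - r ^ 2 ∉ v.asIdeal) : ¬ IsSquare (toCompletion v a) := by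
  rintro ⟨t, ht⟩
  have ha1 := valued_toCompletion_eq_one.mpr ha
  have ht1 : Valued.v t = 1 := by
    rw [ht, map_mul] at ha1
    rw [← pow_two] at ha1
    exact (pow_left_inj₀ zero_le' zero_le' two_ne_zero).mp (ha1.trans (one_pow 2).symm)
  obtain ⟨r, hr⟩ := exists_toCompletion_sub_lt ht1.le
  refine hns r (valued_toCompletion_lt_one.mp ?_)
  have h5 : toCompletion v (a - r ^ 2) = -(toCompletion v r - t) * (toCompletion v r - t + (t + t))
      := by
    rw [map_sub, map_pow, ht]; ring
  rw [h5, map_mul, Valuation.map_neg]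
  refine mul_lt_one_of_nonneg_of_lt_one_left zero_le' hr ?_
  exact (Valued.v.map_add _ _).trans (max_le hr.le ((Valued.v.map_add _ _).trans (by simp [ht1])))

end Completion

end OrthChar
end

noncomputable section
namespace OrthChar

section Cyclotomic

open NumberField IsDedekindDomain WithZero

variable {K L : Type*} [Field K] [NumberField K] [Field L] [NumberField L] [Algebra K L]
  {v : HeightOneSpectrum (𝓞 K)} {p d : ℕ} {ζ : L} {θ : 𝓞 K}

theorem mem_iff_eq_prime_pow (hp : p.Prime) (hpv : (p : 𝓞 K) ∈ v.asIdeal)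
    (hζ : IsPrimitiveRoot ζ d) (hd : Odd d) (hθ : algebraMap K L θ = ζ + ζ⁻¹) :
    4 - θ ^ 2 ∈ v.asIdeal ↔ ∃ k, d = p ^ k := by
  have hd0 : d ≠ 0 := by rintro rfl; simp at hd
  have : v.asIdeal.IsMaximal := v.isMaximal
  obtain ⟨P, hP, hPv⟩ := Ideal.exists_maximal_ideal_liesOver_of_isIntegral (S := 𝓞 L) v.asIdeal
  let k := 𝓞 L ⧸ P
  letI : Field k := Ideal.Quotient.field P
  let f : 𝓞 L →+* k := Ideal.Quotient.mk P
  have hf : ∀ x : 𝓞 K, f (algebraMap (𝓞 K) (𝓞 L) x) = 0 ↔ x ∈ v.asIdeal := fun x => by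
    rw [Ideal.Quotient.eq_zero_iff_mem, Ideal.mem_of_liesOver P v.asIdeal]
  have hpk : (p : k) = 0 := by
    have := (hf p).mpr hpv
    simpa using this
  have : Fact p.Prime := ⟨hp⟩
  have : CharP k p := (CharP.charP_iff_prime_eq_zero hp).mpr hpk
  have hint : IsIntegral ℤ ζ := hζ.isIntegral (by omega)
  let z : 𝓞 L := ⟨ζ, hint⟩
  have hz : IsPrimitiveRoot z d := by
    refine IsPrimitiveRoot.of_map_of_injective (f := algebraMap (𝓞 L) L) ?_
      RingOfIntegers.coe_injective
    exact hζ
  have hzθ : z ^ 2 * algebraMap (𝓞 K) (𝓞 L) (4 - θ ^ 2) = -(z ^ 2 - 1) ^ 2 := by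
    have hζ0 : ζ ≠ 0 := hζ.ne_zero hd0
    apply RingOfIntegers.coe_injective
    have h1 : algebraMap (𝓞 L) L (algebraMap (𝓞 K) (𝓞 L) (4 - θ ^ 2)) = 4 - (ζ + ζ⁻¹) ^ 2 := by
      rw [← hθ, ← IsScalarTower.algebraMap_apply, IsScalarTower.algebraMap_apply (𝓞 K) K L]
      simp
      exact map_ofNat ((algebraMap K L).comp (algebraMap (𝓞 K) K)) 4
    rw [map_mul, h1]
    change ζ ^ 2 * _ = -(ζ ^ 2 - 1) ^ 2
    field_simp
    ring
  have hfz : f z ≠ 0 := fun h => by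
    have := congrArg f hz.pow_eq_one
    rw [map_pow, h, map_one, zero_pow hd0] at this
    exact zero_ne_one this
  have hkey : 4 - θ ^ 2 ∈ v.asIdeal ↔ f z ^ 2 = 1 := by
    have h1 := congrArg f hzθ
    simp only [map_mul, map_pow, map_neg, map_sub, map_one] at h1
    rw [← hf, ← sub_eq_zero (b := (1 : k))]
    constructor
    · intro h
      simp only [map_sub, map_pow] at h
      rw [h, mul_zero] at h1
      exact pow_eq_zero_iff two_ne_zero |>.mp (neg_eq_zero.mp h1.symm)
    · intro h
      rw [h, zero_pow two_ne_zero, neg_zero] at h1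
      simp only [map_sub, map_pow]
      exact (mul_eq_zero.mp h1).resolve_left (pow_ne_zero 2 hfz)
  rw [hkey]
  constructor
  · intro h2
    have h1 : f z = 1 := by
      obtain ⟨m, hm⟩ := hd
      have := congrArg f hz.pow_eq_one
      rwa [map_pow, hm, pow_succ, pow_mul, h2, one_pow, one_mul, map_one] at this
    refine ⟨_, Nat.eq_prime_pow_of_unique_prime_dvd hd0 fun {r} hr hrd => ?_⟩
    have hη : IsPrimitiveRoot (z ^ (d / r)) r :=
      hz.pow (by omega) (Nat.div_mul_cancel hrd).symm
    have h3 := congrArg f (hη.geom_sum_eq_zero hr.one_lt)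
    simp only [map_sum, map_pow, h1, one_pow, map_zero, Finset.sum_const, Finset.card_range,
      nsmul_eq_mul, mul_one] at h3
    exact ((Nat.prime_dvd_prime_iff_eq hp hr).mp ((CharP.cast_eq_zero_iff k p r).mp h3)).symm
  · rintro ⟨e, rfl⟩
    have h1 : (f z - 1) ^ p ^ e = 0 := by
      rw [sub_pow_char_pow, one_pow, ← map_pow, hz.pow_eq_one, map_one, sub_self]
    have h2 : f z = 1 := sub_eq_zero.mp (pow_eq_zero_iff (pow_ne_zero _ hp.ne_zero) |>.mp h1)
    rw [h2, one_pow]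

theorem uniformizer_of_prime_pow {e : ℕ} (hp : p.Prime) (hp2 : p ≠ 2)
    (hζ : IsPrimitiveRoot ζ (p ^ (e + 1))) (hθ : algebraMap K L θ = ζ + ζ⁻¹)
    [IsCyclotomicExtension {p ^ (e + 1)} ℚ L] (hKL : Module.finrank K L = 2)
    (hmem : 4 - θ ^ 2 ∈ v.asIdeal) :
    v.intValuation (4 - θ ^ 2) = exp (-1 : ℤ) ∧ ∀ r : 𝓞 K, ∃ m : ℤ, r - m ∈ v.asIdeal := by
  have : Fact p.Prime := ⟨hp⟩
  have hodd : Nat.Coprime 2 (p ^ (e + 1)) :=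
    ((Nat.coprime_primes Nat.prime_two hp).mpr hp2.symm).pow_right _
  have hζ0 : ζ ≠ 0 := hζ.ne_zero (pow_ne_zero _ hp.ne_zero)
  have hirr := Polynomial.cyclotomic.irreducible_rat (n := p ^ (e + 1)) (pow_pos hp.pos _)
  have hδ : algebraMap K L (algebraMap (𝓞 K) K (4 - θ ^ 2)) = (ζ ^ 2 - 1) * (ζ⁻¹ ^ 2 - 1) := by
    have : algebraMap K L (algebraMap (𝓞 K) K (4 - θ ^ 2)) = 4 - (ζ + ζ⁻¹) ^ 2 := by
      rw [← hθ]; simp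
      exact map_ofNat ((algebraMap K L).comp (algebraMap (𝓞 K) K)) 4
    rw [this]; field_simp; ring
  have hN : Algebra.norm ℚ (algebraMap (𝓞 K) K (4 - θ ^ 2)) ^ 2 = (p : ℚ) ^ 2 := by
    have h1 := Algebra.norm_norm (R := ℚ) (S := K)
      (a := algebraMap K L (algebraMap (𝓞 K) K (4 - θ ^ 2)))
    rw [Algebra.norm_algebraMap, hKL, map_pow, hδ, map_mul,
      (hζ.pow_of_coprime 2 hodd).norm_sub_one_of_prime_ne_two hirr hp2,
      (hζ.inv.pow_of_coprime 2 hodd).norm_sub_one_of_prime_ne_two hirr hp2] at h1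
    rw [h1]; ring
  have habs : Ideal.absNorm (Ideal.span {4 - θ ^ 2}) = p := by
    rw [Ideal.absNorm_span_singleton]
    have h1 : (Algebra.norm ℤ (4 - θ ^ 2)) ^ 2 = (p : ℤ) ^ 2 := by
      have := Algebra.coe_norm_int (4 - θ ^ 2)
      rw [← this] at hN
      exact_mod_cast hN
    have := Int.natAbs_eq_iff_sq_eq.mpr h1
    simpa using this
  have hprime : (Ideal.span {4 - θ ^ 2}).IsPrime :=
    Ideal.isPrime_of_irreducible_absNorm (by rw [habs]; exact hp)
  have hne : 4 - θ ^ 2 ≠ 0 := fun h => by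
    rw [h] at habs
    simp at habs
    exact hp.ne_zero habs.symm
  have hv : v.asIdeal = Ideal.span {4 - θ ^ 2} := by
    have : (Ideal.span {4 - θ ^ 2}).IsMaximal :=
      hprime.isMaximal (by rwa [Ne, Ideal.span_singleton_eq_bot])
    exact (this.eq_of_le v.isPrime.ne_top
      ((Ideal.span_singleton_le_iff_mem _).mpr hmem)).symm
  refine ⟨v.intValuation_singleton hne hv, fun r => ?_⟩
  have hcard : Nat.card (𝓞 K ⧸ v.asIdeal) = p := by
    rw [← Submodule.cardQuot_apply, ← Ideal.absNorm_apply, hv, habs]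
  have hpv : ((p : ℕ) : 𝓞 K ⧸ v.asIdeal) = 0 := by
    have : Finite (𝓞 K ⧸ v.asIdeal) := Nat.finite_of_card_ne_zero (by rw [hcard]; exact hp.ne_zero)
    letI := Fintype.ofFinite (𝓞 K ⧸ v.asIdeal)
    rw [← hcard, Nat.card_eq_fintype_card]
    exact Nat.cast_card_eq_zero _
  have hnt : Nontrivial (𝓞 K ⧸ v.asIdeal) := Ideal.Quotient.nontrivial_iff.mpr v.isPrime.ne_top
  have : CharP (𝓞 K ⧸ v.asIdeal) p := by
    have := v.isMaximal
    letI : Field (𝓞 K ⧸ v.asIdeal) := Ideal.Quotient.field _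
    exact (CharP.charP_iff_prime_eq_zero hp).mpr hpv
  have hbij : Function.Bijective (ZMod.castHom (dvd_refl p) (𝓞 K ⧸ v.asIdeal)) := by
    have : Finite (𝓞 K ⧸ v.asIdeal) := Nat.finite_of_card_ne_zero (by rw [hcard]; exact hp.ne_zero)
    letI := Fintype.ofFinite (𝓞 K ⧸ v.asIdeal)
    rw [Fintype.bijective_iff_injective_and_card]
    refine ⟨RingHom.injective _, ?_⟩
    rw [ZMod.card, ← hcard, Nat.card_eq_fintype_card]
  obtain ⟨t, ht⟩ := hbij.2 (Ideal.Quotient.mk _ r)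
  obtain ⟨m, rfl⟩ := ZMod.intCast_surjective t
  refine ⟨m, Ideal.Quotient.eq_zero_iff_mem.mp ?_⟩
  rw [map_sub, ← ht]
  simp

end Cyclotomic

end OrthChar
end

noncomputable section
namespace OrthChar

section LocalClass

open NumberField IsDedekindDomain WithZero

variable {K : Type*} [Field K] [NumberField K] {v : HeightOneSpectrum (𝓞 K)} {A : Type*} [Ring A]
  [Algebra K A]

theorem algebraMap_ringOfIntegers (a : 𝓞 K) :
    algebraMap K (v.adicCompletion K) a = toCompletion v a :=
  (IsScalarTower.algebraMap_apply (𝓞 K) K (v.adicCompletion K) a).symm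

theorem isMatrixOver_completion {a b : 𝓞 K} (ha : a ≠ 0) (hb : b ≠ 0)
    (hA : IsMatrixOver K A (QuaternionAlgebra K (a : K) 0 (b : K))) :
    IsMatrixOver (v.adicCompletion K) (v.adicCompletion K ⊗[K] A)
      (QuaternionAlgebra (v.adicCompletion K) (toCompletion v a) 0 (toCompletion v b)) := by
  have ha' : (a : K) ≠ 0 := RingOfIntegers.coe_ne_zero_iff.mpr ha
  have hb' : (b : K) ≠ 0 := RingOfIntegers.coe_ne_zero_iff.mpr hb
  obtain ⟨e⟩ := quaternion_baseChange (v.adicCompletion K) ha' hb'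
  rw [algebraMap_ringOfIntegers, algebraMap_ringOfIntegers] at e
  exact (hA.baseChange (v.adicCompletion K)).trans (.of_equiv e)

theorem toCompletion_ne_zero {a : 𝓞 K} (ha : a ≠ 0) : toCompletion v a ≠ 0 := by
  rw [← algebraMap_ringOfIntegers, Ne, map_eq_zero]
  exact RingOfIntegers.coe_ne_zero_iff.mpr ha

theorem neZero_two_completion : NeZero (2 : v.adicCompletion K) := by
  refine ⟨?_⟩
  rw [← map_ofNat (algebraMap K (v.adicCompletion K)) 2, Ne, map_eq_zero]
  exact two_ne_zero

theorem sameBrauerClass_completion_of_norm {a b : 𝓞 K} (ha : a ≠ 0) (hb : b ≠ 0)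
    (hA : IsMatrixOver K A (QuaternionAlgebra K (a : K) 0 (b : K)))
    (h : ∃ x y, toCompletion v b = x ^ 2 - toCompletion v a * y ^ 2) :
    IsMatrixOver (v.adicCompletion K) (v.adicCompletion K ⊗[K] A) (v.adicCompletion K) := by
  have := neZero_two_completion (v := v)
  obtain ⟨x, y, h⟩ := h
  exact (isMatrixOver_completion ha hb hA).trans
    (quaternion_isMatrixOver_of_norm (toCompletion_ne_zero ha) (toCompletion_ne_zero hb) h)

theorem exists_norm_of_isSquare {L : Type*} [Field L] [NeZero (2 : L)] {a b : L} (ha : a ≠ 0)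
    (h : IsSquare a) : ∃ x y, b = x ^ 2 - a * y ^ 2 := by
  have h2 : (2 : L) ≠ 0 := NeZero.ne 2
  obtain ⟨s, rfl⟩ := h
  have hs : s ≠ 0 := left_ne_zero_of_mul ha
  exact ⟨(b + 1) / 2, (b - 1) / (2 * s), by field_simp; ring⟩

theorem not_sameBrauerClass_completion.{u} {K A : Type u} [Field K] [NumberField K]
    {v : HeightOneSpectrum (𝓞 K)} [Ring A] [Algebra K A] {a b : 𝓞 K} (hb : b ≠ 0)
    (hA : IsMatrixOver K A (QuaternionAlgebra K (a : K) 0 (b : K))) (hav : a ∉ v.asIdeal)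
    (hns : ∀ r : 𝓞 K, a - r ^ 2 ∉ v.asIdeal) (hbv : v.intValuation b = exp (-1 : ℤ)) :
    ¬ SameBrauerClass (v.adicCompletion K) (v.adicCompletion K ⊗[K] A) (v.adicCompletion K) := by
  have ha : a ≠ 0 := fun h => hav (by rw [h]; exact zero_mem _)
  have := quaternion_noZeroDivisors (a := toCompletion v a) (b := toCompletion v b)
    (fun x y z h => eq_zero_of_mul_eq_norm hav hns hbv h) (not_isSquare_toCompletion hav hns)
  refine not_sameBrauerClass_of_noZeroDivisors (d := ⟨0, 1, 0, 0⟩) ?_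
    (isMatrixOver_completion ha hb hA) AlgEquiv.refl
  rintro ⟨x, hx⟩
  have := congrArg QuaternionAlgebra.imI hx
  simp at this

end LocalClass

section Criterion

open NumberField IsDedekindDomain WithZero

variable {K L A : Type} [Field K] [NumberField K] [Field L] [NumberField L] [Algebra K L]
  [Ring A] [Algebra K A] {v : HeightOneSpectrum (𝓞 K)} {p d : ℕ} {ζ : L} {θ : 𝓞 K}

theorem intCast_mem_iff (hpv : v.asIdeal.comap (algebraMap ℤ (𝓞 K)) = Ideal.span {(p : ℤ)})
    (m : ℤ) : (m : 𝓞 K) ∈ v.asIdeal ↔ (p : ℤ) ∣ m := by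
  rw [← Ideal.mem_span_singleton, ← hpv, Ideal.mem_comap]
  simp

theorem sub_sq_notMem (hpv : v.asIdeal.comap (algebraMap ℤ (𝓞 K)) = Ideal.span {(p : ℤ)})
    (hres : ∀ r : 𝓞 K, ∃ m : ℤ, r - m ∈ v.asIdeal) {a : ℤ} (ha : ¬ IsSquare (a : ZMod p))
    (r : 𝓞 K) : (a : 𝓞 K) - r ^ 2 ∉ v.asIdeal := fun h => by
  obtain ⟨m, hm⟩ := hres r
  have h1 : ((a - m ^ 2 : ℤ) : 𝓞 K) ∈ v.asIdeal := by
    have : ((a - m ^ 2 : ℤ) : 𝓞 K) = (a - r ^ 2) + (r + m) * (r - m) := by push_cast; ring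
    rw [this]
    exact add_mem h (v.asIdeal.mul_mem_left _ hm)
  rw [intCast_mem_iff hpv, ← ZMod.intCast_zmod_eq_zero_iff_dvd] at h1
  push_cast at h1
  exact ha ⟨m, by linear_combination h1⟩

theorem exists_sub_sq_mem (hpv : v.asIdeal.comap (algebraMap ℤ (𝓞 K)) = Ideal.span {(p : ℤ)})
    {a : ℤ} (ha : IsSquare (a : ZMod p)) : ∃ r : 𝓞 K, (a : 𝓞 K) - r ^ 2 ∈ v.asIdeal := by
  obtain ⟨t, ht⟩ := ha
  obtain ⟨m, rfl⟩ := ZMod.intCast_surjective t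
  refine ⟨m, ?_⟩
  have h1 : ((a - m * m : ℤ) : ZMod p) = 0 := by push_cast; rw [ht, sub_self]
  rw [ZMod.intCast_zmod_eq_zero_iff_dvd, ← intCast_mem_iff hpv] at h1
  convert h1 using 1
  push_cast
  ring

theorem two_notMem (hp : p.Prime) (hp2 : p ≠ 2)
    (hpv : v.asIdeal.comap (algebraMap ℤ (𝓞 K)) = Ideal.span {(p : ℤ)}) :
    (2 : 𝓞 K) ∉ v.asIdeal := fun h => by
  have h1 : (p : ℤ) ∣ 2 := (intCast_mem_iff hpv 2).mp (by exact_mod_cast h)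
  exact hp2 ((Nat.prime_dvd_prime_iff_eq hp Nat.prime_two).mp (by exact_mod_cast h1))

theorem mod_eight_iff_not_isSquare_two (hp : p.Prime) (hp2 : p ≠ 2) :
    (p % 8 = 3 ∨ p % 8 = 5) ↔ ¬ IsSquare (2 : ZMod p) := by
  have : Fact p.Prime := ⟨hp⟩
  rw [ZMod.exists_sq_eq_two_iff hp2]
  have := hp.eq_two_or_odd
  omega

/-- The local behaviour of the quaternion algebra `(2, 2δ)`. -/
theorem not_sameBrauerClass_completion_iff (hp : p.Prime) (hp2 : p ≠ 2)
    (hpv : v.asIdeal.comap (algebraMap ℤ (𝓞 K)) = Ideal.span {(p : ℤ)})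
    (hζ : IsPrimitiveRoot ζ d) (hd : Odd d) (hd1 : 1 < d) (hθ : algebraMap K L θ = ζ + ζ⁻¹)
    [IsCyclotomicExtension {d} ℚ L] (hKL : Module.finrank K L = 2)
    (hA : IsMatrixOver K A
      (QuaternionAlgebra K ((2 : 𝓞 K) : K) 0 ((2 * (4 - θ ^ 2) : 𝓞 K) : K))) :
    ¬ SameBrauerClass (v.adicCompletion K) (v.adicCompletion K ⊗[K] A) (v.adicCompletion K) ↔
      (p % 8 = 3 ∨ p % 8 = 5) ∧ ∃ k, d = p ^ k := by
  have h2v := two_notMem hp hp2 hpv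
  have h20 : (2 : 𝓞 K) ≠ 0 := two_ne_zero
  have hpv' : (p : 𝓞 K) ∈ v.asIdeal := by
    exact_mod_cast (intCast_mem_iff hpv p).mpr (dvd_refl _)
  have hδ : 4 - θ ^ 2 ≠ 0 := fun h => by
    have h1 : algebraMap K L (algebraMap (𝓞 K) K (4 - θ ^ 2)) = 4 - (ζ + ζ⁻¹) ^ 2 := by
      rw [← hθ]; simp
      exact map_ofNat ((algebraMap K L).comp (algebraMap (𝓞 K) K)) 4
    have hζ0 : ζ ≠ 0 := hζ.ne_zero (by omega)
    rw [h, map_zero, map_zero] at h1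
    have h2 : (ζ ^ 2 - 1) ^ 2 = 0 := by
      field_simp at h1; linear_combination h1
    have h3 : ζ ^ 2 = 1 := sub_eq_zero.mp (pow_eq_zero_iff two_ne_zero |>.mp h2)
    have h4 := Nat.le_of_dvd two_pos (hζ.dvd_of_pow_eq_one 2 h3)
    obtain ⟨k, hk⟩ := hd
    omega
  have hb0 : 2 * (4 - θ ^ 2) ≠ 0 := mul_ne_zero h20 hδ
  have hmem := mem_iff_eq_prime_pow hp hpv' hζ hd hθ
  have htriv : (∃ x y, toCompletion v (2 * (4 - θ ^ 2)) = x ^ 2 - toCompletion v 2 * y ^ 2) →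
      SameBrauerClass (v.adicCompletion K) (v.adicCompletion K ⊗[K] A) (v.adicCompletion K) :=
    fun h => sameBrauerClass_of_isMatrixOver
      (sameBrauerClass_completion_of_norm h20 hb0 hA h) (.of_equiv AlgEquiv.refl)
  rw [mod_eight_iff_not_isSquare_two hp hp2, ← hmem]
  constructor
  · refine fun h => ⟨fun hsq => h (htriv ?_), by_contra fun hδv => h (htriv ?_)⟩
    · obtain ⟨r, hr⟩ := exists_sub_sq_mem hpv (a := 2) (by exact_mod_cast hsq)
      have := neZero_two_completion (v := v)
      exact exists_norm_of_isSquare (toCompletion_ne_zero h20)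
        (isSquare_toCompletion h2v h2v (by exact_mod_cast hr))
    · exact exists_local_norm h2v h2v fun h => (v.isPrime.mem_or_mem h).elim h2v hδv
  · rintro ⟨hsq, hδv⟩
    obtain ⟨k, rfl⟩ := hmem.mp hδv
    obtain ⟨e, rfl⟩ : ∃ e, k = e + 1 := Nat.exists_eq_succ_of_ne_zero (by rintro rfl; simp at hd1)
    obtain ⟨hval, hres⟩ := uniformizer_of_prime_pow hp hp2 hζ hθ hKL hδv
    refine not_sameBrauerClass_completion hb0 hA h2v (fun r => ?_) ?_
    · have := sub_sq_notMem hpv hres (a := 2) (by exact_mod_cast hsq) r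
      exact_mod_cast this
    · rw [map_mul, hval, HeightOneSpectrum.intValuation_eq_one_iff.mpr h2v, one_mul]

/-- The local behaviour of the quaternion algebra `(-1, -6)`. -/
theorem not_sameBrauerClass_completion_iff_three (hp : p.Prime) (hp2 : p ≠ 2)
    (hpv : v.asIdeal.comap (algebraMap ℤ (𝓞 K)) = Ideal.span {(p : ℤ)})
    (hζ : IsPrimitiveRoot ζ 3) (hθ : algebraMap K L θ = ζ + ζ⁻¹)
    [IsCyclotomicExtension {3} ℚ L] (hKL : Module.finrank K L = 2)
    (hA : IsMatrixOver K A (QuaternionAlgebra K ((-1 : 𝓞 K) : K) 0 ((-6 : 𝓞 K) : K))) :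
    ¬ SameBrauerClass (v.adicCompletion K) (v.adicCompletion K ⊗[K] A) (v.adicCompletion K) ↔
      (p % 8 = 3 ∨ p % 8 = 5) ∧ ∃ k, 3 = p ^ k := by
  have h2v := two_notMem hp hp2 hpv
  have h10 : (-1 : 𝓞 K) ≠ 0 := by simp
  have h60 : (-6 : 𝓞 K) ≠ 0 := by simp
  have h1v : (-1 : 𝓞 K) ∉ v.asIdeal := fun h =>
    v.isPrime.ne_top ((Ideal.eq_top_iff_one _).mpr (by simpa using neg_mem h))
  have hpv' : (p : 𝓞 K) ∈ v.asIdeal := by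
    exact_mod_cast (intCast_mem_iff hpv p).mpr (dvd_refl _)
  have h3iff : (∃ k, 3 = p ^ k) ↔ p = 3 := by
    constructor
    · rintro ⟨k, hk⟩
      exact (Nat.prime_dvd_prime_iff_eq hp Nat.prime_three).mp
        (hk ▸ dvd_pow_self p (by rintro rfl; simp at hk))
    · rintro rfl; exact ⟨1, rfl⟩
  have hδ : 4 - θ ^ 2 = 3 := by
    have hζ0 : ζ ≠ 0 := hζ.ne_zero (by norm_num)
    apply RingOfIntegers.coe_injective (K := K)
    apply (algebraMap K L).injective
    have h1 : algebraMap K L (algebraMap (𝓞 K) K (4 - θ ^ 2)) = 4 - (ζ + ζ⁻¹) ^ 2 := by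
      rw [← hθ]; simp
      exact map_ofNat ((algebraMap K L).comp (algebraMap (𝓞 K) K)) 4
    have h2 : ζ ^ 2 + ζ + 1 = 0 := by
      have := hζ.geom_sum_eq_zero (by norm_num)
      simp [Finset.sum_range_succ] at this
      linear_combination this
    rw [h1]
    have h3 : algebraMap K L (algebraMap (𝓞 K) K 3) = 3 :=
      map_ofNat ((algebraMap K L).comp (algebraMap (𝓞 K) K)) 3
    rw [h3]
    field_simp
    linear_combination (-ζ ^ 2 + ζ - 1) * h2
  have hmem := mem_iff_eq_prime_pow hp hpv' hζ (by decide) hθ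
  rw [hδ, h3iff] at hmem
  have htriv : (∃ x y, toCompletion v (-6) = x ^ 2 - toCompletion v (-1) * y ^ 2) →
      SameBrauerClass (v.adicCompletion K) (v.adicCompletion K ⊗[K] A) (v.adicCompletion K) :=
    fun h => sameBrauerClass_of_isMatrixOver
      (sameBrauerClass_completion_of_norm h10 h60 hA h) (.of_equiv AlgEquiv.refl)
  have h6 : (-6 : 𝓞 K) = -1 * (2 * 3) := by norm_num
  rw [h3iff]
  constructor
  · intro h
    have hp3 : p = 3 := by
      by_contra hne
      refine h (htriv (exists_local_norm h2v h1v fun h => ?_))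
      rw [h6] at h
      rcases v.isPrime.mem_or_mem h with h | h
      · exact h1v h
      · exact (v.isPrime.mem_or_mem h).elim h2v fun h => hne (hmem.mp h)
    exact ⟨.inl (by rw [hp3]), hp3⟩
  · rintro ⟨-, rfl⟩
    have h3v := hmem.mpr rfl
    have : IsCyclotomicExtension {3 ^ (0 + 1)} ℚ L := by simpa
    obtain ⟨hval, hres⟩ := uniformizer_of_prime_pow (e := 0) (θ := θ) (v := v) hp hp2
      (by simpa using hζ) hθ hKL (by rw [hδ]; exact h3v)
    refine not_sameBrauerClass_completion h60 hA h1v (fun r => ?_) ?_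
    · have := sub_sq_notMem hpv hres (a := -1) (by
        push_cast; decide) r
      exact_mod_cast this
    · rw [hδ] at hval
      rw [h6, map_mul, map_mul, hval, HeightOneSpectrum.intValuation_eq_one_iff.mpr h2v,
        HeightOneSpectrum.intValuation_eq_one_iff.mpr h1v, one_mul, one_mul]

end Criterion

end OrthChar
end

noncomputable section
namespace OrthChar

section Vartheta

variable {L : Type*} [Field L]

theorem pow_add_inv_pow_succ_succ {z : L} (hz : z ≠ 0) (l : ℕ) : z ^ (l + 2) + (z ^ (l + 2))⁻¹ =
    (z + z⁻¹) * (z ^ (l + 1) + (z ^ (l + 1))⁻¹) - (z ^ l + (z ^ l)⁻¹) := by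
  field_simp
  ring

theorem pow_add_inv_pow_mem {k : Type*} [Field k] [Algebra k L] (E : IntermediateField k L) {z : L}
    (hz : z ≠ 0) (h : z + z⁻¹ ∈ E) (l : ℕ) : z ^ l + (z ^ l)⁻¹ ∈ E := by
  induction l using Nat.twoStepInduction with
  | zero => simpa using add_mem (one_mem E) (one_mem E)
  | one => simpa
  | more l h1 h2 =>
    rw [pow_add_inv_pow_succ_succ hz]
    exact sub_mem (mul_mem h h2) h1

theorem sum_pow_add_inv_pow {z : L} {m : ℕ} (hz : z ^ (2 * m + 1) = 1) (hz1 : z ≠ 1) :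
    ∑ l ∈ Finset.Icc 1 m, (z ^ l + (z ^ l)⁻¹) = -1 := by
  have hz0 : z ≠ 0 := fun h => by simp [h] at hz
  have key : ∀ m : ℕ, (z - 1) * (1 + ∑ l ∈ Finset.Icc 1 m, (z ^ l + (z ^ l)⁻¹)) =
      z ^ (m + 1) - (z ^ m)⁻¹ := fun m => by
    induction m with
    | zero => simp
    | succ m ih =>
      rw [Finset.sum_Icc_succ_top (by omega), ← add_assoc, mul_add, ih]
      field_simp
      ring
  have h := key m
  have h1 : z ^ (m + 1) = (z ^ m)⁻¹ := by
    refine eq_inv_of_mul_eq_one_left ?_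
    rw [← pow_add, ← hz]
    congr 1
    ring
  rw [h1, sub_self, mul_eq_zero] at h
  linear_combination h.resolve_left (sub_ne_zero.mpr hz1)

theorem isPrimitiveRoot_zeta {r : ℕ} (hr : r ≠ 0) : IsPrimitiveRoot (zeta r) r :=
  Complex.isPrimitiveRoot_exp r hr

theorem zeta_ne_zero (r : ℕ) : zeta r ≠ 0 := Complex.exp_ne_zero _

theorem vartheta_mul (r i l : ℕ) :
    vartheta r (i * l) = (zeta r ^ i) ^ l + ((zeta r ^ i) ^ l)⁻¹ := by
  rw [vartheta, pow_mul]

theorem vartheta_mul_mem (r i l : ℕ) :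
    vartheta r (i * l) ∈ IntermediateField.adjoin ℚ {vartheta r i} := by
  have h : vartheta r i ∈ IntermediateField.adjoin ℚ {vartheta r i} :=
    IntermediateField.mem_adjoin_simple_self ℚ _
  rw [vartheta_mul]
  exact pow_add_inv_pow_mem _ (pow_ne_zero i (zeta_ne_zero r)) h l

theorem isPrimitiveRoot_zeta_pow {r i : ℕ} (hr : r ≠ 0) (hi : i ≠ 0) :
    IsPrimitiveRoot (zeta r ^ i) (r / Nat.gcd r i) := by
  have h := IsPrimitiveRoot.orderOf (zeta r ^ i)
  rwa [orderOf_pow' _ hi, ← (isPrimitiveRoot_zeta hr).eq_orderOf] at h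

theorem sum_vartheta {m i : ℕ} (hi : ¬ (2 * m + 1) ∣ i) :
    ∑ l ∈ Finset.Icc 1 m, vartheta (2 * m + 1) (i * l) = -1 := by
  have h := isPrimitiveRoot_zeta (r := 2 * m + 1) (by omega)
  simp only [vartheta_mul]
  refine sum_pow_add_inv_pow ?_ fun h1 => hi ((h.pow_eq_one_iff_dvd i).mp h1)
  rw [← pow_mul, mul_comm i, pow_mul, h.pow_eq_one, one_pow]

/-- The field of real numbers inside the complex numbers. -/
abbrev realSubfield : IntermediateField ℚ ℂ :=
  (⊥ : IntermediateField ℝ ℂ).restrictScalars ℚ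

theorem mem_realSubfield {z : ℂ} : z ∈ realSubfield ↔ ∃ x : ℝ, (x : ℂ) = z :=
  IntermediateField.mem_bot

theorem add_inv_mem_realSubfield {z : ℂ} (hz : ‖z‖ = 1) : z + z⁻¹ ∈ realSubfield := by
  rw [Complex.inv_eq_conj hz, Complex.add_conj]
  exact mem_realSubfield.mpr ⟨_, rfl⟩

theorem vartheta_mem_realSubfield {r : ℕ} (hr : r ≠ 0) (s : ℕ) :
    vartheta r s ∈ realSubfield :=
  add_inv_mem_realSubfield
    (by rw [norm_pow, (isPrimitiveRoot_zeta hr).norm'_eq_one hr, one_pow])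

theorem vartheta_five_one : vartheta 5 1 = (((Real.sqrt 5 - 1) / 2 : ℝ) : ℂ) := by
  have hz : ‖zeta 5 ^ 1‖ = 1 := by
    rw [norm_pow, (isPrimitiveRoot_zeta (by norm_num)).norm'_eq_one (by norm_num), one_pow]
  have h5 : Real.sqrt 5 ^ 2 = 5 := Real.sq_sqrt (by norm_num)
  have hcos : Real.cos (2 * (Real.pi / 5)) = (Real.sqrt 5 - 1) / 4 := by
    rw [Real.cos_two_mul, Real.cos_pi_div_five]
    linear_combination h5 / 8
  have hre : (zeta 5).re = Real.cos (2 * (Real.pi / 5)) := by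
    rw [zeta, show (2 * Real.pi * Complex.I / (5 : ℕ) : ℂ) =
      ((2 * (Real.pi / 5) : ℝ) : ℂ) * Complex.I by push_cast; ring,
      Complex.exp_ofReal_mul_I_re]
  rw [vartheta, Complex.inv_eq_conj hz, Complex.add_conj, pow_one, hre, hcos]
  congr 1
  ring

end Vartheta

section Cyclotomic

/-- The quadratic extension of the real field generated by `ζ + ζ⁻¹` is cyclotomic. -/
theorem exists_cyclotomic_quadratic {d : ℕ} (hd : Odd d) (hd1 : 1 < d) {ζ : ℂ}
    (hζ : IsPrimitiveRoot ζ d) (E : IntermediateField ℚ ℂ)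
    (hE : E = IntermediateField.adjoin ℚ {ζ + ζ⁻¹}) :
    ∃ (L : Type) (_ : Field L) (_ : NumberField L) (_ : Algebra E L) (z : L) (θ : 𝓞 E),
      IsPrimitiveRoot z d ∧ IsCyclotomicExtension {d} ℚ L ∧ Module.finrank E L = 2 ∧
      algebraMap E L θ = z + z⁻¹ ∧ ((θ : E) : ℂ) = ζ + ζ⁻¹ := by
  have hd0 : d ≠ 0 := by omega
  have : NeZero d := ⟨hd0⟩
  let L := IntermediateField.adjoin ℚ {ζ}
  have hcyc : IsCyclotomicExtension {d} ℚ L := by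
    have hint : IsIntegral ℚ ζ := (hζ.isIntegral (by omega)).tower_top
    change IsCyclotomicExtension {d} ℚ (IntermediateField.adjoin ℚ {ζ}).toSubalgebra
    rw [IntermediateField.adjoin_simple_toSubalgebra_of_isAlgebraic hint.isAlgebraic]
    exact hζ.adjoin_isCyclotomicExtension ℚ
  have hNF : NumberField L := IsCyclotomicExtension.numberField {d} ℚ L
  have hζL : ζ ∈ L := IntermediateField.subset_adjoin ℚ _ rfl
  have hEL : E ≤ L := by
    rw [hE, IntermediateField.adjoin_le_iff, Set.singleton_subset_iff]
    exact add_mem hζL (inv_mem hζL)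
  have hER : E ≤ realSubfield := by
    rw [hE, IntermediateField.adjoin_le_iff, Set.singleton_subset_iff]
    exact add_inv_mem_realSubfield (hζ.norm'_eq_one hd0)
  let : Algebra E L := (IntermediateField.inclusion hEL).toRingHom.toAlgebra
  have : IsScalarTower ℚ E L := .of_algebraMap_eq fun x => Subtype.ext rfl
  let z : L := ⟨ζ, hζL⟩
  have hz : IsPrimitiveRoot z d :=
    IsPrimitiveRoot.of_map_of_injective (f := L.val) hζ L.val.injective
  have hθE : ζ + ζ⁻¹ ∈ E := by rw [hE]; exact IntermediateField.subset_adjoin ℚ _ rfl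
  have hθint : IsIntegral ℤ (⟨ζ + ζ⁻¹, hθE⟩ : E) := by
    have h1 : IsIntegral ℤ (ζ + ζ⁻¹) :=
      (hζ.isIntegral (by omega)).add (hζ.inv.isIntegral (by omega))
    exact (isIntegral_algHom_iff (E.val.restrictScalars ℤ) E.val.injective).mp h1
  let θ : 𝓞 E := ⟨⟨ζ + ζ⁻¹, hθE⟩, hθint⟩
  have hθ : algebraMap E L θ = z + z⁻¹ := Subtype.ext rfl
  refine ⟨L, inferInstance, hNF, inferInstance, z, θ, hz, hcyc, ?_, hθ, rfl⟩
  have htop : IntermediateField.adjoin E {z} = ⊤ := by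
    refine eq_top_iff.mpr fun x _ => ?_
    have h1 : x ∈ Algebra.adjoin ℚ {z} := by
      rw [IsCyclotomicExtension.adjoin_primitive_root_eq_top hz]; trivial
    have h2 : Algebra.adjoin ℚ {z} ≤
        (IntermediateField.adjoin E {z}).toSubalgebra.restrictScalars ℚ :=
      Algebra.adjoin_le (Set.singleton_subset_iff.mpr (IntermediateField.subset_adjoin E _ rfl))
    exact h2 h1
  have hzint : IsIntegral E z := (hz.isIntegral (by omega)).tower_top
  rw [← IntermediateField.finrank_top', ← htop, IntermediateField.adjoin.finrank hzint]
  refine le_antisymm ?_ ?_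
  · let P : Polynomial E := Polynomial.X ^ 2 - Polynomial.C (θ : E) * Polynomial.X + 1
    have hP : P.natDegree = 2 := by simp only [P]; compute_degree!
    have hP0 : P ≠ 0 := fun h => by simp [h] at hP
    have hz0 : z ≠ 0 := hz.ne_zero hd0
    have hPz : Polynomial.aeval z P = 0 := by
      simp only [P, map_add, map_sub, map_mul, map_pow, Polynomial.aeval_X, Polynomial.aeval_C,
        map_one, hθ]
      field_simp
      ring
    rw [← hP]
    exact Polynomial.natDegree_le_of_dvd (minpoly.dvd E z hPz) hP0
  · by_contra! hlt
    have hpos := minpoly.natDegree_pos hzint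
    obtain ⟨y, hy⟩ := minpoly.natDegree_eq_one_iff.mp (show (minpoly E z).natDegree = 1 by omega)
    have hyz : (y : ℂ) = ζ := congrArg Subtype.val hy
    obtain ⟨x, hx⟩ := mem_realSubfield.mp (hER y.2)
    have h1 : ζ⁻¹ = ζ := by
      rw [Complex.inv_eq_conj (hζ.norm'_eq_one hd0), ← hyz, ← hx, Complex.conj_ofReal]
    have h2 : ζ ^ 2 = 1 := by
      rw [sq]
      nth_rewrite 1 [← h1]
      exact inv_mul_cancel₀ (hζ.ne_zero hd0)
    have h3 := Nat.le_of_dvd two_pos ((hζ.pow_eq_one_iff_dvd 2).mp h2)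
    obtain ⟨k, hk⟩ := hd
    omega

end Cyclotomic

section Fields

variable {G V : Type*} [Group G] [AddCommGroup V] [Module ℂ V] {ρ : Representation ℂ G V}

theorem charField_le {E : IntermediateField ℚ ℂ} (h : ∀ g, ρ.character g ∈ E) :
    charField ρ ≤ E := by
  rw [charField, IntermediateField.adjoin_le_iff]
  rintro _ ⟨g, rfl⟩
  exact h g

theorem character_mem_charField (g : G) : ρ.character g ∈ charField ρ :=
  IntermediateField.subset_adjoin ℚ _ ⟨g, rfl⟩

theorem realCharField_eq (h : ∀ g, ρ.character g ∈ realSubfield) :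
    realCharField ρ = charField ρ :=
  inf_eq_left.mpr (charField_le h)

theorem character_mem_realCharField (h : ∀ g, ρ.character g ∈ realSubfield) (g : G) :
    ρ.character g ∈ realCharField ρ := by
  rw [realCharField_eq h]
  exact character_mem_charField g

end Fields

end OrthChar
end

noncomputable section
namespace OrthChar

open Matrix

section RealCharacter

variable {G V : Type*} [Group G] [AddCommGroup V] [Module ℂ V] {ρ : Representation ℂ G V}

/-- A real-valued character, with values in the real character field. -/
def realCharacter (h : ∀ g, ρ.character g ∈ realSubfield) (g : G) : realCharField ρ :=
  ⟨ρ.character g, character_mem_realCharField h g⟩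

end RealCharacter

variable {F : Type*} [Field F] [Fintype F] [CharP F 2] {V : Type*} [AddCommGroup V] [Module ℂ V]
  {ρ : Representation ℂ (SpecialLinearGroup (Fin 2) F) V}
  (h : ∀ g, ρ.character g ∈ realSubfield)

theorem realCharacter_eq_companion {g : SpecialLinearGroup (Fin 2) F} (hg : g ≠ 1) :
    realCharacter h g = realCharacter h (companion (tr g)) :=
  Subtype.ext (apply_eq_companion (fun g k => ρ.char_conj g k) hg)

theorem realCharacter_upper {x : F} (hx : x ≠ 0) :
    realCharacter h (upper x) = realCharacter h (companion 0) := by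
  have h1 : upper x ≠ 1 := fun h1 => hx (by
    have := congrArg (fun g : SpecialLinearGroup (Fin 2) F => g 0 1) h1
    simpa using this)
  rw [realCharacter_eq_companion h h1, tr_upper, (CharTwo.two_eq_zero : (2 : F) = 0)]

theorem realCharacter_matA_companion {ν : Fˣ} (hν : ν ≠ 1) :
    realCharacter h (companion (ν + (ν : F)⁻¹)) = realCharacter h (matA ν) := by
  have h1 : matA ν ≠ 1 := fun h1 => hν (matA_injective (h1.trans matA_one.symm))
  rw [realCharacter_eq_companion h h1]
  simp [tr, matA]

section Table

variable {q : ℕ} {ν : Fˣ} {b : SpecialLinearGroup (Fin 2) F}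
  (hF : Fintype.card F = q) (hq : Even q) (hq4 : 4 ≤ q)
  (hν : ∀ x : Fˣ, x ∈ Subgroup.zpowers ν) (hb : orderOf b = q + 1)

include hF hq hq4 hν hb

theorem character_mem_of_classes (E : IntermediateField ℚ ℂ) (h1 : ρ.character 1 ∈ E)
    (hc : ρ.character matC ∈ E)
    (ha : ∀ l ∈ Finset.Icc 1 ((q - 2) / 2), ρ.character (matA ν ^ l) ∈ E)
    (hbm : ∀ m ∈ Finset.Icc 1 (q / 2), ρ.character (b ^ m) ∈ E) (g) : ρ.character g ∈ E := by
  rcases apply_cases hF hq hq4 hν hb (fun g k => ρ.char_conj g k) g with rfl | ⟨i, hi⟩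
  · exact h1
  · rw [hi]
    rcases i with u | l | m
    · exact hc
    · exact ha _ l.2
    · exact hbm _ m.2

theorem realCharacter_companion_zero :
    (realCharacter h (companion 0) : ℂ) = ρ.character matC :=
  apply_companion_zero hF hq hq4 hν hb fun g k => ρ.char_conj g k

theorem sum_realCharacter_companion : ((∑ t, realCharacter h (companion t) : realCharField ρ) : ℂ) =
    ρ.character matC + (∑ l ∈ Finset.Icc 1 ((q - 2) / 2), ρ.character (matA ν ^ l) +
      ∑ m ∈ Finset.Icc 1 (q / 2), ρ.character (b ^ m)) := by
  rw [← sum_companion hF hq hq4 hν hb fun g k => ρ.char_conj g k]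
  push_cast
  rfl

end Table

end OrthChar
end

noncomputable section
namespace OrthChar

open Matrix

section Families

variable {F : Type*} [Field F] [Fintype F] [CharP F 2]
  {V : Type*} [AddCommGroup V] [Module ℂ V] [FiniteDimensional ℂ V]
  {ρ : Representation ℂ (SpecialLinearGroup (Fin 2) F) V} (hρ : ρ.IsIrreducible)
  {q : ℕ} {ν : Fˣ} {b : SpecialLinearGroup (Fin 2) F}
  (hF : Fintype.card F = q) (hq : 4 ∣ q)
  (hν : ∀ x : Fˣ, x ∈ Subgroup.zpowers ν) (hb : orderOf b = q + 1)

omit [CharP F 2] in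
include hF hq in
theorem four_le_card : 4 ≤ q :=
  Nat.le_of_dvd (by rw [← hF]; exact Fintype.card_pos) hq

omit [Field F] [Fintype F] [CharP F 2] in
include hq in
theorem even_card : Even q := even_iff_two_dvd.mpr ((by decide : 2 ∣ 4).trans hq)

include hF hq hν hb

theorem charField_eq_bot_of_isPsi (hχ : IsPsi q ν b ρ.character) : charField ρ = ⊥ := by
  obtain ⟨h1, hc, ha, hbm⟩ := hχ
  refine eq_bot_iff.mpr (charField_le (character_mem_of_classes hF
    (even_card hq) (four_le_card hF hq) hν hb _ ?_ ?_ ?_ ?_))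
  · rw [h1]; exact natCast_mem _ q
  · rw [hc]; exact zero_mem _
  · intro l hl; rw [ha l hl]; exact one_mem _
  · intro m hm; rw [hbm m hm]; exact neg_mem (one_mem _)

include hρ

theorem discEq_of_isPsi (hχ : IsPsi q ν b ρ.character) :
    DiscEq ρ ((q : realCharField ρ) + 1) := by
  classical
  have hq4 := four_le_card hF hq
  have hq2 : Even q := even_card hq
  have h : ∀ g, ρ.character g ∈ realSubfield := fun g =>
    (charField_eq_bot_of_isPsi hF hq hν hb hχ ▸ bot_le : charField ρ ≤ realSubfield)
      (character_mem_charField g)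
  obtain ⟨h1, hc, ha, hbm⟩ := hχ
  let _ := Fintype.ofFinite (SpecialLinearGroup (Fin 2) F)
  have hd : Module.finrank ℂ V = q := by
    have := ρ.char_one
    rw [h1] at this
    exact_mod_cast this.symm
  have h1' : realCharacter h 1 = q := Subtype.ext h1
  have hX0 : realCharacter h (companion 0) = 0 :=
    Subtype.ext ((realCharacter_companion_zero h hF hq2 hq4 hν hb).trans hc)
  have hT : ∑ t, realCharacter h (companion t) = -1 := by
    refine Subtype.ext ((sum_realCharacter_companion h hF hq2 hq4 hν hb).trans ?_)
    rw [hc, Finset.sum_congr rfl ha, Finset.sum_congr rfl hbm]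
    obtain ⟨k, rfl⟩ := hq
    rw [show (4 * k - 2) / 2 = 2 * k - 1 by omega, show 4 * k / 2 = 2 * k by omega]
    have : ((2 * k - 1 : ℕ) : ℂ) = 2 * k - 1 := by
      rw [Nat.cast_sub (by omega)]; push_cast; ring
    simp [this]
    ring
  obtain ⟨hne, lam, h0, hsum, hM⟩ := orthModel_orbit hρ (χ := realCharacter h) (fun _ => rfl)
    (c := 0) (fun x hx => by rw [realCharacter_upper h hx, hX0]) (by rw [h1', hF, sub_zero])
  refine ⟨hne, fun M => ?_⟩
  obtain ⟨hdim, w, a, ha0, hw⟩ := hM M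
  obtain ⟨β, hβ⟩ := exists_basis_steinberg M.invariant h0 hsum
    (X := fun t => realCharacter h (companion t)) (fun g hg => realCharacter_eq_companion h hg)
    ha0 hw hF h1' hX0 hT (hdim.trans_eq hd)
  have hcard : Fintype.card (Fˣ ⊕ Unit) = q := by
    rw [Fintype.card_sum, Fintype.card_units, hF]; simp; omega
  refine ⟨?_, hasSignedDisc_of_basis β hβ (pow_ne_zero (q / 2) ha0) ?_⟩
  · rw [OrthModel.dim, Module.finrank_eq_card_basis β, hcard]; exact hq2
  · rw [hcard, Fintype.prod_sum_type]
    simp only [Sum.elim_inl, Sum.elim_inr, Finset.prod_const, Finset.card_univ,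
      Fintype.card_units, hF, Fintype.card_unit, pow_one]
    have he : Even (q * (q - 1) / 2) := by
      obtain ⟨k, rfl⟩ := hq
      rw [show 4 * k * (4 * k - 1) = 2 * (2 * (k * (4 * k - 1))) by ring,
        Nat.mul_div_cancel_left _ two_pos]
      exact even_two_mul _
    have hp : (a ^ (q / 2)) ^ 2 = a ^ (q - 1) * a := by
      rw [← pow_mul, ← pow_succ]
      congr 1
      obtain ⟨k, rfl⟩ := hq
      omega
    rw [he.neg_one_pow, hp]
    ring

omit hρ in
theorem character_mem_real_of_isTheta {j : ℕ} (hχ : IsTheta q ν b j ρ.character) (g) :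
    ρ.character g ∈ realSubfield := by
  obtain ⟨h1, hc, ha, hbm⟩ := hχ
  refine character_mem_of_classes hF
    (even_card hq) (four_le_card hF hq) hν hb _ ?_ ?_ ?_ ?_ g
  · rw [h1]; exact sub_mem (natCast_mem _ q) (one_mem _)
  · rw [hc]; exact neg_mem (one_mem _)
  · intro l hl; rw [ha l hl]; exact zero_mem _
  · intro m hm; rw [hbm m hm]; exact neg_mem (vartheta_mem_realSubfield (by omega) _)

theorem orthModel_of_isTheta {j : ℕ} (hχ : IsTheta q ν b j ρ.character) :
    Nonempty (OrthModel ρ) ∧ ∀ M : OrthModel ρ, M.CliffordDefined ∧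
      (∀ m, q = 8 * m + 8 → IsMatrixOver (realCharField ρ) M.c (realCharField ρ)) ∧
      (q = 4 → IsMatrixOver (realCharField ρ) M.c
        (QuaternionAlgebra (realCharField ρ) (-1) 0 (-1))) := by
  classical
  have hq4 := four_le_card hF hq
  have hq2 : Even q := even_card hq
  have h := character_mem_real_of_isTheta hF hq hν hb hχ
  obtain ⟨h1, hc, -, -⟩ := hχ
  let _ := Fintype.ofFinite (SpecialLinearGroup (Fin 2) F)
  have hd : Module.finrank ℂ V = q - 1 := by
    have := ρ.char_one
    rw [h1, ← Nat.cast_one, ← Nat.cast_sub (by omega)] at this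
    exact_mod_cast this.symm
  have h1' : realCharacter h 1 = q - 1 := Subtype.ext (h1.trans (by push_cast; rfl))
  have hX0 : realCharacter h (companion 0) = -1 :=
    Subtype.ext ((realCharacter_companion_zero h hF hq2 hq4 hν hb).trans (hc.trans (by simp)))
  obtain ⟨hne, lam, h0, hsum, hM⟩ := orthModel_orbit hρ (χ := realCharacter h) (fun _ => rfl)
    (c := -1) (fun x hx => by rw [realCharacter_upper h hx, hX0]) (by rw [h1', hF]; ring)
  refine ⟨hne, fun M => ?_⟩
  obtain ⟨hdim, w, a, ha0, hw⟩ := hM M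
  obtain ⟨β, hβ⟩ := exists_basis_torus M.invariant h0 hsum
    (X := fun t => realCharacter h (companion t)) (fun g hg => realCharacter_eq_companion h hg)
    ha0 hw hF h1' hX0 (hdim.trans_eq hd)
  have hcard : Fintype.card Fˣ = q - 1 := by rw [Fintype.card_units, hF]
  have hcard' : Fintype.card {x : Fˣ // x ≠ 1} = q - 2 := by
    rw [Fintype.card_subtype_compl, Fintype.card_subtype_eq, hcard]; omega
  obtain ⟨hC, hA⟩ := M.c_isMatrixOver_of_basis β ha0 hβ 1 (by
    rw [hcard, Fintype.card_eq_zero, add_zero]; exact Nat.Even.sub_odd (by omega) hq2 odd_one)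
  refine ⟨hC, fun m hm => hA.trans (isMatrixOver_neg_one_of_card (m := m) (by omega) _),
    fun h4 => hA.trans (isMatrixOver_neg_one_of_card_two (by omega) _)⟩

theorem cliffordEq_of_isTheta {j : ℕ} (hχ : IsTheta q ν b j ρ.character) (hq8 : 8 ∣ q) :
    CliffordEq ρ (realCharField ρ) := by
  obtain ⟨hne, hM⟩ := orthModel_of_isTheta hρ hF hq hν hb hχ
  refine ⟨hne, fun M => ⟨(hM M).1, ?_⟩⟩
  obtain ⟨m, hm⟩ := hq8
  have := four_le_card hF hq
  exact sameBrauerClass_of_isMatrixOver ((hM M).2.1 (m - 1) (by omega)) (.of_equiv .refl)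

theorem cliffordEq_of_isTheta_four {j : ℕ} (hχ : IsTheta q ν b j ρ.character) (hq4 : q = 4) :
    CliffordEq ρ (QuaternionAlgebra (realCharField ρ) (-1) 0 (-1)) := by
  obtain ⟨hne, hM⟩ := orthModel_of_isTheta hρ hF hq hν hb hχ
  refine ⟨hne, fun M => ⟨(hM M).1, ?_⟩⟩
  have h1 : (-1 : realCharField ρ) ≠ 0 := by simp
  have := quaternion_isCentral h1 h1
  have := quaternion_isSimple h1 h1
  exact sameBrauerClass_of_isMatrixOver ((hM M).2.2 hq4) (.of_equiv .refl)

omit hρ in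
theorem charField_eq_of_isTheta_four {j : ℕ} (hj : j ∈ Finset.Icc 1 (q / 2))
    (hχ : IsTheta q ν b j ρ.character) (hq4 : q = 4) :
    charField ρ = IntermediateField.adjoin ℚ {((Real.sqrt 5 : ℝ) : ℂ)} := by
  have hs : ((Real.sqrt 5 : ℝ) : ℂ) ∈ IntermediateField.adjoin ℚ {((Real.sqrt 5 : ℝ) : ℂ)} :=
    IntermediateField.mem_adjoin_simple_self ℚ _
  have hv1 : vartheta 5 1 ∈ IntermediateField.adjoin ℚ {((Real.sqrt 5 : ℝ) : ℂ)} := by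
    rw [vartheta_five_one]
    push_cast
    exact div_mem (sub_mem hs (one_mem _)) (ofNat_mem _ 2)
  obtain ⟨h1, hc, ha, hbm⟩ := hχ
  refine le_antisymm (charField_le (character_mem_of_classes hF
    (even_card hq) (four_le_card hF hq) hν hb _ ?_ ?_ ?_ ?_)) ?_
  · rw [h1]; exact sub_mem (natCast_mem _ q) (one_mem _)
  · rw [hc]; exact neg_mem (one_mem _)
  · intro l hl; rw [ha l hl]; exact zero_mem _
  · intro m hm
    rw [hbm m hm, hq4, ← one_mul (j * m)]
    refine neg_mem ?_
    have h2 := vartheta_mul_mem 5 1 (j * m)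
    have h3 : IntermediateField.adjoin ℚ {vartheta 5 1} ≤
        IntermediateField.adjoin ℚ {((Real.sqrt 5 : ℝ) : ℂ)} := by
      rw [IntermediateField.adjoin_le_iff, Set.singleton_subset_iff]
      exact hv1
    exact h3 h2
  · have h5 : ((Real.sqrt 5 : ℝ) : ℂ) ^ 2 = 5 := by
      rw [← Complex.ofReal_pow, Real.sq_sqrt (by norm_num)]; norm_num
    have hz := zeta_ne_zero 5
    have hv4 : vartheta 5 4 = vartheta 5 1 := by
      have hp := (isPrimitiveRoot_zeta (r := 5) (by norm_num)).pow_eq_one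
      have h4 : zeta 5 ^ 4 = (zeta 5)⁻¹ := eq_inv_of_mul_eq_one_left (by rw [← pow_succ, hp])
      rw [vartheta, vartheta, h4, inv_inv, pow_one, add_comm]
    have hjj : vartheta 5 (j * j) = vartheta 5 1 := by
      rw [hq4, Finset.mem_Icc] at hj
      obtain rfl | rfl : j = 1 ∨ j = 2 := by omega
      · rfl
      · exact hv4
    rw [IntermediateField.adjoin_le_iff, Set.singleton_subset_iff, SetLike.mem_coe]
    have hmem := character_mem_charField (ρ := ρ) (b ^ j)
    rw [hbm j hj, hq4, hjj, vartheta_five_one] at hmem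
    have e : ((Real.sqrt 5 : ℝ) : ℂ) = 1 - 2 * -(((Real.sqrt 5 - 1) / 2 : ℝ) : ℂ) := by
      push_cast; ring
    rw [e]
    exact sub_mem (one_mem _) (mul_mem (ofNat_mem _ 2) hmem)

end Families

end OrthChar
end

noncomputable section
namespace OrthChar

open Matrix

section Quaternion

variable {K A B : Type} [Field K] [NeZero (2 : K)] [Ring A] [Algebra K A] [Ring B] [Algebra K B]

theorem sameBrauerClass_of_isMatrixOver_quaternion {a b : K} (ha : a ≠ 0) (hb : b ≠ 0)
    (hA : IsMatrixOver K A (QuaternionAlgebra K a 0 b))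
    (hB : IsMatrixOver K B (QuaternionAlgebra K a 0 b)) : SameBrauerClass K A B := by
  have := quaternion_isCentral ha hb
  have := quaternion_isSimple ha hb
  exact sameBrauerClass_of_isMatrixOver hA hB

theorem sameBrauerClass_baseChange_of_split (L : Type) [Field L] [Algebra K L]
    (hA : IsMatrixOver K A K) : SameBrauerClass L (L ⊗[K] A) L :=
  sameBrauerClass_of_isMatrixOver
    ((hA.baseChange L).trans (.of_equiv (Algebra.TensorProduct.rid K L L))) (.of_equiv .refl)

end Quaternion

section Arithmetic

theorem not_mod_eight_of_dvd {n p : ℕ} (hn : Odd n) (hp : p.Prime) (hp2 : p ≠ 2)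
    (h : p ∣ 2 ^ n - 1) : ¬ (p % 8 = 3 ∨ p % 8 = 5) := by
  rw [mod_eight_iff_not_isSquare_two hp hp2, not_not]
  obtain ⟨m, rfl⟩ := hn
  have h1 : ((2 ^ (2 * m + 1) - 1 : ℕ) : ZMod p) = 0 := (ZMod.natCast_eq_zero_iff _ _).mpr h
  rw [Nat.cast_sub Nat.one_le_two_pow] at h1
  push_cast at h1
  exact ⟨2 ^ (m + 1), by linear_combination -2 * h1⟩

theorem four_sub_sq_ne_zero {d : ℕ} (hd : Odd d) (hd1 : 1 < d) {ζ : ℂ} (hζ : IsPrimitiveRoot ζ d) :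
    4 - (ζ + ζ⁻¹) ^ 2 ≠ 0 := fun h => by
  have hζ0 : ζ ≠ 0 := hζ.ne_zero (by omega)
  have h1 : (ζ ^ 2 - 1) ^ 2 = 0 := by
    field_simp at h
    linear_combination -h
  have h2 := Nat.le_of_dvd two_pos ((hζ.pow_eq_one_iff_dvd 2).mp
    (sub_eq_zero.mp (pow_eq_zero_iff two_ne_zero |>.mp h1)))
  obtain ⟨k, hk⟩ := hd
  omega

end Arithmetic

section Principal

variable {F : Type*} [Field F] [Fintype F] [CharP F 2]
  {V : Type*} [AddCommGroup V] [Module ℂ V] [FiniteDimensional ℂ V]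
  {ρ : Representation ℂ (SpecialLinearGroup (Fin 2) F) V} (hρ : ρ.IsIrreducible)
  {q : ℕ} {ν : Fˣ} {b : SpecialLinearGroup (Fin 2) F}
  (hF : Fintype.card F = q) (hq : 4 ∣ q)
  (hν : ∀ x : Fˣ, x ∈ Subgroup.zpowers ν) (hb : orderOf b = q + 1)
  {i : ℕ} (hi : i ∈ Finset.Icc 1 ((q - 2) / 2)) (hχ : IsChi q ν b i ρ.character)

include hi in
theorem odd_and_one_lt_div_gcd (hq : Even q) :
    Odd ((q - 1) / Nat.gcd (q - 1) i) ∧ 1 < (q - 1) / Nat.gcd (q - 1) i := by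
  rw [Finset.mem_Icc] at hi
  have hg : Nat.gcd (q - 1) i ∣ q - 1 := Nat.gcd_dvd_left _ _
  have hgi := Nat.gcd_le_right (q - 1) (show 0 < i by omega)
  have hg0 : 0 < Nat.gcd (q - 1) i := Nat.gcd_pos_of_pos_right _ (by omega)
  refine ⟨Odd.of_dvd_nat (Nat.Even.sub_odd (by omega) hq odd_one) (Nat.div_dvd_of_dvd hg), ?_⟩
  refine (Nat.lt_div_iff_mul_lt_of_dvd hg0.ne' hg).mpr ?_
  omega

include hF hq hν hb hχ

theorem character_mem_real_of_isChi (g) : ρ.character g ∈ realSubfield := by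
  have hq4 := four_le_card hF hq
  obtain ⟨h1, hc, ha, hbm⟩ := hχ
  refine character_mem_of_classes hF (even_card hq) hq4 hν hb _ ?_ ?_ ?_ ?_ g
  · rw [h1]; exact add_mem (natCast_mem _ q) (one_mem _)
  · rw [hc]; exact one_mem _
  · intro l hl; rw [ha l hl]; exact vartheta_mem_realSubfield (by omega) _
  · intro m hm; rw [hbm m hm]; exact zero_mem _

theorem character_matA_of_isChi : ρ.character (matA ν) = vartheta (q - 1) i := by
  have hq4 := four_le_card hF hq
  have := hχ.2.2.1 1 (Finset.mem_Icc.mpr (by omega))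
  rwa [pow_one, mul_one] at this

theorem charField_eq_of_isChi :
    charField ρ = IntermediateField.adjoin ℚ {vartheta (q - 1) i} := by
  have hq4 := four_le_card hF hq
  refine le_antisymm ?_ ?_
  · obtain ⟨h1, hc, ha, hbm⟩ := hχ
    refine charField_le (character_mem_of_classes hF (even_card hq) hq4 hν hb _ ?_ ?_ ?_ ?_)
    · rw [h1]; exact add_mem (natCast_mem _ q) (one_mem _)
    · rw [hc]; exact one_mem _
    · intro l hl; rw [ha l hl]; exact vartheta_mul_mem _ _ _
    · intro m hm; rw [hbm m hm]; exact zero_mem _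
  · rw [IntermediateField.adjoin_le_iff, Set.singleton_subset_iff, SetLike.mem_coe,
      ← character_matA_of_isChi hF hq hν hb hχ]
    exact character_mem_charField _

include hρ hi

theorem orthModel_of_isChi {θ : realCharField ρ} (hθ : (θ : ℂ) = vartheta (q - 1) i)
    {r s : realCharField ρ} (hr : r ≠ 0) (hs : s ≠ 0) :
    Nonempty (OrthModel ρ) ∧ ∀ M : OrthModel ρ, M.CliffordDefined ∧
      (∀ m, q = 8 * m + 8 → IsMatrixOver (realCharField ρ) M.c (QuaternionAlgebra (realCharField ρ)
        (2 * q * r ^ 2) 0 (q * (4 - θ ^ 2) / 2 * s ^ 2))) ∧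
      (q = 4 → 2 * q * r ^ 2 = 2 → q * (4 - θ ^ 2) / 2 * s ^ 2 = 6 →
        IsMatrixOver (realCharField ρ) M.c (QuaternionAlgebra (realCharField ρ) (-1) 0 (-6))) := by
  classical
  have hq4 := four_le_card hF hq
  have hq2 := even_card hq
  have h := character_mem_real_of_isChi hF hq hν hb hχ
  have hAν := character_matA_of_isChi hF hq hν hb hχ
  obtain ⟨hdodd, hd1⟩ := odd_and_one_lt_div_gcd hi hq2
  rw [Finset.mem_Icc] at hi
  have hζ := isPrimitiveRoot_zeta_pow (r := q - 1) (i := i) (by omega) (by omega)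
  have hδ : 4 - θ ^ 2 ≠ 0 := fun h0 => four_sub_sq_ne_zero hdodd hd1 hζ (by
    have := congrArg Subtype.val h0
    push_cast at this
    rwa [hθ] at this)
  obtain ⟨h1, hc, ha, hbm⟩ := hχ
  let _ := Fintype.ofFinite (SpecialLinearGroup (Fin 2) F)
  have hd : Module.finrank ℂ V = q + 1 := by
    have := ρ.char_one
    rw [h1] at this
    exact_mod_cast this.symm
  have h1' : realCharacter h 1 = q + 1 := Subtype.ext (h1.trans (by push_cast; rfl))
  have hX0 : realCharacter h (companion 0) = 1 :=
    Subtype.ext ((realCharacter_companion_zero h hF hq2 hq4 hν hb).trans hc)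
  have hT : ∑ t, realCharacter h (companion t) = 0 := by
    refine Subtype.ext ((sum_realCharacter_companion h hF hq2 hq4 hν hb).trans ?_)
    rw [hc, Finset.sum_congr rfl ha, Finset.sum_congr rfl hbm]
    have e : q - 1 = 2 * ((q - 2) / 2) + 1 := by obtain ⟨k, hk⟩ := hq; omega
    rw [e, sum_vartheta fun hdvd => by have := Nat.le_of_dvd (by omega) hdvd; omega]
    simp
  have hν1 : ν ≠ 1 := fun h0 => by
    have := orderOf_matA hν
    rw [h0, matA_one, orderOf_one, hF] at this
    omega
  obtain ⟨hne, lam, h0, hsum, hM⟩ := orthModel_orbit hρ (χ := realCharacter h) (fun _ => rfl)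
    (c := 1) (fun x hx => by rw [realCharacter_upper h hx, hX0]) (by rw [h1', hF]; ring)
  refine ⟨hne, fun M => ?_⟩
  obtain ⟨hdim, w, a, ha0, hw⟩ := hM M
  obtain ⟨β, hβ⟩ := exists_basis_principal M.invariant h0 hsum
    (X := fun t => realCharacter h (companion t)) (fun g hg => realCharacter_eq_companion h hg)
    ha0 hw hF h1' hX0 hT hν1
    ((realCharacter_matA_companion h hν1).trans (Subtype.ext (hAν.trans hθ.symm))) hδ hr hs
    (hdim.trans_eq hd)
  have hcard : Fintype.card Fˣ = q - 1 := by rw [Fintype.card_units, hF]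
  have hcard' : Fintype.card {x : Fˣ // x ≠ 1} = q - 2 := by
    rw [Fintype.card_subtype_compl, Fintype.card_subtype_eq, hcard]; omega
  obtain ⟨hC, hA⟩ := M.c_isMatrixOver_of_basis β ha0 hβ 1 (by
    rw [hcard, Fintype.card_fin]
    exact (Nat.Even.sub_odd (by omega) hq2 odd_one).add_even even_two)
  exact ⟨hC, fun m hm => hA.trans (isMatrixOver_principal (m := m) (by omega) _),
    fun h4 h2 h6 => hA.trans (isMatrixOver_principal_four (by omega) three_ne_zero h2 h6)⟩

theorem split_of_isChi {m : ℕ} (hqm : q = 2 ^ (2 * m + 1)) (hq8 : 8 ∣ q) :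
    Nonempty (OrthModel ρ) ∧ ∀ M : OrthModel ρ, M.CliffordDefined ∧
      IsMatrixOver (realCharField ρ) M.c (realCharField ρ) := by
  have hmem := character_mem_real_of_isChi hF hq hν hb hχ
  have hq4 := four_le_card hF hq
  obtain ⟨hdodd, hd1⟩ := odd_and_one_lt_div_gcd hi (even_card hq)
  have hi' := Finset.mem_Icc.mp hi
  have hζ := isPrimitiveRoot_zeta_pow (r := q - 1) (i := i) (by omega) (by omega)
  let θ : realCharField ρ := realCharacter hmem (matA ν)
  have hθ : (θ : ℂ) = vartheta (q - 1) i := character_matA_of_isChi hF hq hν hb hχ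
  have hδ : 4 - θ ^ 2 ≠ 0 := fun h0 => four_sub_sq_ne_zero hdodd hd1 hζ (by
    have := congrArg Subtype.val h0
    push_cast at this
    rwa [hθ] at this)
  have h2 : (2 : realCharField ρ) ≠ 0 := two_ne_zero
  have hqK : (q : realCharField ρ) = 2 * (2 ^ m) ^ 2 := by rw [hqm]; push_cast; ring
  obtain ⟨hne, hM⟩ := orthModel_of_isChi hρ hF hq hν hb hi hχ hθ
    (r := 1 / (2 * 2 ^ m)) (s := 1 / 2 ^ m) (by simp) (by simp)
  refine ⟨hne, fun M => ⟨(hM M).1, ?_⟩⟩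
  obtain ⟨k, hk⟩ := hq8
  have hA := (hM M).2.1 (k - 1) (by omega)
  have e1 : 2 * (q : realCharField ρ) * (1 / (2 * 2 ^ m)) ^ 2 = 1 := by rw [hqK]; field_simp
  have e2 : (q : realCharField ρ) * (4 - θ ^ 2) / 2 * (1 / 2 ^ m) ^ 2 = 4 - θ ^ 2 := by
    rw [hqK]; field_simp
  rw [e1, e2] at hA
  exact hA.trans (quaternion_one_isMatrixOver hδ)

end Principal

end OrthChar
end

noncomputable section
namespace OrthChar

open Matrix

section Principal

variable {F : Type*} [Field F] [Fintype F] [CharP F 2]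
  {V : Type*} [AddCommGroup V] [Module ℂ V] [FiniteDimensional ℂ V]
  {ρ : Representation ℂ (SpecialLinearGroup (Fin 2) F) V} (hρ : ρ.IsIrreducible)
  {q : ℕ} {ν : Fˣ} {b : SpecialLinearGroup (Fin 2) F}
  (hF : Fintype.card F = q) (hq : 4 ∣ q)
  (hν : ∀ x : Fˣ, x ∈ Subgroup.zpowers ν) (hb : orderOf b = q + 1)
  {i : ℕ} (hi : i ∈ Finset.Icc 1 ((q - 2) / 2)) (hχ : IsChi q ν b i ρ.character)

include hρ hF hq hν hb hi hχ

theorem local_of_isChi_of_odd {m : ℕ} (hqm : q = 2 ^ (2 * m + 1)) (hq8 : 8 ∣ q) :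
    Nonempty (OrthModel ρ) ∧
      (∀ M M' : OrthModel ρ, SameBrauerClass (realCharField ρ) M.c M'.c) ∧
      ∀ M : OrthModel ρ, M.CliffordDefined ∧
        ∀ (v : IsDedekindDomain.HeightOneSpectrum (𝓞 (realCharField ρ))) (p : ℕ),
          p.Prime → p ≠ 2 →
          v.asIdeal.comap (algebraMap ℤ (𝓞 (realCharField ρ))) = Ideal.span {(p : ℤ)} →
          (¬ M.LocallyTrivial ρ v ↔
            (p % 8 = 3 ∨ p % 8 = 5) ∧ ∃ k : ℕ, (q - 1) / Nat.gcd (q - 1) i = p ^ k) := by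
  obtain ⟨hne, hM⟩ := split_of_isChi hρ hF hq hν hb hi hχ hqm hq8
  refine ⟨hne, fun M M' => sameBrauerClass_of_isMatrixOver (hM M).2 (hM M').2,
    fun M => ⟨(hM M).1, fun v p hp hp2 _ => iff_of_false ?_ ?_⟩⟩
  · exact not_not.mpr (sameBrauerClass_baseChange_of_split _ (hM M).2)
  · rintro ⟨h8, k, hk⟩
    have hd1 := (odd_and_one_lt_div_gcd hi (even_card hq)).2
    have hk0 : k ≠ 0 := fun h0 => by rw [hk, h0, pow_zero] at hd1; omega
    refine not_mod_eight_of_dvd ⟨m, rfl⟩ hp hp2 ?_ h8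
    rw [← hqm]
    exact (hk ▸ dvd_pow_self p hk0).trans (Nat.div_dvd_of_dvd (Nat.gcd_dvd_left _ _))

theorem local_of_isChi_of_even {m : ℕ} (hqm : q = 2 ^ (2 * m)) :
    Nonempty (OrthModel ρ) ∧
      (∀ M M' : OrthModel ρ, SameBrauerClass (realCharField ρ) M.c M'.c) ∧
      ∀ M : OrthModel ρ, M.CliffordDefined ∧
        ∀ (v : IsDedekindDomain.HeightOneSpectrum (𝓞 (realCharField ρ))) (p : ℕ),
          p.Prime → p ≠ 2 →
          v.asIdeal.comap (algebraMap ℤ (𝓞 (realCharField ρ))) = Ideal.span {(p : ℤ)} →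
          (¬ M.LocallyTrivial ρ v ↔
            (p % 8 = 3 ∨ p % 8 = 5) ∧ ∃ k : ℕ, (q - 1) / Nat.gcd (q - 1) i = p ^ k) := by
  have hmem := character_mem_real_of_isChi hF hq hν hb hχ
  have hq4 := four_le_card hF hq
  obtain ⟨hdodd, hd1⟩ := odd_and_one_lt_div_gcd hi (even_card hq)
  have hi' := Finset.mem_Icc.mp hi
  have hζ := isPrimitiveRoot_zeta_pow (r := q - 1) (i := i) (by omega) (by omega)
  have hE := (realCharField_eq hmem).trans (charField_eq_of_isChi hF hq hν hb hχ)
  obtain ⟨L, _, _, _, z, θ, hz, hcyc, hL, hθz, hθ⟩ :=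
    exists_cyclotomic_quadratic hdodd hd1 hζ (realCharField ρ) hE
  have hδ : 4 - (θ : realCharField ρ) ^ 2 ≠ 0 := fun h0 => four_sub_sq_ne_zero hdodd hd1 hζ (by
    have := congrArg Subtype.val h0
    push_cast at this
    rwa [hθ] at this)
  have hqK : (q : realCharField ρ) = (2 ^ m) ^ 2 := by rw [hqm]; push_cast; ring
  obtain ⟨hne, hM⟩ := orthModel_of_isChi hρ hF hq hν hb hi hχ hθ
    (r := 1 / 2 ^ m) (s := 2 / 2 ^ m) (by simp) (by simp)
  have e1 : 2 * (q : realCharField ρ) * (1 / 2 ^ m) ^ 2 = 2 := by rw [hqK]; field_simp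
  have e2 : (q : realCharField ρ) * (4 - (θ : realCharField ρ) ^ 2) / 2 * (2 / 2 ^ m) ^ 2 =
      2 * (4 - (θ : realCharField ρ) ^ 2) := by rw [hqK]; field_simp
  rw [e1, e2] at hM
  refine ⟨hne, ?_⟩
  by_cases hq' : q = 4
  · have hi1 : i = 1 := by omega
    have hd3 : (q - 1) / Nat.gcd (q - 1) i = 3 := by rw [hq', hi1]; rfl
    rw [hd3] at hz hcyc ⊢
    have hζ3 := hd3 ▸ hζ
    have hθ1 : (θ : realCharField ρ) = -1 := by
      refine Subtype.ext (hθ.trans ?_)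
      have h0 := hζ3.ne_zero (by norm_num)
      have h1 := hζ3.geom_sum_eq_zero (by norm_num)
      simp only [Finset.sum_range_succ, Finset.sum_range_zero, pow_zero, pow_one, zero_add] at h1
      push_cast
      field_simp
      linear_combination h1
    have hA : ∀ M : OrthModel ρ, IsMatrixOver (realCharField ρ) M.c
        (QuaternionAlgebra (realCharField ρ) (-1) 0 (-6)) := fun M =>
      (hM M).2.2 hq' rfl (by rw [hθ1]; norm_num)
    refine ⟨fun M M' => sameBrauerClass_of_isMatrixOver_quaternion (by simp) (by simp) (hA M)
      (hA M'), fun M => ⟨(hM M).1, fun v p hp hp2 hpv => ?_⟩⟩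
    refine not_sameBrauerClass_completion_iff_three hp hp2 hpv hz hθz hL ?_
    have c1 : ((-1 : 𝓞 (realCharField ρ)) : realCharField ρ) = -1 := by simp
    have c2 : ((-6 : 𝓞 (realCharField ρ)) : realCharField ρ) = -6 := by
      change algebraMap (𝓞 (realCharField ρ)) (realCharField ρ) (-6) = -6
      rw [map_neg, map_ofNat]
    rw [c1, c2]
    exact hA M
  · obtain ⟨k, hk⟩ : 8 ∣ q := by
      rw [hqm]
      refine pow_dvd_pow 2 (m := 3) ?_
      by_contra! hlt
      obtain rfl | rfl : m = 0 ∨ m = 1 := by omega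
      · omega
      · exact hq' hqm
    have hA : ∀ M : OrthModel ρ, IsMatrixOver (realCharField ρ) M.c
        (QuaternionAlgebra (realCharField ρ) 2 0 (2 * (4 - (θ : realCharField ρ) ^ 2))) := fun M =>
      (hM M).2.1 (k - 1) (by omega)
    refine ⟨fun M M' => sameBrauerClass_of_isMatrixOver_quaternion two_ne_zero
      (mul_ne_zero two_ne_zero hδ) (hA M) (hA M'),
      fun M => ⟨(hM M).1, fun v p hp hp2 hpv => ?_⟩⟩
    refine not_sameBrauerClass_completion_iff hp hp2 hpv hz hdodd hd1 hθz hL ?_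
    have c1 : ((2 : 𝓞 (realCharField ρ)) : realCharField ρ) = 2 := map_ofNat _ 2
    have c2 : ((2 * (4 - θ ^ 2) : 𝓞 (realCharField ρ)) : realCharField ρ) =
      2 * (4 - (θ : realCharField ρ) ^ 2) := by
      change algebraMap (𝓞 (realCharField ρ)) (realCharField ρ) (2 * (4 - θ ^ 2)) =
        2 * (4 - algebraMap (𝓞 (realCharField ρ)) (realCharField ρ) θ ^ 2)
      rw [map_mul, map_sub, map_pow, map_ofNat, map_ofNat]
    rw [c1, c2]
    exact hA M

end Principal

end OrthChar
end

theorem mainTheorem4 (n : ℕ) (hn : 2 ≤ n) (q : ℕ) (hq : q = 2 ^ n)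
    (F : Type*) [Field F] [Fintype F] (hF : Fintype.card F = q)
    (ν : Fˣ) (hν : ∀ x : Fˣ, x ∈ Subgroup.zpowers ν)
    (b : Matrix.SpecialLinearGroup (Fin 2) F) (hb : orderOf b = q + 1)
    (V : Type*) [AddCommGroup V] [Module ℂ V] [FiniteDimensional ℂ V]
    (ρ : Representation ℂ (Matrix.SpecialLinearGroup (Fin 2) F) V) (hρ : ρ.IsIrreducible) :
    -- the Steinberg character
    (OrthChar.IsPsi q ν b ρ.character →
      OrthChar.charField ρ = ⊥ ∧ OrthChar.realCharField ρ = OrthChar.charField ρ ∧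
      OrthChar.DiscEq ρ ((q : OrthChar.realCharField ρ) + 1)) ∧
    -- the characters `χ_i` of degree `q + 1`
    (∀ i ∈ Finset.Icc 1 ((q - 2) / 2), OrthChar.IsChi q ν b i ρ.character →
      OrthChar.charField ρ = IntermediateField.adjoin ℚ {OrthChar.vartheta (q - 1) i} ∧
      OrthChar.realCharField ρ = OrthChar.charField ρ ∧
      (Odd n → OrthChar.CliffordEq ρ (OrthChar.realCharField ρ)) ∧
      Nonempty (OrthChar.OrthModel ρ) ∧
      (∀ M M' : OrthChar.OrthModel ρ,
        OrthChar.SameBrauerClass (OrthChar.realCharField ρ) M.c M'.c) ∧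
      ∀ M : OrthChar.OrthModel ρ, M.CliffordDefined ∧
        ∀ (v : IsDedekindDomain.HeightOneSpectrum
            (NumberField.RingOfIntegers (OrthChar.realCharField ρ))) (p : ℕ),
          p.Prime → p ≠ 2 →
          v.asIdeal.comap (algebraMap ℤ
            (NumberField.RingOfIntegers (OrthChar.realCharField ρ))) = Ideal.span {(p : ℤ)} →
          (¬ M.LocallyTrivial ρ v ↔
            (p % 8 = 3 ∨ p % 8 = 5) ∧ ∃ k : ℕ, (q - 1) / Nat.gcd (q - 1) i = p ^ k)) ∧
    -- the characters `θ_j` of degree `q - 1`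
    (∀ j ∈ Finset.Icc 1 (q / 2), OrthChar.IsTheta q ν b j ρ.character →
      OrthChar.realCharField ρ = OrthChar.charField ρ ∧
      (q = 4 →
        OrthChar.charField ρ = IntermediateField.adjoin ℚ {((Real.sqrt 5 : ℝ) : ℂ)} ∧
        OrthChar.CliffordEq ρ (QuaternionAlgebra (OrthChar.realCharField ρ) (-1) 0 (-1))) ∧
      (8 ≤ q → OrthChar.CliffordEq ρ (OrthChar.realCharField ρ))) := by
  have hcard : Fintype.card F = 2 ^ n := hF.trans hq
  have := OrthChar.charP_two_of_card hcard
  have hq4 : 4 ∣ q := hq ▸ pow_dvd_pow 2 (m := 2) hn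
  have hq2 : 4 ≤ q := OrthChar.four_le_card hF hq4
  refine ⟨fun hχ => ?_, fun i hi hχ => ?_, fun j hj hχ => ?_⟩
  · have h := OrthChar.charField_eq_bot_of_isPsi hF hq4 hν hb hχ
    refine ⟨h, OrthChar.realCharField_eq fun g => ?_,
      OrthChar.discEq_of_isPsi hρ hF hq4 hν hb hχ⟩
    exact (h ▸ bot_le : OrthChar.charField ρ ≤ OrthChar.realSubfield)
      (OrthChar.character_mem_charField g)
  · refine ⟨OrthChar.charField_eq_of_isChi hF hq4 hν hb hχ,
      OrthChar.realCharField_eq (OrthChar.character_mem_real_of_isChi hF hq4 hν hb hχ), ?_, ?_⟩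
    · rintro ⟨m, rfl⟩
      obtain ⟨hne, hM⟩ := OrthChar.split_of_isChi hρ hF hq4 hν hb hi hχ hq
        (hq ▸ pow_dvd_pow 2 (m := 3) (by omega))
      exact ⟨hne, fun M => ⟨(hM M).1,
        OrthChar.sameBrauerClass_of_isMatrixOver (hM M).2 (.of_equiv .refl)⟩⟩
    · rcases Nat.even_or_odd' n with ⟨m, rfl | rfl⟩
      · exact OrthChar.local_of_isChi_of_even hρ hF hq4 hν hb hi hχ hq
      · exact OrthChar.local_of_isChi_of_odd hρ hF hq4 hν hb hi hχ hq
          (hq ▸ pow_dvd_pow 2 (m := 3) (by omega))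
  · refine ⟨OrthChar.realCharField_eq
      (OrthChar.character_mem_real_of_isTheta hF hq4 hν hb hχ), fun h4 => ?_, fun h8 => ?_⟩
    · exact ⟨OrthChar.charField_eq_of_isTheta_four hF hq4 hν hb hj hχ h4,
        OrthChar.cliffordEq_of_isTheta_four hρ hF hq4 hν hb hχ h4⟩
    · refine OrthChar.cliffordEq_of_isTheta hρ hF hq4 hν hb hχ
        (hq ▸ pow_dvd_pow 2 (m := 3) ?_)
      by_contra! hlt
      have : n = 2 := by omega
      subst this
      omega
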